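/- Let $\Sigma=\{1,\dots,\sigma\}$ be an ordered alphabet and let $G=(V,E)$, $E\subseteq V\times V\times\Sigma$, be a finite directed edge-labeled graph with $n=|V|\ge 1$ nodes. Call $G$ \emph{deterministic} if the edges from a node to distinct nodes carry distinct labels, and a \emph{pseudoforest} if every node has exactly one incoming edge; then $\lambda(u)$ denotes the label of the edge entering $u$. A strict total order $<$ on $V$ is a \emph{Wheeler order} if (1) nodes of in-degree $0$ precede all nodes of positive in-degree; (2) for $(u',u,a),(v',v,b)\in E$ with $u<v$ we have $a\le b$; (3) for $(u',u,a),(v',v,a)\in E$ with $u<v$ we have $u'\le v'$. For a node $u$, let $\inf_u\in\Sigma^*\cup\Sigma^\omega$ be the lexicographic infimum of the set of strings read by following edges backwards from $u$, either forever or until a node of in-degree $0$ is reached. If the strings $\inf_u$, $u\in V$, are pairwise distinct, let $\gamma_1^*\prec\dots\prec\gamma_n^*$ be these strings in lexicographic order; the \emph{reduced LCP array} of $G$ is $\mathsf{LCP}^*_G[i]=\mathsf{lcp}(\gamma^*_{i-1},\gamma^*_i)$ for $2\le i\le n$, where $\mathsf{lcp}$ is the length of the longest common prefix. Let $G$ be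 a deterministic pseudoforest with Wheeler order $v_1<\dots<v_n$ and with $\inf_u\ne\inf_v$ for all $u\ne v$. Suppose that $n$ and $\sigma$ are given and that $G$ is represented by an FM-index, that is, a data structure answering each of the following queries in $O(\log\sigma)$ time: (a) given $1<i\le n$ and $c\in\Sigma$, return the $i'$ such that $(v_k,v_{i'},c)\in E$, where $k\ge i$ is smallest such that $v_k$ has an outgoing edge labeled $c$, or $\bot$ if there is no such $k$; (b) given $i$ and $j$, return the $j$-th smallest label of the edges leaving $v_i$, or $\bot$ if $j$ exceeds the out-degree of $v_i$; (c) given $i$, return $\lambda(v_i)$. Then, on a word RAM with words of $\Theta(\log(n+\sigma))$ bits, $\mathsf{LCP}^*_G$ can be computed in $O(n\log\sigma)$ time and $O(n\log\sigma)$ bits of working space on top of the input, where $\log\sigma$ is read as $1$ if $\sigma=1$. No memory is allocated for the output array: its entries are streamed to a write-only output as pairs $(i,\mathsf{LCP}^*_G[i])$, exactly one for each $2\le i\le n$, in nondecreasing order of the second component. -/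

import Mathlib

namespace WheelerLCP

/-! ## Strings -/

/-- Finite and right-infinite strings over the ordered alphabet `Fin σ`: a string is the function
giving its characters (positions counted from `0`), extended by `⊥` after its end. The order
inherited from `Lex (ℕ → WithBot (Fin σ))` is the lexicographic order, in which a proper prefix of
a string precedes it. -/
abbrev Str (σ : ℕ) : Type :=
  {a : Lex (ℕ → WithBot (Fin σ)) // ∀ k, ofLex a k = ⊥ → ofLex a (k + 1) = ⊥}

/-- The character at position `k`, or `⊥` beyond the end. -/
def Str.at {σ : ℕ} (a : Str σ) (k : ℕ) : WithBot (Fin σ) := ofLex a.1 k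

/-- The empty string. -/
def Str.empty (σ : ℕ) : Str σ := ⟨toLex fun _ => ⊥, fun _ _ => rfl⟩

instance (σ : ℕ) : Nonempty (Str σ) := ⟨Str.empty σ⟩

/-- The two strings have a common prefix of length `k`. -/
def Str.CommonPrefix {σ : ℕ} (a b : Str σ) (k : ℕ) : Prop :=
  ∀ j < k, a.at j = b.at j ∧ a.at j ≠ ⊥

/-- Length of the longest common prefix (`⊤` for two equal infinite strings). -/
noncomputable def Str.lcp {σ : ℕ} (a b : Str σ) : ℕ∞ :=
  ⨆ (k : ℕ) (_ : Str.CommonPrefix a b k), (k : ℕ∞)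

/-! ## Labeled graphs -/

/-- A directed edge-labeled graph: a set of triples (origin, target, label). -/
structure LabeledGraph (V : Type*) (σ : ℕ) where
  E : Set (V × V × Fin σ)

namespace LabeledGraph

variable {V : Type*} {σ : ℕ}

noncomputable def inDeg (G : LabeledGraph V σ) (u : V) : ℕ := {e ∈ G.E | e.2.1 = u}.ncard

def Deterministic (G : LabeledGraph V σ) : Prop :=
  ∀ u v₁ v₂ a b, (u, v₁, a) ∈ G.E → (u, v₂, b) ∈ G.E → v₁ ≠ v₂ → a ≠ b

def IsPseudoforest (G : LabeledGraph V σ) : Prop := ∀ u, G.inDeg u = 1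

/-- `lt` is a strict total order satisfying the three Wheeler axioms. -/
structure IsWheelerOrder (G : LabeledGraph V σ) (lt : V → V → Prop) : Prop where
  total : IsStrictTotalOrder V lt
  source_lt : ∀ u v, G.inDeg u = 0 → 0 < G.inDeg v → lt u v
  label_le : ∀ u' u a v' v b, (u', u, a) ∈ G.E → (v', v, b) ∈ G.E → lt u v → a ≤ b
  origin_le : ∀ u' u v' v a, (u', u, a) ∈ G.E → (v', v, a) ∈ G.E → lt u v → lt u' v' ∨ u' = v'

/-- Infinite strings read by following edges backwards from `u` forever. -/
def omegaStrings (G : LabeledGraph V σ) (u : V) : Set (Str σ) :=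
  {α | ∃ p : ℕ → V, p 0 = u ∧ ∀ i, ∃ c : Fin σ, α.at i = c ∧ (p (i + 1), p i, c) ∈ G.E}

/-- Finite strings read by following edges backwards from `u` up to a source
(only the empty string if `u` is itself a source). -/
def finiteStrings (G : LabeledGraph V σ) (u : V) : Set (Str σ) :=
  {α | ∃ (m : ℕ) (p : ℕ → V), p 0 = u ∧ G.inDeg (p m) = 0 ∧
    (∀ i < m, ∃ c : Fin σ, α.at i = c ∧ (p (i + 1), p i, c) ∈ G.E) ∧ ∀ i, m ≤ i → α.at i = ⊥}

/-- The set of all strings leaving `u` backwards. -/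
def backStrings (G : LabeledGraph V σ) (u : V) : Set (Str σ) :=
  G.omegaStrings u ∪ G.finiteStrings u

/-- The infimum string of `u`: the greatest lower bound of the strings leaving `u` backwards. -/
noncomputable def infStr (G : LabeledGraph V σ) (u : V) : Str σ :=
  Classical.epsilon fun γ => IsGLB (G.backStrings u) γ

open Classical in
/-- The infimum strings of all nodes, sorted lexicographically. -/
noncomputable def sortedInfima [Fintype V] (G : LabeledGraph V σ) : List (Str σ) :=
  (Finset.univ.image G.infStr).sort (· ≤ ·)

/-- Entry `i` of the reduced LCP array, `2 ≤ i ≤ n`, where the sorted infimum strings are numbered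
from `1`: the longest common prefix of the strings number `i - 1` and `i`. -/
noncomputable def reducedLCP [Fintype V] (G : LabeledGraph V σ) (i : ℕ) : ℕ∞ :=
  Str.lcp (G.sortedInfima.getD (i - 2) (Str.empty σ)) (G.sortedInfima.getD (i - 1) (Str.empty σ))

def HasOut (G : LabeledGraph V σ) (u : V) (c : Fin σ) : Prop := ∃ u', (u, u', c) ∈ G.E

open Classical in
/-- The labels of the edges leaving `u`, in increasing order. -/
noncomputable def outl (G : LabeledGraph V σ) (u : V) : List (Fin σ) :=
  (Finset.univ.filter fun c => G.HasOut u c).sort (· ≤ ·)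

end LabeledGraph

/-! ## Queries of the FM-index

Let `v` list the nodes in the Wheeler order. In the queries the nodes are numbered `1, …, n`,
the characters `1, …, σ` (so node number `i` is `v` at `i - 1`, likewise for characters), and `0`
stands for the answer "undefined". -/

/-- The queries through which the index can be accessed. -/
structure FMIndex where
  forwardStep : ℕ → ℕ → ℕ
  outLabel : ℕ → ℕ → ℕ
  inLabel : ℕ → ℕ

namespace FMIndex

variable {V : Type*} {σ n : ℕ}

/-- The possible answers to the forward step from `i` by `c`: the number of the node reached by
the `c`-edge that leaves the first node with number `≥ i` having an outgoing `c`-edge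
(at most one answer if the graph is deterministic). -/
def forwardAnswers (G : LabeledGraph V σ) (v : Fin n ≃ V) (i c : ℕ) : Set ℕ :=
  {r | 1 < i ∧ ∃ (k t : Fin n) (a : Fin σ), (a : ℕ) + 1 = c ∧ (t : ℕ) + 1 = r ∧
    i ≤ (k : ℕ) + 1 ∧ (v k, v t, a) ∈ G.E ∧
    ∀ l : Fin n, i ≤ (l : ℕ) + 1 → l < k → ¬ G.HasOut (v l) a}

/-- The possible answers to the query for the label of the edge entering node number `i`
(exactly one in a pseudoforest, if `1 ≤ i ≤ n`). -/
def inLabelAnswers (G : LabeledGraph V σ) (v : Fin n ≃ V) (i : ℕ) : Set ℕ :=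
  {r | ∃ (k : Fin n) (a : Fin σ), (k : ℕ) + 1 = i ∧ (a : ℕ) + 1 = r ∧ ∃ u, (u, v k, a) ∈ G.E}

/-- The index of `G` with respect to the node order `v`. (Here `sInf` picks the only element of the
set of answers, and is `0` if there is none.) The query `outLabel i j` asks for the `j`-th outgoing
label of node number `i`, and is undefined if `j` exceeds the out-degree. -/
noncomputable def ofGraph (G : LabeledGraph V σ) (v : Fin n ≃ V) : FMIndex where
  forwardStep i c := sInf (forwardAnswers G v i c)
  outLabel i j :=
    if h : 1 ≤ j ∧ 1 ≤ i ∧ i - 1 < n then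
      ((G.outl (v ⟨i - 1, h.2.2⟩)).map fun a => (a : ℕ) + 1).getD (j - 1) 0
    else 0
  inLabel i := sInf (inLabelAnswers G v i)

end FMIndex

/-! ## Word RAM

A word RAM with words of `w` bits. A program has finitely many registers of one word each, a
random-access working memory of words, read-only access to the input through the queries of an
index, and a write-only output stream of pairs of words. -/

/-- Number of binary digits of `x ≥ 1`; it stands for `log x`, and is at least `1`. -/
def lg (x : ℕ) : ℕ := Nat.log 2 x + 1

/-- Operations on words. -/
inductive BinOp
  | add | sub | mul | div | mod | and | or | xor | shl | shr | lt | eq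

def BinOp.eval (w : ℕ) : BinOp → ℕ → ℕ → ℕ
  | .add, a, b => (a + b) % 2 ^ w
  | .sub, a, b => (a + 2 ^ w - b) % 2 ^ w
  | .mul, a, b => (a * b) % 2 ^ w
  | .div, a, b => a / b
  | .mod, a, b => a % b
  | .and, a, b => a &&& b
  | .or, a, b => a ||| b
  | .xor, a, b => a ^^^ b
  | .shl, a, b => (a <<< b) % 2 ^ w
  | .shr, a, b => a >>> b
  | .lt, a, b => if a < b then 1 else 0
  | .eq, a, b => if a = b then 1 else 0

/-- Expressions over constants and registers. -/
inductive Expr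
  | const (k : ℕ)
  | reg (x : ℕ)
  | op (o : BinOp) (e₁ e₂ : Expr)

def Expr.eval (w : ℕ) (ρ : ℕ → ℕ) : Expr → ℕ
  | .const k => k % 2 ^ w
  | .reg x => ρ x
  | .op o e₁ e₂ => o.eval w (e₁.eval w ρ) (e₂.eval w ρ)

/-- Time to evaluate an expression: one step per constant, register and operation. -/
def Expr.time : Expr → ℕ
  | .const _ => 1
  | .reg _ => 1
  | .op _ e₁ e₂ => e₁.time + e₂.time + 1

/-- A bound on the registers occurring in an expression. -/
def Expr.regs : Expr → ℕ
  | .const _ => 0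
  | .reg x => x + 1
  | .op _ e₁ e₂ => max e₁.regs e₂.regs

/-- Programs. -/
inductive Prog
  | skip
  | assign (x : ℕ) (e : Expr)
  | load (x : ℕ) (addr : Expr)
  | store (addr e : Expr)
  | output (e₁ e₂ : Expr)
  | forwardStep (x : ℕ) (i c : Expr)
  | outLabel (x : ℕ) (i j : Expr)
  | inLabel (x : ℕ) (i : Expr)
  | seq (P Q : Prog)
  | ite (e : Expr) (P Q : Prog)
  | while (e : Expr) (P : Prog)

/-- Number of registers of a program (registers are numbered from `0`). -/
def Prog.regs : Prog → ℕ
  | .skip => 0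
  | .assign x e => max (x + 1) e.regs
  | .load x a => max (x + 1) a.regs
  | .store a e => max a.regs e.regs
  | .output e₁ e₂ => max e₁.regs e₂.regs
  | .forwardStep x i c => max (x + 1) (max i.regs c.regs)
  | .outLabel x i j => max (x + 1) (max i.regs j.regs)
  | .inLabel x i => max (x + 1) i.regs
  | .seq P Q => max P.regs Q.regs
  | .ite e P Q => max e.regs (max P.regs Q.regs)
  | .while e P => max e.regs P.regs

/-- Configurations. All working-memory addresses accessed so far are smaller than `peak`, and
`out` is the list of pairs output so far, in order. -/
structure Config where
  reg : ℕ → ℕ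
  mem : ℕ → ℕ
  peak : ℕ
  out : List (ℕ × ℕ)

namespace Config

def setReg (w : ℕ) (s : Config) (x a : ℕ) : Config :=
  { s with reg := Function.update s.reg x (a % 2 ^ w) }

/-- Record an access to the memory cell with address `a`. -/
def touch (s : Config) (a : ℕ) : Config := { s with peak := max s.peak (a + 1) }

def setMem (s : Config) (a b : ℕ) : Config := { s with mem := Function.update s.mem a b }

def emit (s : Config) (p : ℕ × ℕ) : Config := { s with out := s.out ++ [p] }

/-- Value of an expression. -/
def val (w : ℕ) (s : Config) (e : Expr) : ℕ := e.eval w s.reg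

/-- Initial configuration: registers `0`, `1`, `2` hold the number of nodes, the alphabet size and
the word size; all else is `0`. -/
def init (w n σ : ℕ) : Config where
  reg x := (if x = 0 then n else if x = 1 then σ else if x = 2 then w else 0) % 2 ^ w
  mem _ := 0
  peak := 0
  out := []

end Config

/-- `Exec w q D P s t s'`: on words of `w` bits and with the index `D`, each query of which takes
`q` time units, the program `P` started in configuration `s` halts after `t` time units in
configuration `s'`. -/
inductive Exec (w q : ℕ) (D : FMIndex) : Prog → Config → ℕ → Config → Prop
  | skip (s : Config) : Exec w q D .skip s 1 s
  | assign (s : Config) (x : ℕ) (e : Expr) :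
      Exec w q D (.assign x e) s (e.time + 1) (s.setReg w x (s.val w e))
  | load (s : Config) (x : ℕ) (a : Expr) :
      Exec w q D (.load x a) s (a.time + 1)
        ((s.touch (s.val w a)).setReg w x (s.mem (s.val w a)))
  | store (s : Config) (a e : Expr) :
      Exec w q D (.store a e) s (a.time + e.time + 1)
        ((s.touch (s.val w a)).setMem (s.val w a) (s.val w e))
  | output (s : Config) (e₁ e₂ : Expr) :
      Exec w q D (.output e₁ e₂) s (e₁.time + e₂.time + 1) (s.emit (s.val w e₁, s.val w e₂))
  | forwardStep (s : Config) (x : ℕ) (i c : Expr) :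
      Exec w q D (.forwardStep x i c) s (i.time + c.time + q + 1)
        (s.setReg w x (D.forwardStep (s.val w i) (s.val w c)))
  | outLabel (s : Config) (x : ℕ) (i j : Expr) :
      Exec w q D (.outLabel x i j) s (i.time + j.time + q + 1)
        (s.setReg w x (D.outLabel (s.val w i) (s.val w j)))
  | inLabel (s : Config) (x : ℕ) (i : Expr) :
      Exec w q D (.inLabel x i) s (i.time + q + 1) (s.setReg w x (D.inLabel (s.val w i)))
  | seq {P Q : Prog} {s s₁ s₂ : Config} {t₁ t₂ : ℕ} :
      Exec w q D P s t₁ s₁ → Exec w q D Q s₁ t₂ s₂ → Exec w q D (.seq P Q) s (t₁ + t₂) s₂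
  | ite_true {e : Expr} {P Q : Prog} {s s₁ : Config} {t : ℕ} :
      s.val w e ≠ 0 → Exec w q D P s t s₁ → Exec w q D (.ite e P Q) s (e.time + 1 + t) s₁
  | ite_false {e : Expr} {P Q : Prog} {s s₁ : Config} {t : ℕ} :
      s.val w e = 0 → Exec w q D Q s t s₁ → Exec w q D (.ite e P Q) s (e.time + 1 + t) s₁
  | while_false {e : Expr} {P : Prog} {s : Config} :
      s.val w e = 0 → Exec w q D (.while e P) s (e.time + 1) s
  | while_true {e : Expr} {P : Prog} {s s₁ s₂ : Config} {t₁ t₂ : ℕ} :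
      s.val w e ≠ 0 → Exec w q D P s t₁ s₁ → Exec w q D (.while e P) s₁ t₂ s₂ →
      Exec w q D (.while e P) s (e.time + 1 + t₁ + t₂) s₂

/-- Working space, in bits, of a run of `P` ending in `s`: all registers, and all cells of the
working memory up to the largest address accessed. -/
def workingBits (w : ℕ) (P : Prog) (s : Config) : ℕ := w * (P.regs + s.peak)

/-- The list consists of the pairs `(i, LCP*[i])`, one for each `2 ≤ i ≤ n`, in nondecreasing order
of their second components. -/
structure StreamsReducedLCP {V : Type*} [Fintype V] {σ : ℕ} (G : LabeledGraph V σ)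
    (out : List (ℕ × ℕ)) : Prop where
  nodup : (out.map Prod.fst).Nodup
  mem_iff : ∀ i, i ∈ out.map Prod.fst ↔ 2 ≤ i ∧ i ≤ Fintype.card V
  value : ∀ p ∈ out, (p.2 : ℕ∞) = G.reducedLCP p.1
  sorted : out.Pairwise fun p p' => p.2 ≤ p'.2

end WheelerLCP

open WheelerLCP

namespace WheelerLCP

set_option linter.constructorNameAsVariable false

/-! ## A small imperative language compiled to word RAM programs -/

/-- Program variables; each is kept in a register of its own. -/
inductive Var
  | n | sg | wd | b | pw | m | h | hp | nn | hn | i | j | c | e | st | x | y | z | u | g | acc | a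
  | k | sp | cc | nc | par | lev | go | r1 | r2 | r3 | p | prev
  deriving DecidableEq

/-- Arrays; they are interleaved in the working memory. -/
inductive Arr
  | pop | sz | lab | cnt | mark | bits | dir | set | que | stk
  deriving DecidableEq

def Var.idx (x : Var) : ℕ := x.ctorIdx

def Arr.idx (r : Arr) : ℕ := r.ctorIdx

theorem Var.idx_injective : Function.Injective Var.idx := by
  intro x y h
  have hx : Var.ofNat x.idx = x := Var.ofNat_ctorIdx x
  have hy : Var.ofNat y.idx = y := Var.ofNat_ctorIdx y
  rw [← hx, ← hy, h]

theorem Arr.idx_lt (r : Arr) : r.idx < 16 := by cases r <;> decide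

theorem Arr.idx_injective : Function.Injective Arr.idx := by
  intro x y h
  have hx : Arr.ofNat x.idx = x := Arr.ofNat_ctorIdx x
  have hy : Arr.ofNat y.idx = y := Arr.ofNat_ctorIdx y
  rw [← hx, ← hy, h]

/-- Value of an operation in the absence of overflow. -/
def BinOp.ideal : BinOp → ℕ → ℕ → ℕ
  | .add, a, b => a + b
  | .sub, a, b => a - b
  | .mul, a, b => a * b
  | .div, a, b => a / b
  | .mod, a, b => a % b
  | .and, a, b => a &&& b
  | .or, a, b => a ||| b
  | .xor, a, b => a ^^^ b
  | .shl, a, b => a * 2 ^ b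
  | .shr, a, b => a / 2 ^ b
  | .lt, a, b => if a < b then 1 else 0
  | .eq, a, b => if a = b then 1 else 0

/-- Conditions under which an operation does not overflow words with values below `W`. -/
def BinOp.Safe (W : ℕ) : BinOp → ℕ → ℕ → Prop
  | .add, a, b => a + b < W
  | .sub, a, b => b ≤ a ∧ a < W
  | .mul, a, b => a * b < W
  | .shl, a, b => a * 2 ^ b < W
  | _, _, _ => True

theorem BinOp.eval_eq_ideal {w : ℕ} {o : BinOp} {a b : ℕ} (h : o.Safe (2 ^ w) a b) :
    o.eval w a b = o.ideal a b := by
  cases o <;> simp only [BinOp.Safe] at h <;> simp only [BinOp.eval, BinOp.ideal]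
  · exact Nat.mod_eq_of_lt h
  · rw [show a + 2 ^ w - b = a - b + 2 ^ w by omega, Nat.add_mod_right]
    exact Nat.mod_eq_of_lt (by omega)
  · exact Nat.mod_eq_of_lt h
  · rw [Nat.shiftLeft_eq]; exact Nat.mod_eq_of_lt h
  · exact Nat.shiftRight_eq_div_pow a b

/-- Expressions over program variables. -/
inductive Ex
  | lit (k : ℕ)
  | var (x : Var)
  | op (o : BinOp) (a b : Ex)

instance (k : ℕ) : OfNat Ex k := ⟨.lit k⟩
instance : Add Ex := ⟨.op .add⟩
instance : Sub Ex := ⟨.op .sub⟩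
instance : Mul Ex := ⟨.op .mul⟩
instance : Div Ex := ⟨.op .div⟩
instance : Mod Ex := ⟨.op .mod⟩

namespace Ex

def toExpr : Ex → Expr
  | lit k => .const k
  | var x => .reg x.idx
  | op o a b => .op o a.toExpr b.toExpr

def ev (ρ : Var → ℕ) : Ex → ℕ
  | lit k => k
  | var x => ρ x
  | op o a b => o.ideal (a.ev ρ) (b.ev ρ)

def Safe (W : ℕ) (ρ : Var → ℕ) : Ex → Prop
  | lit k => k < W
  | var _ => True
  | op o a b => a.Safe W ρ ∧ b.Safe W ρ ∧ o.Safe W (a.ev ρ) (b.ev ρ)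

def time : Ex → ℕ
  | lit _ => 1
  | var _ => 1
  | op _ a b => a.time + b.time + 1

theorem time_toExpr (e : Ex) : e.toExpr.time = e.time := by
  induction e <;> simp_all [toExpr, Expr.time, time]

theorem eval_toExpr {w : ℕ} {ρ : Var → ℕ} {f : ℕ → ℕ} (hf : ∀ x, f (Var.idx x) = ρ x) {e : Ex}
    (h : e.Safe (2 ^ w) ρ) : e.toExpr.eval w f = e.ev ρ := by
  induction e with
  | lit k => exact Nat.mod_eq_of_lt h
  | var x => exact hf x
  | op o a b iha ihb =>
    obtain ⟨ha, hb, ho⟩ := h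
    simp only [toExpr, Expr.eval, ev, iha ha, ihb hb]
    exact BinOp.eval_eq_ideal ho

end Ex

/-- States: values of the variables and arrays, and the output so far. -/
structure St where
  v : Var → ℕ
  a : Arr → ℕ → ℕ
  out : List (ℕ × ℕ)

namespace St

def set (S : St) (x : Var) (y : ℕ) : St := { S with v := Function.update S.v x y }

def put (S : St) (r : Arr) (k y : ℕ) : St :=
  { S with a := Function.update S.a r (Function.update (S.a r) k y) }

def emit (S : St) (p : ℕ × ℕ) : St := { S with out := S.out ++ [p] }

@[simp] theorem set_v_self (S : St) (x : Var) (y : ℕ) : (S.set x y).v x = y := by simp [set]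

@[simp] theorem set_v_ne (S : St) {x z : Var} (y : ℕ) (h : z ≠ x) : (S.set x y).v z = S.v z := by
  simp [set, h]

@[simp] theorem set_a (S : St) (x : Var) (y : ℕ) : (S.set x y).a = S.a := rfl
@[simp] theorem set_out (S : St) (x : Var) (y : ℕ) : (S.set x y).out = S.out := rfl
@[simp] theorem put_v (S : St) (r : Arr) (k y : ℕ) : (S.put r k y).v = S.v := rfl
@[simp] theorem put_out (S : St) (r : Arr) (k y : ℕ) : (S.put r k y).out = S.out := rfl

@[simp] theorem put_a_self (S : St) (r : Arr) (k y : ℕ) :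
    (S.put r k y).a r = Function.update (S.a r) k y := by simp [put]

@[simp] theorem put_a_ne (S : St) {r r' : Arr} (k y : ℕ) (h : r' ≠ r) :
    (S.put r k y).a r' = S.a r' := by simp [put, h]

@[simp] theorem emit_v (S : St) (p : ℕ × ℕ) : (S.emit p).v = S.v := rfl
@[simp] theorem emit_a (S : St) (p : ℕ × ℕ) : (S.emit p).a = S.a := rfl
@[simp] theorem emit_out (S : St) (p : ℕ × ℕ) : (S.emit p).out = S.out ++ [p] := rfl

end St

/-- Commands. -/
inductive Cmd
  | skip
  | asg (x : Var) (e : Ex)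
  | ld (x : Var) (r : Arr) (i : Ex)
  | sto (r : Arr) (i e : Ex)
  | outp (e₁ e₂ : Ex)
  | outL (x : Var) (i j : Ex)
  | inL (x : Var) (i : Ex)
  | seq (P Q : Cmd)
  | ite (e : Ex) (P Q : Cmd)
  | wh (e : Ex) (P : Cmd)

infixr:60 ";;" => Cmd.seq

/-- Parameters of a machine: a bound for the values of words, a bound for the array indices, the
cost of a query, and the index. -/
structure Mach where
  W : ℕ
  X : ℕ
  q : ℕ
  D : FMIndex

namespace Cmd

def addr (r : Arr) (i : Ex) : Expr := .op .add (.op .mul (.const 16) i.toExpr) (.const r.idx)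

def compile : Cmd → Prog
  | skip => .skip
  | asg x e => .assign x.idx e.toExpr
  | ld x r i => .load x.idx (addr r i)
  | sto r i e => .store (addr r i) e.toExpr
  | outp e₁ e₂ => .output e₁.toExpr e₂.toExpr
  | outL x i j => .outLabel x.idx i.toExpr j.toExpr
  | inL x i => .inLabel x.idx i.toExpr
  | seq P Q => .seq P.compile Q.compile
  | ite e P Q => .ite e.toExpr P.compile Q.compile
  | wh e P => .while e.toExpr P.compile

/-- Variables assigned by a command. -/
def wr (x : Var) : Cmd → Bool
  | asg y _ | ld y _ _ | outL y _ _ | inL y _ => x == y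
  | seq P Q | ite _ P Q => P.wr x || Q.wr x
  | wh _ P => P.wr x
  | skip | sto _ _ _ | outp _ _ => false

/-- Arrays written by a command. -/
def wa (r : Arr) : Cmd → Bool
  | sto y _ _ => r == y
  | seq P Q | ite _ P Q => P.wa r || Q.wa r
  | wh _ P => P.wa r
  | _ => false

/-- Whether a command can output. -/
def emits : Cmd → Bool
  | outp _ _ => true
  | seq P Q | ite _ P Q => P.emits || Q.emits
  | wh _ P => P.emits
  | _ => false

end Cmd

/-- Big-step semantics of commands with ideal arithmetic, restricted to runs without overflow. -/
inductive BS (μ : Mach) : Cmd → St → ℕ → St → Prop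
  | skip (S : St) : BS μ .skip S 1 S
  | asg (S : St) (x : Var) (e : Ex) : e.Safe μ.W S.v → e.ev S.v < μ.W →
      BS μ (.asg x e) S (e.time + 1) (S.set x (e.ev S.v))
  | ld (S : St) (x : Var) (r : Arr) (i : Ex) : i.Safe μ.W S.v → i.ev S.v < μ.X →
      S.a r (i.ev S.v) < μ.W → BS μ (.ld x r i) S (i.time + 5) (S.set x (S.a r (i.ev S.v)))
  | sto (S : St) (r : Arr) (i e : Ex) : i.Safe μ.W S.v → i.ev S.v < μ.X → e.Safe μ.W S.v →
      BS μ (.sto r i e) S (i.time + e.time + 5) (S.put r (i.ev S.v) (e.ev S.v))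
  | outp (S : St) (e₁ e₂ : Ex) : e₁.Safe μ.W S.v → e₂.Safe μ.W S.v →
      BS μ (.outp e₁ e₂) S (e₁.time + e₂.time + 1) (S.emit (e₁.ev S.v, e₂.ev S.v))
  | outL (S : St) (x : Var) (i j : Ex) : i.Safe μ.W S.v → j.Safe μ.W S.v →
      μ.D.outLabel (i.ev S.v) (j.ev S.v) < μ.W →
      BS μ (.outL x i j) S (i.time + j.time + μ.q + 1)
        (S.set x (μ.D.outLabel (i.ev S.v) (j.ev S.v)))
  | inL (S : St) (x : Var) (i : Ex) : i.Safe μ.W S.v → μ.D.inLabel (i.ev S.v) < μ.W →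
      BS μ (.inL x i) S (i.time + μ.q + 1) (S.set x (μ.D.inLabel (i.ev S.v)))
  | seq {P Q : Cmd} {S S₁ S₂ : St} {t₁ t₂ : ℕ} :
      BS μ P S t₁ S₁ → BS μ Q S₁ t₂ S₂ → BS μ (.seq P Q) S (t₁ + t₂) S₂
  | ite_true {e : Ex} {P Q : Cmd} {S S₁ : St} {t : ℕ} : e.Safe μ.W S.v →
      e.ev S.v ≠ 0 → BS μ P S t S₁ → BS μ (.ite e P Q) S (e.time + 1 + t) S₁
  | ite_false {e : Ex} {P Q : Cmd} {S S₁ : St} {t : ℕ} : e.Safe μ.W S.v →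
      e.ev S.v = 0 → BS μ Q S t S₁ → BS μ (.ite e P Q) S (e.time + 1 + t) S₁
  | wh_false {e : Ex} {P : Cmd} {S : St} : e.Safe μ.W S.v →
      e.ev S.v = 0 → BS μ (.wh e P) S (e.time + 1) S
  | wh_true {e : Ex} {P : Cmd} {S S₁ S₂ : St} {t₁ t₂ : ℕ} : e.Safe μ.W S.v →
      e.ev S.v ≠ 0 → BS μ P S t₁ S₁ → BS μ (.wh e P) S₁ t₂ S₂ →
      BS μ (.wh e P) S (e.time + 1 + t₁ + t₂) S₂

/-- The configuration `s` represents the state `S`, with memory accesses only to array indices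
below `X`. -/
structure Rep (X : ℕ) (s : Config) (S : St) : Prop where
  reg : ∀ x, s.reg (Var.idx x) = S.v x
  mem : ∀ r k, s.mem (16 * k + Arr.idx r) = S.a r k
  out : s.out = S.out
  peak : s.peak ≤ 16 * X

namespace Rep

variable {X w : ℕ} {s : Config} {S : St}

theorem setReg (h : Rep X s S) (x : Var) {y : ℕ} (hy : y < 2 ^ w) :
    Rep X (s.setReg w x.idx y) (S.set x y) := by
  refine ⟨fun z => ?_, h.mem, h.out, h.peak⟩
  by_cases hz : z = x
  · subst hz; simp [Config.setReg, Nat.mod_eq_of_lt hy]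
  · have : z.idx ≠ x.idx := fun e => hz (Var.idx_injective e)
    simp [Config.setReg, this, hz, h.reg]

theorem touch (h : Rep X s S) {k : ℕ} (r : Arr) (hk : k < X) :
    Rep X (s.touch (16 * k + r.idx)) S := by
  refine ⟨h.reg, h.mem, h.out, ?_⟩
  have := r.idx_lt
  have := h.peak
  simp only [Config.touch]
  omega

theorem setMem (h : Rep X s S) (r : Arr) (k y : ℕ) :
    Rep X (s.setMem (16 * k + r.idx) y) (S.put r k y) := by
  refine ⟨h.reg, fun r' k' => ?_, h.out, h.peak⟩
  have h1 := r.idx_lt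
  have h2 := r'.idx_lt
  by_cases hr : r' = r
  · subst hr
    by_cases hk : k' = k
    · subst hk; simp [Config.setMem]
    · have : 16 * k' + r'.idx ≠ 16 * k + r'.idx := by omega
      simp [Config.setMem, hk, h.mem]
  · have hne : r'.idx ≠ r.idx := fun e => hr (Arr.idx_injective e)
    have : 16 * k' + r'.idx ≠ 16 * k + r.idx := by omega
    simp [Config.setMem, this, hr, h.mem]

theorem val_addr (h : Rep X s S) (hX : 16 * X ≤ 2 ^ w) (hW : 16 < 2 ^ w) {r : Arr} {i : Ex}
    (hs : i.Safe (2 ^ w) S.v) (hi : i.ev S.v < X) :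
    s.val w (Cmd.addr r i) = 16 * i.ev S.v + r.idx := by
  have := r.idx_lt
  simp only [Config.val, Cmd.addr, Expr.eval, Ex.eval_toExpr h.reg hs, BinOp.eval]
  rw [Nat.mod_eq_of_lt hW, Nat.mod_eq_of_lt (a := r.idx) (by omega),
    Nat.mod_eq_of_lt (a := 16 * _) (by omega), Nat.mod_eq_of_lt (by omega)]

end Rep

/-- Runs of commands are runs of the compiled programs. -/
theorem BS.exec {μ : Mach} {w : ℕ} (hw : μ.W = 2 ^ w) (hX : 16 * μ.X ≤ 2 ^ w) (hW : 16 < 2 ^ w)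
    {c : Cmd} {S S' : St} {t : ℕ} (h : BS μ c S t S') :
    ∀ s, Rep μ.X s S → ∃ s', Exec w μ.q μ.D c.compile s t s' ∧ Rep μ.X s' S' := by
  induction h with
  | skip S => exact fun s hs => ⟨s, .skip s, hs⟩
  | asg S x e he hlt =>
    intro s hs
    rw [hw] at he hlt
    refine ⟨_, Ex.time_toExpr e ▸ Exec.assign s x.idx e.toExpr, ?_⟩
    rw [Config.val, Ex.eval_toExpr hs.reg he]
    exact hs.setReg x hlt
  | ld S x r i hi hX' hlt =>
    intro s hs
    rw [hw] at hi hlt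
    have ht : (Cmd.addr r i).time + 1 = i.time + 5 := by
      simp only [Cmd.addr, Expr.time, Ex.time_toExpr]; omega
    refine ⟨_, ht ▸ Exec.load s x.idx (Cmd.addr r i), ?_⟩
    rw [hs.val_addr hX hW hi hX', hs.mem]
    exact (hs.touch r hX').setReg x hlt
  | sto S r i e hi hX' he =>
    intro s hs
    rw [hw] at hi he
    have ht : (Cmd.addr r i).time + e.toExpr.time + 1 = i.time + e.time + 5 := by
      simp only [Cmd.addr, Expr.time, Ex.time_toExpr]; omega
    refine ⟨_, ht ▸ Exec.store s (Cmd.addr r i) e.toExpr, ?_⟩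
    rw [hs.val_addr hX hW hi hX', Config.val, Ex.eval_toExpr hs.reg he]
    exact (hs.touch r hX').setMem r _ _
  | outp S e₁ e₂ h₁ h₂ =>
    intro s hs
    rw [hw] at h₁ h₂
    refine ⟨_, Ex.time_toExpr e₁ ▸ Ex.time_toExpr e₂ ▸ Exec.output s e₁.toExpr e₂.toExpr, ?_⟩
    rw [Config.val, Config.val, Ex.eval_toExpr hs.reg h₁, Ex.eval_toExpr hs.reg h₂]
    exact ⟨hs.reg, hs.mem, by simp [Config.emit, hs.out], hs.peak⟩
  | outL S x i j hi hj hlt =>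
    intro s hs
    rw [hw] at hi hj hlt
    refine ⟨_, Ex.time_toExpr i ▸ Ex.time_toExpr j ▸ Exec.outLabel s x.idx i.toExpr j.toExpr, ?_⟩
    rw [Config.val, Config.val, Ex.eval_toExpr hs.reg hi, Ex.eval_toExpr hs.reg hj]
    exact hs.setReg x hlt
  | inL S x i hi hlt =>
    intro s hs
    rw [hw] at hi hlt
    refine ⟨_, Ex.time_toExpr i ▸ Exec.inLabel s x.idx i.toExpr, ?_⟩
    rw [Config.val, Ex.eval_toExpr hs.reg hi]
    exact hs.setReg x hlt
  | seq _ _ ih₁ ih₂ =>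
    intro s hs
    obtain ⟨s₁, h₁, hs₁⟩ := ih₁ s hs
    obtain ⟨s₂, h₂, hs₂⟩ := ih₂ s₁ hs₁
    exact ⟨s₂, .seq h₁ h₂, hs₂⟩
  | ite_true he hv _ ih =>
    intro s hs
    rw [hw] at he
    obtain ⟨s₁, h₁, hs₁⟩ := ih s hs
    refine ⟨s₁, Ex.time_toExpr _ ▸ Exec.ite_true ?_ h₁, hs₁⟩
    rwa [Config.val, Ex.eval_toExpr hs.reg he]
  | ite_false he hv _ ih =>
    intro s hs
    rw [hw] at he
    obtain ⟨s₁, h₁, hs₁⟩ := ih s hs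
    refine ⟨s₁, Ex.time_toExpr _ ▸ Exec.ite_false ?_ h₁, hs₁⟩
    rwa [Config.val, Ex.eval_toExpr hs.reg he]
  | wh_false he hv =>
    intro s hs
    rw [hw] at he
    refine ⟨s, Ex.time_toExpr _ ▸ Exec.while_false ?_, hs⟩
    rwa [Config.val, Ex.eval_toExpr hs.reg he]
  | wh_true he hv _ _ ih₁ ih₂ =>
    intro s hs
    rw [hw] at he
    obtain ⟨s₁, h₁, hs₁⟩ := ih₁ s hs
    obtain ⟨s₂, h₂, hs₂⟩ := ih₂ s₁ hs₁
    refine ⟨s₂, Ex.time_toExpr _ ▸ Exec.while_true ?_ h₁ h₂, hs₂⟩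
    rwa [Config.val, Ex.eval_toExpr hs.reg he]

/-- The state `S'` agrees with `S` on everything that the command cannot change. -/
structure Frame (c : Cmd) (S S' : St) : Prop where
  v : ∀ x, c.wr x = false → S'.v x = S.v x
  a : ∀ r, c.wa r = false → S'.a r = S.a r
  out : c.emits = false → S'.out = S.out

theorem BS.frame {μ : Mach} {c : Cmd} {S S' : St} {t : ℕ} (h : BS μ c S t S') : Frame c S S' := by
  induction h with
  | skip => exact ⟨fun _ _ => rfl, fun _ _ => rfl, fun _ => rfl⟩
  | asg | ld | outL | inL =>
    refine ⟨fun y hy => ?_, fun _ _ => rfl, fun _ => rfl⟩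
    simp only [Cmd.wr, beq_eq_false_iff_ne] at hy
    simp [hy]
  | sto =>
    refine ⟨fun _ _ => rfl, fun r hr => ?_, fun _ => rfl⟩
    simp only [Cmd.wa, beq_eq_false_iff_ne] at hr
    simp [hr]
  | outp => exact ⟨fun _ _ => rfl, fun _ _ => rfl, fun h => by simp [Cmd.emits] at h⟩
  | seq _ _ ih₁ ih₂ =>
    refine ⟨fun x hx => ?_, fun r hr => ?_, fun ho => ?_⟩
    · simp only [Cmd.wr, Bool.or_eq_false_iff] at hx
      rw [ih₂.v x hx.2, ih₁.v x hx.1]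
    · simp only [Cmd.wa, Bool.or_eq_false_iff] at hr
      rw [ih₂.a r hr.2, ih₁.a r hr.1]
    · simp only [Cmd.emits, Bool.or_eq_false_iff] at ho
      rw [ih₂.out ho.2, ih₁.out ho.1]
  | ite_true _ _ _ ih =>
    refine ⟨fun x hx => ih.v x ?_, fun r hr => ih.a r ?_, fun ho => ih.out ?_⟩ <;>
      simp_all [Cmd.wr, Cmd.wa, Cmd.emits]
  | ite_false _ _ _ ih =>
    refine ⟨fun x hx => ih.v x ?_, fun r hr => ih.a r ?_, fun ho => ih.out ?_⟩ <;>
      simp_all [Cmd.wr, Cmd.wa, Cmd.emits]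
  | wh_false => exact ⟨fun _ _ => rfl, fun _ _ => rfl, fun _ => rfl⟩
  | wh_true _ _ _ _ ih₁ ih₂ =>
    refine ⟨fun x hx => ?_, fun r hr => ?_, fun ho => ?_⟩
    · rw [ih₂.v x hx, ih₁.v x (by simpa [Cmd.wr] using hx)]
    · rw [ih₂.a r hr, ih₁.a r (by simpa [Cmd.wa] using hr)]
    · rw [ih₂.out ho, ih₁.out (by simpa [Cmd.emits] using ho)]

/-- Started in `S`, the command halts within time `T` in a state satisfying `R`. -/
def Tr (μ : Mach) (c : Cmd) (T : ℕ) (S : St) (R : St → Prop) : Prop :=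
  ∃ t S', BS μ c S t S' ∧ t ≤ T ∧ R S'

namespace Tr

variable {μ : Mach} {c P Q : Cmd} {T T₁ T₂ : ℕ} {S : St} {R R' : St → Prop} {e : Ex}

theorem mono (h : Tr μ c T₁ S R) (hT : T₁ ≤ T) (hR : ∀ S', R S' → R' S') : Tr μ c T S R' := by
  obtain ⟨t, S', h, ht, hr⟩ := h
  exact ⟨t, S', h, ht.trans hT, hR S' hr⟩

theorem frame (h : Tr μ c T S R) : Tr μ c T S fun S' => R S' ∧ Frame c S S' := by
  obtain ⟨t, S', h, ht, hr⟩ := h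
  exact ⟨t, S', h, ht, hr, h.frame⟩

theorem seq (h : Tr μ P T₁ S fun S' => Tr μ Q T₂ S' R) : Tr μ (P ;; Q) (T₁ + T₂) S R := by
  obtain ⟨t₁, S₁, h₁, ht₁, t₂, S₂, h₂, ht₂, hr⟩ := h
  exact ⟨_, S₂, .seq h₁ h₂, by omega, hr⟩

theorem ite (he : e.Safe μ.W S.v) (h₁ : e.ev S.v ≠ 0 → Tr μ P T S R)
    (h₂ : e.ev S.v = 0 → Tr μ Q T S R) : Tr μ (.ite e P Q) (e.time + 1 + T) S R := by
  by_cases hv : e.ev S.v = 0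
  · obtain ⟨t, S', h, ht, hr⟩ := h₂ hv
    exact ⟨_, S', .ite_false he hv h, by omega, hr⟩
  · obtain ⟨t, S', h, ht, hr⟩ := h₁ hv
    exact ⟨_, S', .ite_true he hv h, by omega, hr⟩

/-- Rule for loops, with an invariant about a ghost state `a` and a potential `Φ` paying for the
running time. -/
theorem wh {α : Type*} (I : α → St → Prop) (Φ : α → ℕ)
    (hsafe : ∀ a S, I a S → e.Safe μ.W S.v)
    (step : ∀ a S, I a S → e.ev S.v ≠ 0 → ∃ T, Tr μ P T S fun S' =>
      ∃ a', I a' S' ∧ T + (e.time + 1) + Φ a' ≤ Φ a)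
    {a : α} (hI : I a S) (hT : Φ a + e.time + 1 ≤ T)
    (post : ∀ a S, I a S → e.ev S.v = 0 → R S) : Tr μ (.wh e P) T S R := by
  induction hk : Φ a using Nat.strong_induction_on generalizing a S T with
  | _ k ih =>
    by_cases hv : e.ev S.v = 0
    · exact ⟨_, S, .wh_false (hsafe a S hI) hv, by omega, post a S hI hv⟩
    · obtain ⟨T₁, t₁, S₁, h₁, ht₁, a', hI', hΦ⟩ := step a S hI hv
      obtain ⟨t₂, S₂, h₂, ht₂, hr⟩ :=
        ih (Φ a') (by omega) (T := Φ a' + e.time + 1) hI' le_rfl rfl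
      exact ⟨_, S₂, .wh_true (hsafe a S hI) hv h₁ h₂, by omega, hr⟩

end Tr

namespace Cmd

/-- Weakest precondition of a command without loops. -/
def wp (μ : Mach) : Cmd → (St → Prop) → St → Prop
  | skip, R, S => R S
  | asg x e, R, S => e.Safe μ.W S.v ∧ e.ev S.v < μ.W ∧ R (S.set x (e.ev S.v))
  | ld x r i, R, S => i.Safe μ.W S.v ∧ i.ev S.v < μ.X ∧ S.a r (i.ev S.v) < μ.W ∧
      R (S.set x (S.a r (i.ev S.v)))
  | sto r i e, R, S => i.Safe μ.W S.v ∧ i.ev S.v < μ.X ∧ e.Safe μ.W S.v ∧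
      R (S.put r (i.ev S.v) (e.ev S.v))
  | outp e₁ e₂, R, S => e₁.Safe μ.W S.v ∧ e₂.Safe μ.W S.v ∧ R (S.emit (e₁.ev S.v, e₂.ev S.v))
  | outL x i j, R, S => i.Safe μ.W S.v ∧ j.Safe μ.W S.v ∧
      μ.D.outLabel (i.ev S.v) (j.ev S.v) < μ.W ∧
      R (S.set x (μ.D.outLabel (i.ev S.v) (j.ev S.v)))
  | inL x i, R, S => i.Safe μ.W S.v ∧ μ.D.inLabel (i.ev S.v) < μ.W ∧
      R (S.set x (μ.D.inLabel (i.ev S.v)))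
  | seq P Q, R, S => P.wp μ (fun S' => Q.wp μ R S') S
  | ite e P Q, R, S => e.Safe μ.W S.v ∧ (e.ev S.v ≠ 0 → P.wp μ R S) ∧ (e.ev S.v = 0 → Q.wp μ R S)
  | wh _ _, _, _ => False

/-- Time bound for a command without loops. -/
def cost (q : ℕ) : Cmd → ℕ
  | skip => 1
  | asg _ e => e.time + 1
  | ld _ _ i => i.time + 5
  | sto _ i e => i.time + e.time + 5
  | outp e₁ e₂ => e₁.time + e₂.time + 1
  | outL _ i j => i.time + j.time + q + 1
  | inL _ i => i.time + q + 1
  | seq P Q => P.cost q + Q.cost q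
  | ite e P Q => e.time + 1 + (P.cost q + Q.cost q)
  | wh _ _ => 0

theorem tr_of_wp {μ : Mach} {c : Cmd} {S : St} {R : St → Prop} (h : c.wp μ R S) :
    Tr μ c (c.cost μ.q) S R := by
  induction c generalizing S R with
  | skip => exact ⟨_, S, .skip S, le_rfl, h⟩
  | asg x e => exact ⟨_, _, .asg S x e h.1 h.2.1, le_rfl, h.2.2⟩
  | ld x r i => exact ⟨_, _, .ld S x r i h.1 h.2.1 h.2.2.1, le_rfl, h.2.2.2⟩
  | sto r i e => exact ⟨_, _, .sto S r i e h.1 h.2.1 h.2.2.1, le_rfl, h.2.2.2⟩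
  | outp e₁ e₂ => exact ⟨_, _, .outp S e₁ e₂ h.1 h.2.1, le_rfl, h.2.2⟩
  | outL x i j => exact ⟨_, _, .outL S x i j h.1 h.2.1 h.2.2.1, le_rfl, h.2.2.2⟩
  | inL x i => exact ⟨_, _, .inL S x i h.1 h.2.1, le_rfl, h.2.2⟩
  | seq P Q ihP ihQ => exact Tr.seq ((ihP h).mono le_rfl fun S' h' => ihQ h')
  | ite e P Q ihP ihQ =>
    exact Tr.ite h.1 (fun hv => (ihP (h.2.1 hv)).mono (by omega) fun _ => id)
      (fun hv => (ihQ (h.2.2 hv)).mono (by omega) fun _ => id)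
  | wh e P => exact h.elim

end Cmd

end WheelerLCP

namespace WheelerLCP

open Finset

/-! ## Sorting a sequence bit by bit

A sequence `ε 0, …, ε (N - 1)` is sorted stably by its `l` lowest bits, for `l = 0, …, h`. Cell
`l * N + p` stands for the place `p` in the order number `l`. -/

section Cells

variable (N : ℕ) (ε : ℕ → ℕ)

/-- The cell, in order number `l`, of the first element `y ≥ x` with `ε y % 2 ^ l = g`, that is,
the place where such an element is to be inserted. -/
def pos (l g x : ℕ) : ℕ :=
  l * N + #{y ∈ range N | ε y % 2 ^ l < g} + #{y ∈ range x | ε y % 2 ^ l = g}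

/-- The cell of the element number `x` in order number `l`. -/
def place (l x : ℕ) : ℕ := pos N ε l (ε x % 2 ^ l) x

variable {N ε}

theorem pos_zero_zero (x : ℕ) : pos N ε 0 0 x = x := by
  simp [pos, Nat.mod_one]

theorem pos_mono {l g x x' : ℕ} (h : x ≤ x') : pos N ε l g x ≤ pos N ε l g x' := by
  unfold pos
  gcongr

theorem le_pos (l g x : ℕ) : l * N ≤ pos N ε l g x := by
  unfold pos; omega

theorem pos_le {l g g' x : ℕ} (hx : x ≤ N) (hg : g < g') (x' : ℕ) :
    pos N ε l g x ≤ pos N ε l g' x' := by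
  have : #{y ∈ range N | ε y % 2 ^ l < g} + #{y ∈ range x | ε y % 2 ^ l = g} ≤
      #{y ∈ range N | ε y % 2 ^ l < g'} := by
    rw [← card_union_of_disjoint]
    · apply card_le_card
      intro y hy
      simp only [mem_union, mem_filter, mem_range] at hy ⊢
      omega
    · rw [disjoint_left]
      intro y hy hy'
      simp only [mem_filter] at hy hy'
      omega
  unfold pos
  omega

theorem pos_lt_pos {l g x x' : ℕ} (h : x < x') (hg : ε x % 2 ^ l = g) :
    pos N ε l g x < pos N ε l g x' := by
  have : #{y ∈ range x | ε y % 2 ^ l = g} < #{y ∈ range x' | ε y % 2 ^ l = g} := by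
    apply card_lt_card
    refine ⟨fun y hy => ?_, fun hs => ?_⟩
    · simp only [mem_filter, mem_range] at hy ⊢
      omega
    · have := hs (show x ∈ _ by simp [h, hg])
      simp at this
  unfold pos
  omega

theorem place_lt_pos_iff {l g x y : ℕ} (hx : x ≤ N) (hy : y < N) :
    place N ε l y < pos N ε l g x ↔ ε y % 2 ^ l < g ∨ ε y % 2 ^ l = g ∧ y < x := by
  unfold place
  rcases lt_trichotomy (ε y % 2 ^ l) g with hlt | heq | hgt
  · have h1 := pos_lt_pos (N := N) hy (rfl : ε y % 2 ^ l = ε y % 2 ^ l)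
    have h2 := pos_le (ε := ε) (l := l) (le_refl N) hlt x
    simp only [hlt, true_or, iff_true]
    omega
  · subst heq
    rcases lt_or_ge y x with h | h
    · simp [h, pos_lt_pos h rfl]
    · have := pos_mono (N := N) (ε := ε) (l := l) (g := ε y % 2 ^ l) h
      simp only [lt_irrefl, false_or, true_and]
      omega
  · have := pos_le (ε := ε) (l := l) hx hgt y
    have h1 : ¬ ε y % 2 ^ l < g := by omega
    have h2 : ¬ ε y % 2 ^ l = g := by omega
    simp only [h1, h2, false_and, or_false, iff_false]
    omega

theorem place_injOn {l x y : ℕ} (hx : x < N) (hy : y < N) (h : place N ε l x = place N ε l y) :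
    x = y := by
  have h1 := place_lt_pos_iff (ε := ε) (l := l) (g := ε y % 2 ^ l) hy.le hx
  have h2 := place_lt_pos_iff (ε := ε) (l := l) (g := ε x % 2 ^ l) hx.le hy
  have e1 : pos N ε l (ε y % 2 ^ l) y = place N ε l y := rfl
  have e2 : pos N ε l (ε x % 2 ^ l) x = place N ε l x := rfl
  rw [e1, h] at h1
  rw [e2, h] at h2
  omega

theorem place_lt {l x : ℕ} (hx : x < N) : place N ε l x < (l + 1) * N := by
  have h1 := (place_lt_pos_iff (ε := ε) (l := l) (g := 2 ^ l) le_rfl hx).2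
    (Or.inl (Nat.mod_lt _ (by positivity)))
  refine h1.trans_le ?_
  have h2 : #{y ∈ range N | ε y % 2 ^ l < 2 ^ l} ≤ N := (card_filter_le _ _).trans (by simp)
  have h3 : #{y ∈ range N | ε y % 2 ^ l = 2 ^ l} = 0 := by
    rw [card_eq_zero, filter_eq_empty_iff]
    intro y _
    exact (Nat.mod_lt _ (by positivity)).ne
  unfold pos
  rw [h3, add_mul]
  omega

theorem le_place (l x : ℕ) : l * N ≤ place N ε l x := le_pos _ _ _

theorem place_div {l x : ℕ} (hx : x < N) : place N ε l x / N = l :=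
  Nat.div_eq_of_lt_le (le_place l x) (place_lt hx)

theorem pos_lt {h l g x : ℕ} (hN : 0 < N) (hs : ε (N - 1) = 2 ^ h - 1) (hl : l ≤ h)
    (hg : g < 2 ^ l) (hx : x < N) : pos N ε l g x < (l + 1) * N := by
  have hm : ε (N - 1) % 2 ^ l = 2 ^ l - 1 := by
    obtain ⟨d, rfl⟩ := Nat.exists_eq_add_of_le hl
    rw [hs, pow_add]
    have hd : 1 ≤ 2 ^ d := Nat.one_le_two_pow
    have hl' : 1 ≤ 2 ^ l := Nat.one_le_two_pow
    obtain ⟨D, hD⟩ := Nat.exists_eq_add_of_le hd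
    have : 2 ^ l * 2 ^ d - 1 = 2 ^ l - 1 + 2 ^ l * D := by
      rw [hD, mul_add]; omega
    rw [this, Nat.add_mul_mod_self_left, Nat.mod_eq_of_lt (by omega)]
  have h1 := (place_lt_pos_iff (ε := ε) (l := l) (g := g) hx.le (show N - 1 < N by omega))
  have h2 := place_lt (ε := ε) (l := l) (show N - 1 < N by omega)
  omega

variable (N ε) in
/-- The bit of every element is stored in its cell. -/
def cellBit (l a : ℕ) : Prop := ∃ x < N, a = place N ε l x ∧ (ε x).testBit l = true

theorem card_cellBit {S : Set ℕ} [DecidablePred (· ∈ S)] {l g x : ℕ} (hx : x ≤ N)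
    (hS : ∀ a, l * N ≤ a → a < (l + 1) * N → (a ∈ S ↔ cellBit N ε l a))
    (hp : pos N ε l g x ≤ (l + 1) * N) :
    #{a ∈ range (pos N ε l g x) | a ∈ S} = #{a ∈ range (l * N) | a ∈ S} +
      (#{y ∈ range N | ε y % 2 ^ l < g ∧ (ε y).testBit l = true} +
       #{y ∈ range x | ε y % 2 ^ l = g ∧ (ε y).testBit l = true}) := by
  have h1 : {a ∈ range (pos N ε l g x) | a ∈ S} = {a ∈ range (l * N) | a ∈ S} ∪
      ({y ∈ range N | ε y % 2 ^ l < g ∧ (ε y).testBit l = true} ∪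
       {y ∈ range x | ε y % 2 ^ l = g ∧ (ε y).testBit l = true}).image (place N ε l) := by
    ext a
    simp only [mem_union, mem_filter, mem_range, mem_image]
    constructor
    · rintro ⟨ha, haS⟩
      by_cases hal : a < l * N
      · exact Or.inl ⟨hal, haS⟩
      · obtain ⟨y, hy, rfl, hb⟩ := (hS a (by omega) (by omega)).1 haS
        refine Or.inr ⟨y, ?_, rfl⟩
        rcases (place_lt_pos_iff hx hy).1 ha with h | h
        · exact Or.inl ⟨hy, h, hb⟩
        · exact Or.inr ⟨h.2, h.1, hb⟩
    · rintro (⟨ha, haS⟩ | ⟨y, hy, rfl⟩)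
      · exact ⟨ha.trans_le (le_pos _ _ _), haS⟩
      · have hyN : y < N := by omega
        have hb : (ε y).testBit l = true := by tauto
        refine ⟨(place_lt_pos_iff hx hyN).2 (by tauto), ?_⟩
        exact (hS _ (le_place l y) (place_lt hyN)).2 ⟨y, hyN, rfl, hb⟩
  rw [h1, card_union_of_disjoint, card_image_of_injOn, card_union_of_disjoint]
  · rw [disjoint_left]
    intro y hy hy'
    simp only [mem_filter] at hy hy'
    omega
  · intro y hy y' hy' hyy
    simp only [coe_union, coe_filter, mem_range, Set.mem_union, Set.mem_ofPred_eq] at hy hy'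
    exact place_injOn (by omega) (by omega) hyy
  · rw [disjoint_left]
    intro a ha ha'
    simp only [mem_filter, mem_range, mem_image] at ha ha'
    obtain ⟨y, -, rfl⟩ := ha'
    have := le_place (N := N) (ε := ε) l y
    omega

theorem card_filter_and_add {s : Finset ℕ} (p : ℕ → Prop) (b : ℕ → Bool) [DecidablePred p] :
    #{y ∈ s | p y ∧ b y = true} + #{y ∈ s | p y ∧ b y = false} = #{y ∈ s | p y} := by
  rw [← card_filter_add_card_filter_not (s := {y ∈ s | p y}) (fun y => b y = true),
    filter_filter, filter_filter]
  simp

theorem mod_two_pow_succ (x l : ℕ) :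
    x % 2 ^ (l + 1) = x % 2 ^ l + 2 ^ l * (x.testBit l).toNat := by
  rw [Nat.mod_pow_succ, Nat.toNat_testBit]

theorem mod_lt_iff_zero {x l g : ℕ} (hg : g < 2 ^ l) :
    x % 2 ^ (l + 1) < g ↔ x % 2 ^ l < g ∧ x.testBit l = false := by
  rw [mod_two_pow_succ]
  cases x.testBit l <;> simp
  omega

theorem mod_eq_iff_zero {x l g : ℕ} (hg : g < 2 ^ l) :
    x % 2 ^ (l + 1) = g ↔ x % 2 ^ l = g ∧ x.testBit l = false := by
  rw [mod_two_pow_succ]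
  cases x.testBit l <;> simp
  omega

theorem mod_lt_iff_one {x l g : ℕ} :
    x % 2 ^ (l + 1) < g + 2 ^ l ↔ x.testBit l = false ∨ x % 2 ^ l < g ∧ x.testBit l = true := by
  have := Nat.mod_lt x (show 0 < 2 ^ l by positivity)
  rw [mod_two_pow_succ]
  cases x.testBit l <;> simp <;> omega

theorem mod_eq_iff_one {x l g : ℕ} :
    x % 2 ^ (l + 1) = g + 2 ^ l ↔ x % 2 ^ l = g ∧ x.testBit l = true := by
  have := Nat.mod_lt x (show 0 < 2 ^ l by positivity)
  rw [mod_two_pow_succ]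
  cases x.testBit l <;> simp <;> omega

variable (N) in
/-- The first of the two cells of the next order that a cell leads to, computed from the numbers of
bits stored before some cells. -/
def child₀ (R : ℕ → ℕ) (a : ℕ) : ℕ := a + N - (R a - R (a / N * N))

variable (N) in
/-- The second of the two cells of the next order that a cell leads to. -/
def child₁ (R : ℕ → ℕ) (a : ℕ) : ℕ := (a / N + 2) * N - (R ((a / N + 1) * N) - R a)

theorem card_row {S : Set ℕ} [DecidablePred (· ∈ S)] {l : ℕ}
    (hS : ∀ a, l * N ≤ a → a < (l + 1) * N → (a ∈ S ↔ cellBit N ε l a)) :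
    #{a ∈ range ((l + 1) * N) | a ∈ S} =
      #{a ∈ range (l * N) | a ∈ S} + #{y ∈ range N | (ε y).testBit l = true} := by
  have hpos : pos N ε l (2 ^ l) 0 = (l + 1) * N := by
    have : {y ∈ range N | ε y % 2 ^ l < 2 ^ l} = range N :=
      filter_true_of_mem fun y _ => Nat.mod_lt _ (by positivity)
    simp only [pos, this, card_range, range_zero, filter_empty, card_empty]
    ring
  have h := card_cellBit (ε := ε) (x := 0) (g := 2 ^ l) (Nat.zero_le N) hS hpos.le
  rw [hpos] at h
  rw [h]
  simp only [range_zero, filter_empty, card_empty, add_zero]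
  congr 2
  apply filter_congr
  intro y _
  simp [Nat.mod_lt _ (show 0 < 2 ^ l by positivity)]

section

variable {S : Set ℕ} [DecidablePred (· ∈ S)] {l g x : ℕ}

theorem child₀_pos (hx : x ≤ N) (hg : g < 2 ^ l)
    (hS : ∀ a, l * N ≤ a → a < (l + 1) * N → (a ∈ S ↔ cellBit N ε l a))
    (hp : pos N ε l g x < (l + 1) * N) :
    child₀ N (fun a => #{c ∈ range a | c ∈ S}) (pos N ε l g x) = pos N ε (l + 1) g x := by
  have hdiv : pos N ε l g x / N = l := Nat.div_eq_of_lt_le (le_pos _ _ _) hp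
  have h1 := card_cellBit hx hS hp.le
  unfold child₀
  rw [hdiv]
  simp only
  rw [h1, Nat.add_sub_cancel_left]
  have h2 := card_filter_and_add (s := range N) (fun y => ε y % 2 ^ l < g) fun y => (ε y).testBit l
  have h3 := card_filter_and_add (s := range x) (fun y => ε y % 2 ^ l = g) fun y => (ε y).testBit l
  unfold pos
  simp only [mod_lt_iff_zero hg, mod_eq_iff_zero hg]
  rw [add_mul]
  omega

theorem child₁_pos (hx : x ≤ N)
    (hS : ∀ a, l * N ≤ a → a < (l + 1) * N → (a ∈ S ↔ cellBit N ε l a))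
    (hp : pos N ε l g x < (l + 1) * N) :
    child₁ N (fun a => #{c ∈ range a | c ∈ S}) (pos N ε l g x) =
      pos N ε (l + 1) (g + 2 ^ l) x := by
  have hdiv : pos N ε l g x / N = l := Nat.div_eq_of_lt_le (le_pos _ _ _) hp
  have h1 := card_cellBit hx hS hp.le
  have h2 := card_row (ε := ε) hS
  unfold child₁
  rw [hdiv]
  simp only
  rw [h1, h2, Nat.add_sub_add_left]
  have h3 : #{y ∈ range N | ε y % 2 ^ (l + 1) < g + 2 ^ l} =
      #{y ∈ range N | (ε y).testBit l = false} +
        #{y ∈ range N | ε y % 2 ^ l < g ∧ (ε y).testBit l = true} := by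
    simp only [mod_lt_iff_one]
    rw [filter_or, card_union_of_disjoint]
    rw [disjoint_left]
    intro y hy hy'
    simp only [mem_filter] at hy hy'
    simp_all
  have h4 : #{y ∈ range N | (ε y).testBit l = true} +
      #{y ∈ range N | (ε y).testBit l = false} = N := by
    have := card_filter_add_card_filter_not (s := range N) (fun y => (ε y).testBit l = true)
    simpa using this
  have h5 : #{y ∈ range N | ε y % 2 ^ l < g ∧ (ε y).testBit l = true} +
      #{y ∈ range x | ε y % 2 ^ l = g ∧ (ε y).testBit l = true} ≤
      #{y ∈ range N | (ε y).testBit l = true} := by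
    rw [← card_union_of_disjoint]
    · apply card_le_card
      intro y hy
      simp only [mem_union, mem_filter, mem_range] at hy ⊢
      rcases hy with hy | hy
      · exact ⟨hy.1, hy.2.2⟩
      · exact ⟨by omega, hy.2.2⟩
    · rw [disjoint_left]
      intro y hy hy'
      simp only [mem_filter] at hy hy'
      omega
  unfold pos
  rw [h3]
  simp only [mod_eq_iff_one]
  rw [add_mul, add_mul]
  omega

end

end Cells

end WheelerLCP

namespace WheelerLCP

open Finset

/-! ## The search -/

/-- What the search has to know about the order of the edges: `ε` lists the labels of the edges in
the order of their origins, followed by a sentinel, `Dg i` is the number of edges that leave nodes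
with numbers below `i`, and `V` are the values to be computed. The functions `c₀` and `c₁` lead from
the cells of an order to those of the next one. -/
structure Layout (n h : ℕ) (ε Dg V c₀ c₁ : ℕ → ℕ) : Prop where
  n_pos : 0 < n
  last : ε n = 2 ^ h - 1
  lt_last : ∀ x < n, ε x < 2 ^ h - 1
  Dg_le : ∀ i ≤ n, Dg i ≤ n
  val_zero : ∀ p, 0 < p → p < n →
    (V p = 0 ↔ ∃ c < 2 ^ h, pos (n + 1) ε h c 0 = h * (n + 1) + p)
  val_le : ∀ p i c, 0 < p → p < n → 0 < i → i < n → c < 2 ^ h →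
    pos (n + 1) ε h c (Dg i) = h * (n + 1) + p → V p ≤ V i + 1
  val_succ : ∀ p v, 0 < p → p < n → V p = v + 1 → ∃ i c, 0 < i ∧ i < n ∧ c < 2 ^ h ∧ V i = v ∧
    pos (n + 1) ε h c (Dg i) = h * (n + 1) + p
  child₀ : ∀ l < h, ∀ g < 2 ^ l, ∀ x ≤ n, c₀ (pos (n + 1) ε l g x) = pos (n + 1) ε (l + 1) g x
  child₁ : ∀ l < h, ∀ g < 2 ^ l, ∀ x ≤ n,
    c₁ (pos (n + 1) ε l g x) = pos (n + 1) ε (l + 1) (g + 2 ^ l) x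

/-- In a stack of cells, given from top to bottom, each cell has at most as many cells below it as
the number of its order. -/
def StackOK (N : ℕ) : List ℕ → Prop
  | [] => True
  | a :: s => s.length ≤ a / N ∧ StackOK N s

/-- State of the search: `M` is the set of marked cells, `stk` holds the cells to be visited, `I` is
the set of positions whose visit has begun, `xs` and `cur` are the remaining positions with value
below `lev`, `nxt` those found with value `lev`. -/
structure SearchInv (n h : ℕ) (ε Dg V c₀ c₁ : ℕ → ℕ) (M : Finset ℕ) (stk : List ℕ)
    (I xs cur nxt : Finset ℕ) (lev : ℕ) (out : List (ℕ × ℕ)) : Prop where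
  mem_lt : ∀ a ∈ M, a < (h + 1) * (n + 1)
  stk_ok : StackOK (n + 1) stk
  stk_pos : ∀ a ∈ stk, ∃ i ∈ I, ∃ l ≤ h, ∃ g < 2 ^ l, a = pos (n + 1) ε l g (Dg i)
  closed : ∀ a ∈ M, a < h * (n + 1) → (c₀ a ∈ M ∨ c₀ a ∈ stk) ∧ (c₁ a ∈ M ∨ c₁ a ∈ stk)
  start : ∀ i ∈ I, Dg i ∈ M ∨ Dg i ∈ stk
  base : ∀ c < 2 ^ h, pos (n + 1) ε h c 0 ∈ M
  val_le : ∀ p, 0 < p → p < n → h * (n + 1) + p ∈ M → V p ≤ lev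
  mem_nxt : ∀ p, p ∈ nxt ↔ 0 < p ∧ p < n ∧ h * (n + 1) + p ∈ M ∧ V p = lev
  complete : ∀ p, 0 < p → p < n → V p < lev → h * (n + 1) + p ∈ M
  todo : ∀ i, (i ∈ I ∨ i ∈ xs ∨ i ∈ cur) ↔ 0 < i ∧ i < n ∧ V i < lev
  nodup : (out.map Prod.fst).Nodup
  mem_out : ∀ i, i ∈ out.map Prod.fst ↔ ∃ p, i = p + 1 ∧ 0 < p ∧ p < n ∧ h * (n + 1) + p ∈ M
  out_val : ∀ r ∈ out, ∃ p, r = (p + 1, V p) ∧ V p ≤ lev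
  sorted : out.Pairwise fun r r' => r.2 ≤ r'.2

namespace Layout

variable {n h : ℕ} {ε Dg V c₀ c₁ : ℕ → ℕ}

theorem pos_lt (L : Layout n h ε Dg V c₀ c₁) {l g x : ℕ} (hl : l ≤ h) (hg : g < 2 ^ l)
    (hx : x ≤ n) :
    pos (n + 1) ε l g x < (l + 1) * (n + 1) :=
  WheelerLCP.pos_lt (h := h) (by omega) (by simpa using L.last) hl hg (by omega)

theorem pos_div (L : Layout n h ε Dg V c₀ c₁) {l g x : ℕ} (hl : l ≤ h) (hg : g < 2 ^ l)
    (hx : x ≤ n) :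
    pos (n + 1) ε l g x / (n + 1) = l :=
  Nat.div_eq_of_lt_le (le_pos _ _ _) (L.pos_lt hl hg hx)

theorem pos_last (L : Layout n h ε Dg V c₀ c₁) : pos (n + 1) ε h (2 ^ h - 1) 0 = h * (n + 1) + n := by
  have h2 : 1 ≤ 2 ^ h := Nat.one_le_two_pow
  have h1 : {y ∈ range (n + 1) | ε y % 2 ^ h < 2 ^ h - 1} = range n := by
    ext y
    simp only [mem_filter, mem_range]
    constructor
    · rintro ⟨hy, hlt⟩
      rcases Nat.lt_succ_iff_lt_or_eq.1 hy with h' | rfl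
      · exact h'
      · rw [L.last, Nat.mod_eq_of_lt (by omega)] at hlt
        omega
    · intro hy
      have := L.lt_last y hy
      rw [Nat.mod_eq_of_lt (by omega)]
      exact ⟨by omega, this⟩
  simp [pos, h1]

end Layout

theorem pos_first (N h : ℕ) (ε : ℕ → ℕ) : pos N ε h 0 0 = h * N := by simp [pos]

namespace SearchInv

variable {n h : ℕ} {ε Dg V c₀ c₁ : ℕ → ℕ} {M : Finset ℕ} {stk : List ℕ}
  {I xs cur nxt : Finset ℕ} {lev : ℕ} {out : List (ℕ × ℕ)}

theorem pop_marked {a : ℕ} (H : SearchInv n h ε Dg V c₀ c₁ M (a :: stk) I xs cur nxt lev out)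
    (ha : a ∈ M) : SearchInv n h ε Dg V c₀ c₁ M stk I xs cur nxt lev out := by
  have key : ∀ c, c ∈ M ∨ c ∈ a :: stk → c ∈ M ∨ c ∈ stk := by
    rintro c (hc | hc)
    · exact Or.inl hc
    · rcases List.mem_cons.1 hc with rfl | hc
      · exact Or.inl ha
      · exact Or.inr hc
  exact { H with
    stk_ok := H.stk_ok.2
    stk_pos := fun c hc => H.stk_pos c (List.mem_cons_of_mem a hc)
    closed := fun c hc hlt => ⟨key _ (H.closed c hc hlt).1, key _ (H.closed c hc hlt).2⟩
    start := fun i hi => key _ (H.start i hi) }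

theorem pop_inner {a : ℕ} (L : Layout n h ε Dg V c₀ c₁)
    (H : SearchInv n h ε Dg V c₀ c₁ M (a :: stk) I xs cur nxt lev out) (hlt : a < h * (n + 1)) :
    SearchInv n h ε Dg V c₀ c₁ (insert a M) (c₁ a :: c₀ a :: stk) I xs cur nxt lev out := by
  obtain ⟨i, hi, l, hl, g, hg, ha⟩ := H.stk_pos a List.mem_cons_self
  have hin := (H.todo i).1 (Or.inl hi)
  have hD : Dg i ≤ n := L.Dg_le i hin.2.1.le
  have hlh : l < h := by
    have := le_pos (N := n + 1) (ε := ε) l g (Dg i)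
    by_contra hc
    have : h * (n + 1) ≤ l * (n + 1) := Nat.mul_le_mul_right _ (by omega)
    omega
  have e₀ : c₀ a = pos (n + 1) ε (l + 1) g (Dg i) := by rw [ha, L.child₀ l hlh g hg _ hD]
  have e₁ : c₁ a = pos (n + 1) ε (l + 1) (g + 2 ^ l) (Dg i) := by
    rw [ha, L.child₁ l hlh g hg _ hD]
  have hg₀ : g < 2 ^ (l + 1) := by rw [pow_succ]; omega
  have hg₁ : g + 2 ^ l < 2 ^ (l + 1) := by rw [pow_succ]; omega
  have key : ∀ c, c ∈ M ∨ c ∈ a :: stk → c ∈ insert a M ∨ c ∈ c₁ a :: c₀ a :: stk := by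
    rintro c (hc | hc)
    · exact Or.inl (mem_insert_of_mem hc)
    · rcases List.mem_cons.1 hc with rfl | hc
      · exact Or.inl (mem_insert_self _ _)
      · exact Or.inr (List.mem_cons_of_mem _ (List.mem_cons_of_mem _ hc))
  have hM : ∀ p, h * (n + 1) + p ∈ insert a M ↔ h * (n + 1) + p ∈ M := by
    intro p
    rw [mem_insert, or_iff_right]
    omega
  refine { H with
    mem_lt := ?_, stk_ok := ?_, stk_pos := ?_, closed := ?_, start := ?_, base := ?_,
    val_le := ?_, mem_nxt := ?_, complete := ?_, mem_out := ?_ }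
  · intro c hc
    rcases mem_insert.1 hc with rfl | hc
    · rw [add_mul]; omega
    · exact H.mem_lt c hc
  · have hlen := H.stk_ok.1
    rw [ha, L.pos_div hl hg hD] at hlen
    refine ⟨?_, ?_, H.stk_ok.2⟩
    · rw [e₁, L.pos_div (by omega) hg₁ hD]; simpa using hlen
    · rw [e₀, L.pos_div (by omega) hg₀ hD]; omega
  · intro c hc
    rcases List.mem_cons.1 hc with rfl | hc
    · exact ⟨i, hi, l + 1, by omega, _, hg₁, e₁⟩
    · rcases List.mem_cons.1 hc with rfl | hc
      · exact ⟨i, hi, l + 1, by omega, _, hg₀, e₀⟩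
      · exact H.stk_pos c (List.mem_cons_of_mem a hc)
  · intro c hc hclt
    rcases mem_insert.1 hc with rfl | hc
    · exact ⟨Or.inr (by simp), Or.inr (by simp)⟩
    · exact ⟨key _ (H.closed c hc hclt).1, key _ (H.closed c hc hclt).2⟩
  · exact fun i hi => key _ (H.start i hi)
  · exact fun c hc => mem_insert_of_mem (H.base c hc)
  · exact fun p h0 hp hpM => H.val_le p h0 hp ((hM p).1 hpM)
  · intro p; rw [hM]; exact H.mem_nxt p
  · intro p h0 hp hv; rw [hM]; exact H.complete p h0 hp hv
  · intro i; simp only [hM]; exact H.mem_out i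

theorem top_cell {a : ℕ} (L : Layout n h ε Dg V c₀ c₁)
    (H : SearchInv n h ε Dg V c₀ c₁ M (a :: stk) I xs cur nxt lev out) (ha : a ∉ M)
    (hle : h * (n + 1) ≤ a) : ∃ p, a = h * (n + 1) + p ∧ 0 < p ∧ p < n ∧ V p = lev := by
  obtain ⟨i, hi, l, hl, g, hg, hag⟩ := H.stk_pos a List.mem_cons_self
  have hin := (H.todo i).1 (Or.inl hi)
  have hD : Dg i ≤ n := L.Dg_le i hin.2.1.le
  have hlt := L.pos_lt hl hg hD
  obtain rfl : l = h := by
    by_contra hne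
    have : (l + 1) * (n + 1) ≤ h * (n + 1) := Nat.mul_le_mul_right _ (by omega)
    omega
  obtain ⟨p, rfl⟩ := Nat.exists_eq_add_of_le hle
  have h2 : 1 ≤ 2 ^ l := Nat.one_le_two_pow
  have hp0 : 0 < p := by
    rcases Nat.eq_zero_or_pos p with rfl | h'
    · exact absurd (pos_first (n + 1) l ε ▸ H.base 0 (by omega)) ha
    · exact h'
  have hpn : p < n := by
    rw [← hag, add_mul] at hlt
    rcases Nat.lt_or_ge p n with h' | h'
    · exact h'
    · obtain rfl : p = n := by omega
      exact absurd (L.pos_last ▸ H.base (2 ^ l - 1) (by omega)) ha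
  refine ⟨p, rfl, hp0, hpn, le_antisymm ?_ ?_⟩
  · have := L.val_le p i g hp0 hpn hin.1 hin.2.1 hg hag.symm
    omega
  · by_contra hc
    exact ha (H.complete p hp0 hpn (by omega))

theorem pop_top {p : ℕ}
    (H : SearchInv n h ε Dg V c₀ c₁ M ((h * (n + 1) + p) :: stk) I xs cur nxt lev out)
    (ha : h * (n + 1) + p ∉ M) (hp0 : 0 < p) (hpn : p < n) (hV : V p = lev) :
    SearchInv n h ε Dg V c₀ c₁ (insert (h * (n + 1) + p) M) stk I xs cur (insert p nxt) lev
      (out ++ [(p + 1, lev)]) := by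
  have key : ∀ c, c ∈ M ∨ c ∈ (h * (n + 1) + p) :: stk →
      c ∈ insert (h * (n + 1) + p) M ∨ c ∈ stk := by
    rintro c (hc | hc)
    · exact Or.inl (mem_insert_of_mem hc)
    · rcases List.mem_cons.1 hc with rfl | hc
      · exact Or.inl (mem_insert_self _ _)
      · exact Or.inr hc
  have hM : ∀ q, h * (n + 1) + q ∈ insert (h * (n + 1) + p) M ↔ q = p ∨ h * (n + 1) + q ∈ M := by
    intro q
    rw [mem_insert]
    simp
  refine { H with
    mem_lt := ?_, stk_ok := H.stk_ok.2, closed := ?_, start := ?_, base := ?_,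
    stk_pos := fun c hc => H.stk_pos c (List.mem_cons_of_mem _ hc)
    val_le := ?_, mem_nxt := ?_, complete := ?_, nodup := ?_, mem_out := ?_, out_val := ?_,
    sorted := ?_ }
  · intro c hc
    rcases mem_insert.1 hc with rfl | hc
    · rw [add_mul]; omega
    · exact H.mem_lt c hc
  · intro c hc hclt
    rcases mem_insert.1 hc with rfl | hc
    · omega
    · exact ⟨key _ (H.closed c hc hclt).1, key _ (H.closed c hc hclt).2⟩
  · exact fun i hi => key _ (H.start i hi)
  · exact fun c hc => mem_insert_of_mem (H.base c hc)
  · intro q h0 hq hqM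
    rcases (hM q).1 hqM with rfl | hqM
    · exact hV.le
    · exact H.val_le q h0 hq hqM
  · intro q
    rw [hM, mem_insert, H.mem_nxt]
    constructor
    · rintro (rfl | h') <;> tauto
    · tauto
  · intro q h0 hq hv
    exact (hM q).2 (Or.inr (H.complete q h0 hq hv))
  · rw [List.map_append, List.nodup_append]
    refine ⟨H.nodup, by simp, ?_⟩
    intro x hx y hy
    simp only [List.map_cons, List.map_nil, List.mem_singleton] at hy
    subst hy
    obtain ⟨q, rfl, h0, hq, hqM⟩ := (H.mem_out x).1 hx
    rintro heq
    obtain rfl : q = p := by omega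
    exact ha hqM
  · intro i
    rw [List.map_append, List.mem_append, H.mem_out]
    simp only [hM, List.map_cons, List.map_nil, List.mem_singleton]
    constructor
    · rintro (⟨q, rfl, h0, hq, hqM⟩ | rfl)
      · exact ⟨q, rfl, h0, hq, Or.inr hqM⟩
      · exact ⟨p, rfl, hp0, hpn, Or.inl rfl⟩
    · rintro ⟨q, rfl, h0, hq, rfl | hqM⟩
      · exact Or.inr rfl
      · exact Or.inl ⟨q, rfl, h0, hq, hqM⟩
  · intro r hr
    rcases List.mem_append.1 hr with hr | hr
    · exact H.out_val r hr
    · rw [List.mem_singleton] at hr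
      exact ⟨p, by rw [hr, hV], hV.le⟩
  · rw [List.pairwise_append]
    refine ⟨H.sorted, by simp, ?_⟩
    intro r hr r' hr'
    rw [List.mem_singleton] at hr'
    obtain ⟨q, rfl, hq⟩ := H.out_val r hr
    rw [hr']
    exact hq

theorem begin_visit {i : ℕ} (H : SearchInv n h ε Dg V c₀ c₁ M [] I xs cur nxt lev out)
    (hi : i ∈ xs) :
    SearchInv n h ε Dg V c₀ c₁ M [Dg i] (insert i I) (xs.erase i) cur nxt lev out := by
  refine { H with
    stk_ok := ?_, stk_pos := ?_, closed := ?_, start := ?_, todo := ?_ }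
  · simp [StackOK]
  · intro a ha
    rw [List.mem_singleton] at ha
    exact ⟨i, mem_insert_self _ _, 0, Nat.zero_le _, 0, by simp, by rw [pos_zero_zero, ha]⟩
  · intro c hc hlt
    have := H.closed c hc hlt
    simp only [List.not_mem_nil, or_false] at this
    exact ⟨Or.inl this.1, Or.inl this.2⟩
  · intro j hj
    rcases mem_insert.1 hj with rfl | hj
    · simp
    · have := H.start j hj
      simp only [List.not_mem_nil, or_false] at this
      exact Or.inl this
  · intro j
    rw [← H.todo j, mem_insert, mem_erase]
    by_cases hj : j = i
    · subst hj; simp [hi]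
    · simp [hj]

theorem regroup {xs' cur' : Finset ℕ} (H : SearchInv n h ε Dg V c₀ c₁ M stk I xs cur nxt lev out)
    (hx : ∀ i, i ∈ xs' ∨ i ∈ cur' ↔ i ∈ xs ∨ i ∈ cur) :
    SearchInv n h ε Dg V c₀ c₁ M stk I xs' cur' nxt lev out :=
  { H with todo := fun i => by rw [← H.todo i, hx] }

theorem mem_of_visited (L : Layout n h ε Dg V c₀ c₁)
    (H : SearchInv n h ε Dg V c₀ c₁ M [] I xs cur nxt lev out) {i : ℕ} (hi : i ∈ I) :
    ∀ l ≤ h, ∀ g < 2 ^ l, pos (n + 1) ε l g (Dg i) ∈ M := by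
  have hin := (H.todo i).1 (Or.inl hi)
  have hD : Dg i ≤ n := L.Dg_le i hin.2.1.le
  intro l
  induction l with
  | zero =>
    intro _ g hg
    obtain rfl : g = 0 := by simpa using hg
    rw [pos_zero_zero]
    simpa using H.start i hi
  | succ l ih =>
    intro hl g hg
    rw [pow_succ] at hg
    by_cases hgl : g < 2 ^ l
    · have := (H.closed _ (ih (by omega) g hgl) ?_).1
      · rw [L.child₀ l (by omega) g hgl _ hD] at this
        simpa using this
      · refine (L.pos_lt (by omega) hgl hD).trans_le ?_
        exact Nat.mul_le_mul_right _ (by omega)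
    · have hg' : g - 2 ^ l < 2 ^ l := by omega
      have := (H.closed _ (ih (by omega) (g - 2 ^ l) hg') ?_).2
      · rw [L.child₁ l (by omega) _ hg' _ hD, Nat.sub_add_cancel (by omega)] at this
        simpa using this
      · refine (L.pos_lt (by omega) hg' hD).trans_le ?_
        exact Nat.mul_le_mul_right _ (by omega)

theorem complete_succ (L : Layout n h ε Dg V c₀ c₁)
    (H : SearchInv n h ε Dg V c₀ c₁ M [] I ∅ ∅ nxt lev out) {p : ℕ} (h0 : 0 < p) (hp : p < n)
    (hv : V p < lev + 1) : h * (n + 1) + p ∈ M := by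
  rcases Nat.lt_succ_iff_lt_or_eq.1 hv with hv | hv
  · exact H.complete p h0 hp hv
  · rcases Nat.eq_zero_or_pos lev with rfl | hlev
    · obtain ⟨c, hc, hpos⟩ := (L.val_zero p h0 hp).1 hv
      exact hpos ▸ H.base c hc
    · obtain ⟨i, c, hi0, hin, hc, hVi, hpos⟩ := L.val_succ p (lev - 1) h0 hp (by omega)
      have hi : i ∈ I := by
        have := (H.todo i).2 ⟨hi0, hin, by omega⟩
        simpa using this
      exact hpos ▸ H.mem_of_visited L hi h le_rfl c hc

theorem next_level (L : Layout n h ε Dg V c₀ c₁)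
    (H : SearchInv n h ε Dg V c₀ c₁ M [] I ∅ ∅ nxt lev out) :
    SearchInv n h ε Dg V c₀ c₁ M [] I ∅ nxt ∅ (lev + 1) out :=
  { H with
    val_le := fun p h0 hp hM => (H.val_le p h0 hp hM).trans (Nat.le_succ _)
    mem_nxt := fun p => by
      simp only [notMem_empty, false_iff]
      rintro ⟨h0, hp, hM, hV⟩
      have := H.val_le p h0 hp hM
      omega
    complete := fun p h0 hp hv => H.complete_succ L h0 hp hv
    todo := fun i => by
      have h1 := H.todo i
      simp only [notMem_empty, or_false, false_or] at h1 ⊢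
      rw [h1, H.mem_nxt]
      constructor
      · rintro (⟨h0, hi, hv⟩ | ⟨h0, hi, -, hv⟩) <;> exact ⟨h0, hi, by omega⟩
      · rintro ⟨h0, hi, hv⟩
        rcases Nat.lt_succ_iff_lt_or_eq.1 hv with hv' | hv'
        · exact Or.inl ⟨h0, hi, hv'⟩
        · exact Or.inr ⟨h0, hi, H.complete_succ L h0 hi hv, hv'⟩
    out_val := fun r hr => by
      obtain ⟨p, hp, hle⟩ := H.out_val r hr
      exact ⟨p, hp, by omega⟩ }

theorem done (L : Layout n h ε Dg V c₀ c₁)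
    (H : SearchInv n h ε Dg V c₀ c₁ M [] I ∅ ∅ ∅ lev out) (p : ℕ) (h0 : 0 < p) (hp : p < n) :
    h * (n + 1) + p ∈ M := by
  have hnone : ∀ p, 0 < p → p < n → V p ≠ lev := by
    intro p h0 hp hv
    have := (H.mem_nxt p).2 ⟨h0, hp, H.complete_succ L h0 hp (by omega), hv⟩
    simp at this
  have hlt : ∀ v p, 0 < p → p < n → V p = v → v < lev := by
    intro v
    induction v with
    | zero =>
      intro p h0 hp hv
      have := hnone p h0 hp
      omega
    | succ v ih =>
      intro p h0 hp hv
      obtain ⟨i, c, hi0, hin, hc, hVi, hpos⟩ := L.val_succ p v h0 hp hv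
      have h1 := ih i hi0 hin hVi
      have h2 := hnone p h0 hp
      omega
  exact H.complete p h0 hp (hlt _ p h0 hp rfl)

end SearchInv

end WheelerLCP

namespace WheelerLCP

open Finset

/-! ## Edges in the order of their origins -/

/-- Nodes are numbered from `0` in the Wheeler order; `lb t` is the label of the edge entering node
`t`, `pred t` its origin, and `V` is the reduced LCP array, for which the recursion given by the
last three conditions holds. -/
structure Model (n : ℕ) (lb pred V : ℕ → ℕ) : Prop where
  n_pos : 0 < n
  lb_pos : ∀ t < n, 0 < lb t
  lb_mono : ∀ s t, s ≤ t → t < n → lb s ≤ lb t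
  pred_lt : ∀ t < n, pred t < n
  pred_strict : ∀ s t, s < t → t < n → lb s = lb t → pred s < pred t
  val_zero : ∀ p, 0 < p → p < n → (V p = 0 ↔ lb (p - 1) ≠ lb p)
  val_le : ∀ p i, 0 < p → p < n → lb (p - 1) = lb p → pred (p - 1) < i → i ≤ pred p →
    V p ≤ V i + 1
  val_ex : ∀ p, 0 < p → p < n → lb (p - 1) = lb p → ∃ i, pred (p - 1) < i ∧ i ≤ pred p ∧
    V p = V i + 1

/-- Rank of the label of node `t` among the labels that occur. -/
def rk (lb : ℕ → ℕ) (t : ℕ) : ℕ := #{u ∈ range t | lb u ≠ lb (u + 1)}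

/-- Targets of the edges leaving node `i`. -/
def targets (n : ℕ) (pred : ℕ → ℕ) (i : ℕ) : List ℕ :=
  (List.range n).filter fun t => pred t = i

/-- Targets of the edges leaving nodes with numbers below `i`. -/
def edges (n : ℕ) (pred : ℕ → ℕ) (i : ℕ) : List ℕ := (List.range i).flatMap (targets n pred)

/-- Ranks of the labels of the edges in the order of their origins, and a sentinel. -/
def labelSeq (n h : ℕ) (lb pred : ℕ → ℕ) (x : ℕ) : ℕ :=
  ((edges n pred n).map (rk lb)).getD x (2 ^ h - 1)

theorem rk_succ (lb : ℕ → ℕ) (t : ℕ) :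
    rk lb (t + 1) = rk lb t + if lb t ≠ lb (t + 1) then 1 else 0 := by
  unfold rk
  rw [range_add_one, filter_insert]
  split_ifs with h
  · rw [card_insert_of_notMem (by simp)]
  · simp

theorem rk_zero (lb : ℕ → ℕ) : rk lb 0 = 0 := by simp [rk]

theorem rk_mono (lb : ℕ → ℕ) {s t : ℕ} (h : s ≤ t) : rk lb s ≤ rk lb t := by
  unfold rk
  gcongr

theorem card_range_filter (n : ℕ) (Q : ℕ → Prop) [DecidablePred Q] :
    #{t ∈ range n | Q t} = (List.range n).countP fun t => decide (Q t) := by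
  induction n with
  | zero => simp
  | succ n ih =>
    rw [range_add_one, filter_insert, List.range_succ, List.countP_append, ← ih]
    by_cases h : Q n
    · simp [h]
    · simp [h]

theorem card_filter_getD (L : List ℕ) (d : ℕ) (P : ℕ → Prop) [DecidablePred P] {k : ℕ}
    (hk : k ≤ L.length) :
    #{y ∈ range k | P (L.getD y d)} = (L.take k).countP fun t => decide (P t) := by
  induction k with
  | zero => simp
  | succ k ih =>
    have hlt : k < L.length := hk
    rw [range_add_one, filter_insert, List.take_succ_eq_append_getElem hlt, List.countP_append,
      ← ih hlt.le]
    have hg : L.getD k d = L[k] := by simp [hlt]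
    by_cases h : P L[k]
    · rw [hg, if_pos h, card_insert_of_notMem (by simp)]
      simp [h]
    · rw [hg, if_neg h]
      simp [h]

theorem edges_succ (n : ℕ) (pred : ℕ → ℕ) (i : ℕ) :
    edges n pred (i + 1) = edges n pred i ++ targets n pred i := by
  simp [edges, List.range_succ]

theorem countP_edges (n : ℕ) (pred : ℕ → ℕ) (i : ℕ) (Q : ℕ → Prop) [DecidablePred Q] :
    (edges n pred i).countP (fun t => decide (Q t)) = #{t ∈ range n | pred t < i ∧ Q t} := by
  induction i with
  | zero => simp [edges]
  | succ i ih =>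
    rw [edges_succ, List.countP_append, ih, targets, List.countP_filter]
    have h1 : (List.range n).countP (fun t => decide (Q t) && decide (pred t = i)) =
        #{t ∈ range n | pred t = i ∧ Q t} := by
      rw [card_range_filter]
      congr 1
      ext t
      simp [and_comm]
    rw [h1, ← card_union_of_disjoint]
    · congr 1
      ext t
      simp only [mem_union, mem_filter, mem_range, Nat.lt_succ_iff_lt_or_eq]
      tauto
    · rw [disjoint_left]
      intro t ht ht'
      simp only [mem_filter] at ht ht'
      omega

theorem length_edges (n : ℕ) (pred : ℕ → ℕ) (i : ℕ) :
    (edges n pred i).length = #{t ∈ range n | pred t < i} := by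
  have := countP_edges n pred i fun _ => True
  simpa using this

theorem isPrefix_edges (n : ℕ) (pred : ℕ → ℕ) {i j : ℕ} (h : i ≤ j) :
    edges n pred i <+: edges n pred j := by
  induction j, h using Nat.le_induction with
  | base => exact List.prefix_rfl
  | succ j _ ih => exact ih.trans (by rw [edges_succ]; exact List.prefix_append _ _)

namespace Model

variable {n h : ℕ} {lb pred V : ℕ → ℕ}

theorem rk_eq_iff (M : Model n lb pred V) {s t : ℕ} (hst : s ≤ t) (ht : t < n) :
    rk lb s = rk lb t ↔ lb s = lb t := by
  induction t, hst using Nat.le_induction with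
  | base => simp
  | succ t hst ih =>
    have h1 := M.lb_mono s t hst (by omega)
    have h2 := M.lb_mono t (t + 1) (by omega) ht
    have h3 := rk_mono lb hst
    have h4 := ih (by omega)
    rw [rk_succ]
    split_ifs with hne <;> omega

theorem rk_lt_iff (M : Model n lb pred V) {s t : ℕ} (hs : s < n) (ht : t < n) :
    rk lb s < rk lb t ↔ lb s < lb t := by
  rcases le_total s t with h | h
  · have h1 := M.rk_eq_iff h ht
    have h2 := rk_mono lb h
    have h3 := M.lb_mono s t h ht
    omega
  · have h2 := rk_mono lb h
    have h3 := M.lb_mono t s h hs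
    omega

theorem length_edges_all (M : Model n lb pred V) : (edges n pred n).length = n := by
  rw [length_edges, filter_true_of_mem, card_range]
  intro t ht
  exact M.pred_lt t (by simpa using ht)

theorem length_edges_le (M : Model n lb pred V) {i : ℕ} (hi : i ≤ n) :
    (edges n pred i).length ≤ n :=
  (isPrefix_edges n pred hi).length_le.trans M.length_edges_all.le

theorem labelSeq_last (M : Model n lb pred V) : labelSeq n h lb pred n = 2 ^ h - 1 := by
  unfold labelSeq
  rw [List.getD_eq_default]
  simp [M.length_edges_all]

theorem mem_edges {t i : ℕ} (ht : t ∈ edges n pred i) : t < n := by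
  simp only [edges, targets, List.mem_flatMap, List.mem_filter, List.mem_range] at ht
  obtain ⟨_, _, h, _⟩ := ht
  exact h

theorem labelSeq_lt (M : Model n lb pred V) (hh : rk lb (n - 1) + 1 < 2 ^ h) {x : ℕ}
    (hx : x < n) : labelSeq n h lb pred x < 2 ^ h - 1 := by
  unfold labelSeq
  have hx' : x < (edges n pred n).length := by rwa [M.length_edges_all]
  rw [List.getD_eq_getElem _ _ (by simpa using hx'), List.getElem_map]
  have h1 : (edges n pred n)[x] < n := mem_edges (List.getElem_mem hx')
  have h2 := rk_mono lb (show (edges n pred n)[x] ≤ n - 1 by omega)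
  omega

theorem card_labelSeq {i : ℕ} (hi : i ≤ n) (P : ℕ → Prop)
    [DecidablePred P] :
    #{y ∈ range (edges n pred i).length | P (labelSeq n h lb pred y)} =
      #{t ∈ range n | pred t < i ∧ P (rk lb t)} := by
  have hp := isPrefix_edges n pred hi
  unfold labelSeq
  rw [card_filter_getD _ _ _ (by simpa using hp.length_le), ← List.map_take,
    ← List.prefix_iff_eq_take.1 hp, List.countP_map, ← countP_edges n pred i fun t => P (rk lb t)]
  rfl

theorem pos_labelSeq (M : Model n lb pred V) (hh : rk lb (n - 1) + 1 < 2 ^ h) {c i : ℕ}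
    (hc : c < 2 ^ h) (hi : i ≤ n) :
    pos (n + 1) (labelSeq n h lb pred) h c (edges n pred i).length = h * (n + 1) +
      #{t ∈ range n | rk lb t < c ∨ rk lb t = c ∧ pred t < i} := by
  have hlt : ∀ y ≤ n, labelSeq n h lb pred y % 2 ^ h = labelSeq n h lb pred y := by
    intro y hy
    apply Nat.mod_eq_of_lt
    rcases hy.lt_or_eq with hy | rfl
    · have := M.labelSeq_lt hh hy
      omega
    · rw [M.labelSeq_last]
      omega
  have h1 : {y ∈ range (n + 1) | labelSeq n h lb pred y % 2 ^ h < c} =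
      {y ∈ range (edges n pred n).length | labelSeq n h lb pred y < c} := by
    rw [M.length_edges_all]
    ext y
    simp only [mem_filter, mem_range]
    constructor
    · rintro ⟨hy, hlt'⟩
      rw [hlt y (by omega)] at hlt'
      refine ⟨?_, hlt'⟩
      by_contra hcon
      obtain rfl : y = n := by omega
      rw [M.labelSeq_last] at hlt'
      omega
    · rintro ⟨hy, hlt'⟩
      rw [hlt y (by omega)]
      exact ⟨by omega, hlt'⟩
  have h2 : {y ∈ range (edges n pred i).length | labelSeq n h lb pred y % 2 ^ h = c} =
      {y ∈ range (edges n pred i).length | labelSeq n h lb pred y = c} := by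
    apply filter_congr
    intro y hy
    have := M.length_edges_le hi
    rw [hlt y (by simp at hy; omega)]
  unfold pos
  rw [h1, h2, card_labelSeq le_rfl (· < c), card_labelSeq hi (· = c), add_assoc,
    ← card_union_of_disjoint]
  · congr 2
    ext t
    simp only [mem_union, mem_filter, mem_range]
    constructor
    · tauto
    · rintro ⟨ht, h' | h'⟩
      · exact Or.inl ⟨ht, M.pred_lt t ht, h'⟩
      · exact Or.inr ⟨ht, h'.2, h'.1⟩
  · rw [disjoint_left]
    intro t ht ht'
    simp only [mem_filter] at ht ht'
    omega

theorem card_eq_of_lt_iff {Q : ℕ → Prop} [DecidablePred Q] {p : ℕ} (hp : p ≤ n)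
    (hQ : ∀ t < n, (Q t ↔ t < p)) : #{t ∈ range n | Q t} = p := by
  have : {t ∈ range n | Q t} = range p := by
    ext t
    simp only [mem_filter, mem_range]
    constructor
    · rintro ⟨ht, hq⟩
      exact (hQ t ht).1 hq
    · intro ht
      exact ⟨by omega, (hQ t (by omega)).2 ht⟩
  rw [this, card_range]

theorem lt_card_iff {Q : ℕ → Prop} [DecidablePred Q]
    (hQ : ∀ s t, s ≤ t → t < n → Q t → Q s) : ∀ t < n, (Q t ↔ t < #{t ∈ range n | Q t}) := by
  induction n with
  | zero => simp
  | succ n ih =>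
    intro t ht
    have ih' := ih fun s t hst ht => hQ s t hst (by omega)
    rw [range_add_one, filter_insert]
    split_ifs with hn
    · have hall : {t ∈ range n | Q t} = range n :=
        filter_true_of_mem fun s hs => hQ s n (by simp at hs; omega) (by omega) hn
      rw [hall, card_insert_of_notMem (by simp), card_range]
      simp only [ht, iff_true]
      exact hQ t n (by omega) (by omega) hn
    · rcases Nat.lt_succ_iff_lt_or_eq.1 ht with h' | rfl
      · exact ih' t h'
      · have : #{s ∈ range t | Q s} ≤ t := (card_filter_le _ _).trans (by simp)
        constructor
        · intro h'; exact absurd h' hn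
        · intro h'; omega

theorem lt_iff_of_card_eq (M : Model n lb pred V) {c i p : ℕ}
    (hp : #{t ∈ range n | rk lb t < c ∨ rk lb t = c ∧ pred t < i} = p) :
    ∀ t < n, (rk lb t < c ∨ rk lb t = c ∧ pred t < i) ↔ t < p := by
  intro t ht
  rw [← hp]
  refine lt_card_iff (Q := fun t => rk lb t < c ∨ rk lb t = c ∧ pred t < i) ?_ t ht
  intro s t hst ht hQ
  have h1 := rk_mono lb hst
  rcases hst.lt_or_eq with hst' | rfl
  · rcases hQ with hQ | hQ
    · left; omega
    · by_cases he : rk lb s = rk lb t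
      · have := M.pred_strict s t hst' ht ((M.rk_eq_iff hst ht).1 he)
        right; omega
      · left; omega
  · exact hQ

/-- The data of the search for a pseudoforest. -/
theorem layout (M : Model n lb pred V) (hh : rk lb (n - 1) + 1 < 2 ^ h) {c₀ c₁ : ℕ → ℕ}
    (h₀ : ∀ l < h, ∀ g < 2 ^ l, ∀ x ≤ n, c₀ (pos (n + 1) (labelSeq n h lb pred) l g x) =
      pos (n + 1) (labelSeq n h lb pred) (l + 1) g x)
    (h₁ : ∀ l < h, ∀ g < 2 ^ l, ∀ x ≤ n, c₁ (pos (n + 1) (labelSeq n h lb pred) l g x) =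
      pos (n + 1) (labelSeq n h lb pred) (l + 1) (g + 2 ^ l) x) :
    Layout n h (labelSeq n h lb pred) (fun i => (edges n pred i).length) V c₀ c₁ where
  n_pos := M.n_pos
  last := M.labelSeq_last
  lt_last _ hx := M.labelSeq_lt hh hx
  Dg_le _ hi := M.length_edges_le hi
  child₀ := h₀
  child₁ := h₁
  val_zero p h0 hp := by
    have hpos : ∀ c < 2 ^ h, (pos (n + 1) (labelSeq n h lb pred) h c 0 = h * (n + 1) + p ↔
        #{t ∈ range n | rk lb t < c ∨ rk lb t = c ∧ pred t < 0} = p) := by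
      intro c hc
      have := M.pos_labelSeq hh (i := 0) hc (Nat.zero_le n)
      rw [show (edges n pred 0).length = 0 by simp [edges]] at this
      rw [this]
      omega
    have hp1 := M.rk_eq_iff (show p - 1 ≤ p by omega) hp
    have hp2 := rk_mono lb (show p - 1 ≤ p by omega)
    rw [M.val_zero p h0 hp]
    constructor
    · intro hne
      have hlast := rk_mono lb (show p ≤ n - 1 by omega)
      refine ⟨rk lb p, by omega, (hpos _ (by omega)).2 ?_⟩
      refine card_eq_of_lt_iff hp.le fun t ht => ?_
      rcases Nat.lt_or_ge t p with h' | h'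
      · have := rk_mono lb (show t ≤ p - 1 by omega)
        omega
      · have := rk_mono lb h'
        omega
    · rintro ⟨c, hc, heq⟩
      have := M.lt_iff_of_card_eq ((hpos c hc).1 heq)
      have h1 := this (p - 1) (by omega)
      have h2 := this p hp
      omega
  val_le p i c h0 hp hi0 hin hc heq := by
    rw [M.pos_labelSeq hh hc hin.le] at heq
    have := M.lt_iff_of_card_eq (Nat.add_left_cancel heq)
    have h1 := this (p - 1) (by omega)
    have h2 := this p hp
    by_cases hl : lb (p - 1) = lb p
    · have hr := (M.rk_eq_iff (show p - 1 ≤ p by omega) hp).2 hl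
      exact M.val_le p i h0 hp hl (by omega) (by omega)
    · rw [(M.val_zero p h0 hp).2 hl]
      omega
  val_succ p v h0 hp hv := by
    have hl : lb (p - 1) = lb p := by
      by_contra hne
      have := (M.val_zero p h0 hp).2 hne
      omega
    obtain ⟨i, hi1, hi2, hVi⟩ := M.val_ex p h0 hp hl
    have hlast := rk_mono lb (show p ≤ n - 1 by omega)
    have hpl := M.pred_lt p hp
    have hr := (M.rk_eq_iff (show p - 1 ≤ p by omega) hp).2 hl
    refine ⟨i, rk lb p, by omega, by omega, by omega, by omega, ?_⟩
    rw [M.pos_labelSeq hh (by omega) (by omega)]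
    congr 1
    refine card_eq_of_lt_iff hp.le fun t ht => ?_
    rcases Nat.lt_trichotomy t (p - 1) with h' | h' | h'
    · have h1 := rk_mono lb h'.le
      have h2 := M.rk_eq_iff h'.le (show p - 1 < n by omega)
      have h3 := M.pred_strict t (p - 1) h' (by omega)
      omega
    · subst h'; omega
    · have h1 := rk_mono lb (show p ≤ t by omega)
      have h2 := M.rk_eq_iff (show p ≤ t by omega) ht
      rcases Nat.lt_or_ge p t with h4 | h4
      · have h3 := M.pred_strict p t h4 ht
        omega
      · obtain rfl : t = p := by omega
        omega

end Model

end WheelerLCP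

namespace WheelerLCP

open Finset

/-! ## From pseudoforests to models -/

/-- The number of the first position at which the strings read backwards from the nodes `p - 1`
and `p` differ. -/
noncomputable def firstDiff (lb pred : ℕ → ℕ) (p : ℕ) : ℕ :=
  sInf {k | lb (pred^[k] (p - 1)) ≠ lb (pred^[k] p)}

section

variable {n : ℕ} {lb pred : ℕ → ℕ}

theorem iterate_pred_lt (hp : ∀ t < n, pred t < n) (k : ℕ) {t : ℕ} (ht : t < n) :
    pred^[k] t < n := by
  induction k with
  | zero => exact ht
  | succ k ih => rw [Function.iterate_succ_apply']; exact hp _ ih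

theorem iterate_pred_strict (hp : ∀ t < n, pred t < n)
    (hs : ∀ s t, s < t → t < n → lb s = lb t → pred s < pred t) {s t k : ℕ} (hst : s < t)
    (ht : t < n) (hk : ∀ j < k, lb (pred^[j] s) = lb (pred^[j] t)) : pred^[k] s < pred^[k] t := by
  induction k with
  | zero => exact hst
  | succ k ih =>
    rw [Function.iterate_succ_apply', Function.iterate_succ_apply']
    exact hs _ _ (ih fun j hj => hk j (by omega)) (iterate_pred_lt hp k ht) (hk k (by omega))

theorem agree_of_between (hm : ∀ s t, s ≤ t → t < n → lb s ≤ lb t) (hp : ∀ t < n, pred t < n)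
    (hs : ∀ s t, s < t → t < n → lb s = lb t → pred s < pred t) {k : ℕ} :
    ∀ {x u y : ℕ}, x ≤ u → u ≤ y → y < n → (∀ j < k, lb (pred^[j] x) = lb (pred^[j] y)) →
      ∀ j < k, lb (pred^[j] x) = lb (pred^[j] u) := by
  have hle : ∀ s t, s ≤ t → t < n → lb s = lb t → pred s ≤ pred t := by
    intro s t hst ht he
    rcases hst.lt_or_eq with h | rfl
    · exact (hs s t h ht he).le
    · exact le_rfl
  induction k with
  | zero => intro x u y _ _ _ _ j hj; omega
  | succ k ih =>
    intro x u y hxu huy hy hag j hj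
    have h0 : lb x = lb y := hag 0 (by omega)
    have h1 := hm x u hxu (by omega)
    have h2 := hm u y huy hy
    rcases j with _ | j
    · simp only [Function.iterate_zero, id_eq]; omega
    · rw [Function.iterate_succ_apply, Function.iterate_succ_apply]
      refine ih (hle x u hxu (by omega) (by omega)) (hle u y huy hy (by omega)) (hp y hy) ?_ j
        (by omega)
      intro i hi
      have := hag (i + 1) (by omega)
      rwa [Function.iterate_succ_apply, Function.iterate_succ_apply] at this

theorem agree_trans {k : ℕ} {x y : ℕ} (hxy : x ≤ y)
    (h : ∀ i, x < i → i ≤ y → ∀ j < k, lb (pred^[j] (i - 1)) = lb (pred^[j] i)) :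
    ∀ j < k, lb (pred^[j] x) = lb (pred^[j] y) := by
  induction y, hxy using Nat.le_induction with
  | base => intros; rfl
  | succ y hxy ih =>
    intro j hj
    rw [ih (fun i hi hiy => h i hi (by omega)) j hj]
    exact h (y + 1) (by omega) le_rfl j hj

theorem agree_iff_le_firstDiff {p : ℕ} (hd : ∃ k, lb (pred^[k] (p - 1)) ≠ lb (pred^[k] p))
    (k : ℕ) : (∀ j < k, lb (pred^[j] (p - 1)) = lb (pred^[j] p)) ↔ k ≤ firstDiff lb pred p := by
  have hmem : firstDiff lb pred p ∈ {k | lb (pred^[k] (p - 1)) ≠ lb (pred^[k] p)} := Nat.sInf_mem hd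
  constructor
  · intro h
    by_contra hc
    exact hmem (h _ (by omega))
  · intro h j hj
    by_contra hc
    have : firstDiff lb pred p ≤ j := Nat.sInf_le hc
    omega

theorem model_of_distinct (hn : 0 < n) (hpos : ∀ t < n, 0 < lb t)
    (hm : ∀ s t, s ≤ t → t < n → lb s ≤ lb t) (hp : ∀ t < n, pred t < n)
    (hs : ∀ s t, s < t → t < n → lb s = lb t → pred s < pred t)
    (hd : ∀ p, 0 < p → p < n → ∃ k, lb (pred^[k] (p - 1)) ≠ lb (pred^[k] p)) :
    Model n lb pred (firstDiff lb pred) where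
  n_pos := hn
  lb_pos := hpos
  lb_mono := hm
  pred_lt := hp
  pred_strict := hs
  val_zero p h0 hpn := by
    have h := agree_iff_le_firstDiff (hd p h0 hpn) 1
    simp only [Nat.lt_one_iff, forall_eq, Function.iterate_zero, id_eq] at h
    rw [ne_eq, h]
    omega
  val_le p i h0 hpn hl hi1 hi2 := by
    have hpp := hp p hpn
    set k := firstDiff lb pred p with hk
    rcases Nat.eq_zero_or_pos k with h' | h'
    · omega
    have h1 := (agree_iff_le_firstDiff (hd p h0 hpn) k).2 le_rfl
    have h2 : ∀ j < k - 1, lb (pred^[j] (pred (p - 1))) = lb (pred^[j] (pred p)) := by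
      intro j hj
      have := h1 (j + 1) (by omega)
      rwa [Function.iterate_succ_apply, Function.iterate_succ_apply] at this
    have h3 := agree_of_between hm hp hs (show pred (p - 1) ≤ i - 1 by omega) (by omega) hpp h2
    have h4 := agree_of_between hm hp hs (show pred (p - 1) ≤ i by omega) (by omega) hpp h2
    have h5 := (agree_iff_le_firstDiff (hd i (by omega) (by omega)) (k - 1)).1
      fun j hj => (h3 j hj).symm.trans (h4 j hj)
    omega
  val_ex p h0 hpn hl := by
    have hpp := hp p hpn
    have hlt := hs (p - 1) p (by omega) hpn hl
    set k := firstDiff lb pred p with hk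
    by_contra hcon
    push Not at hcon
    have hge : ∀ i, pred (p - 1) < i → i ≤ pred p → k ≤ firstDiff lb pred i := by
      intro i hi1 hi2
      by_contra hc
      have h1 := (agree_iff_le_firstDiff (hd p h0 hpn) k).2 le_rfl
      have h2 : ∀ j < k - 1, lb (pred^[j] (pred (p - 1))) = lb (pred^[j] (pred p)) := by
        intro j hj
        have := h1 (j + 1) (by omega)
        rwa [Function.iterate_succ_apply, Function.iterate_succ_apply] at this
      have h3 := agree_of_between hm hp hs (show pred (p - 1) ≤ i - 1 by omega) (by omega) hpp h2
      have h4 := agree_of_between hm hp hs (show pred (p - 1) ≤ i by omega) (by omega) hpp h2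
      have h5 := (agree_iff_le_firstDiff (hd i (by omega) (by omega)) (k - 1)).1
        fun j hj => (h3 j hj).symm.trans (h4 j hj)
      exact hcon i hi1 hi2 (by omega)
    have h6 := agree_trans hlt.le fun i hi1 hi2 =>
      (agree_iff_le_firstDiff (hd i (by omega) (by omega)) k).2 (hge i hi1 hi2)
    have h7 := (agree_iff_le_firstDiff (hd p h0 hpn) (k + 1)).1 ?_
    · omega
    · intro j hj
      rcases j with _ | j
      · exact hl
      · rw [Function.iterate_succ_apply, Function.iterate_succ_apply]
        exact h6 j (by omega)

end

namespace LabeledGraph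

variable {V : Type*} {σ : ℕ} {G : LabeledGraph V σ}

theorem IsPseudoforest.exists_parent (hG : G.IsPseudoforest) :
    ∃ (par : V → V) (la : V → Fin σ), ∀ u u' a, (u', u, a) ∈ G.E ↔ u' = par u ∧ a = la u := by
  have h : ∀ u, ∃ e : V × Fin σ, ∀ u' a, (u', u, a) ∈ G.E ↔ u' = e.1 ∧ a = e.2 := by
    intro u
    obtain ⟨⟨x, y, a⟩, he⟩ := Set.ncard_eq_one.1 (hG u)
    have hmem : ∀ u' a', (u', u, a') ∈ G.E ↔ (u', u, a') = (x, y, a) := by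
      intro u' a'
      rw [← Set.mem_singleton_iff, ← he]
      simp
    have hy : y = u := by
      have : (x, y, a) ∈ {e ∈ G.E | e.2.1 = u} := by rw [he]; rfl
      exact this.2
    subst hy
    refine ⟨(x, a), fun u' a' => ?_⟩
    rw [hmem]
    simp
  choose f hf using h
  exact ⟨fun u => (f u).1, fun u => (f u).2, hf⟩

/-- The string read backwards from `u` if `par` and `la` give the only edge entering a node. -/
def backStr (par : V → V) (la : V → Fin σ) (u : V) : Str σ :=
  ⟨toLex fun k => (la (par^[k] u) : WithBot (Fin σ)), fun _ h => by simp at h⟩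

theorem at_backStr (par : V → V) (la : V → Fin σ) (u : V) (k : ℕ) :
    (backStr par la u).at k = (la (par^[k] u) : WithBot (Fin σ)) := rfl

theorem backStrings_eq (hG : G.IsPseudoforest) {par : V → V} {la : V → Fin σ}
    (hE : ∀ u u' a, (u', u, a) ∈ G.E ↔ u' = par u ∧ a = la u) (u : V) :
    G.backStrings u = {backStr par la u} := by
  ext α
  rw [Set.mem_singleton_iff]
  constructor
  · rintro (⟨p, hp0, hp⟩ | ⟨m, p, -, hm, -⟩)
    · have hpk : ∀ k, p k = par^[k] u := by
        intro k
        induction k with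
        | zero => exact hp0
        | succ k ih =>
          obtain ⟨c, -, hc⟩ := hp k
          rw [Function.iterate_succ_apply', ← ih]
          exact ((hE _ _ _).1 hc).1
      apply Subtype.ext
      apply ofLex.injective
      funext k
      obtain ⟨c, hc, hcE⟩ := hp k
      have h1 : c = la (par^[k] u) := by rw [← hpk]; exact ((hE _ _ _).1 hcE).2
      exact hc.trans (by rw [h1]; rfl)
    · rw [hG (p m)] at hm
      exact absurd hm one_ne_zero
  · rintro rfl
    refine Or.inl ⟨fun k => par^[k] u, rfl, fun i => ⟨la (par^[i] u), rfl, ?_⟩⟩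
    rw [hE]
    exact ⟨Function.iterate_succ_apply' _ _ _, rfl⟩

theorem infStr_eq (hG : G.IsPseudoforest) {par : V → V} {la : V → Fin σ}
    (hE : ∀ u u' a, (u', u, a) ∈ G.E ↔ u' = par u ∧ a = la u) (u : V) :
    G.infStr u = backStr par la u := by
  have h : IsGLB (G.backStrings u) (G.infStr u) :=
    Classical.epsilon_spec (p := fun γ => IsGLB (G.backStrings u) γ)
      ⟨backStr par la u, by rw [backStrings_eq hG hE]; exact isGLB_singleton⟩
  rw [backStrings_eq hG hE] at h
  exact h.unique isGLB_singleton

theorem mem_outl {u : V} {c : Fin σ} : c ∈ G.outl u ↔ G.HasOut u c := by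
  simp [outl]

end LabeledGraph

theorem Str.lt_of_at {σ : ℕ} {a b : Str σ} {k : ℕ} (h : ∀ j < k, a.at j = b.at j)
    (hk : a.at k < b.at k) : a < b := by
  change toLex (ofLex a.1) < toLex (ofLex b.1)
  exact ⟨k, h, hk⟩

theorem Str.lcp_eq {σ : ℕ} {a b : Str σ} {m : ℕ} (h : ∀ k, Str.CommonPrefix a b k ↔ k ≤ m) :
    Str.lcp a b = m := by
  apply le_antisymm
  · exact iSup₂_le fun k hk => by exact_mod_cast (h k).1 hk
  · exact le_iSup₂ (f := fun (k : ℕ) (_ : Str.CommonPrefix a b k) => (k : ℕ∞)) m ((h m).2 le_rfl)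

/-- A deterministic pseudoforest with a Wheeler order, its index and its reduced LCP array, in terms
of the numbers of the nodes. -/
theorem exists_model {n σ : ℕ} {V : Type*} [Fintype V] {G : LabeledGraph V σ}
    {lt : V → V → Prop} (v : Fin n ≃ V) (hn : 0 < n) (hdet : G.Deterministic)
    (hG : G.IsPseudoforest) (hW : G.IsWheelerOrder lt) (hv : ∀ i j, i < j → lt (v i) (v j))
    (hinj : Function.Injective G.infStr) :
    ∃ lb pred val : ℕ → ℕ, Model n lb pred val ∧
      (∀ t < n, lb t ≤ σ) ∧
      (∀ t < n, (FMIndex.ofGraph G v).inLabel (t + 1) = lb t) ∧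
      (∀ i < n, ∀ j, (FMIndex.ofGraph G v).outLabel (i + 1) (j + 1) =
        ((targets n pred i).map lb).getD j 0) ∧
      ∀ p, 0 < p → p < n → G.reducedLCP (p + 1) = val p := by
  obtain ⟨par, la, hE⟩ := hG.exists_parent
  have hirr : ∀ u, ¬ lt u u := hW.total.irrefl
  have hasym : ∀ u u', lt u u' → ¬ lt u' u := fun u u' h h' => hirr u (hW.total.trans _ _ _ h h')
  let pr : Fin n → Fin n := fun t => v.symm (par (v t))
  let lb : ℕ → ℕ := fun t => if h : t < n then (la (v ⟨t, h⟩) : ℕ) + 1 else 0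
  let pred : ℕ → ℕ := fun t => if h : t < n then (pr ⟨t, h⟩ : ℕ) else 0
  have hlb : ∀ t : Fin n, lb t = (la (v t) : ℕ) + 1 := fun t => by simp [lb]
  have hpred : ∀ t : Fin n, pred t = (pr t : ℕ) := fun t => by simp [pred]
  have hpr : ∀ t, v (pr t) = par (v t) := fun t => by simp [pr]
  have hpredlt : ∀ t < n, pred t < n := fun t ht => by
    rw [hpred ⟨t, ht⟩]; exact (pr ⟨t, ht⟩).2
  have hmono : ∀ s t, s ≤ t → t < n → lb s ≤ lb t := by
    intro s t hst ht
    rcases hst.lt_or_eq with h | rfl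
    · rw [hlb ⟨s, by omega⟩, hlb ⟨t, ht⟩]
      have := hW.label_le _ _ _ _ _ _ ((hE (v ⟨s, by omega⟩) _ _).2 ⟨rfl, rfl⟩)
        ((hE (v ⟨t, ht⟩) _ _).2 ⟨rfl, rfl⟩) (hv _ _ h)
      exact Nat.succ_le_succ this
    · exact le_rfl
  have hstrict : ∀ s t, s < t → t < n → lb s = lb t → pred s < pred t := by
    intro s t hst ht he
    rw [hlb ⟨s, by omega⟩, hlb ⟨t, ht⟩] at he
    have hla : la (v ⟨s, by omega⟩) = la (v ⟨t, ht⟩) := Fin.ext (by omega)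
    have e₁ := (hE (v ⟨s, by omega⟩) _ _).2 ⟨rfl, rfl⟩
    have e₂ := (hE (v ⟨t, ht⟩) _ _).2 ⟨rfl, hla⟩
    rw [hpred ⟨s, by omega⟩, hpred ⟨t, ht⟩]
    rw [← Fin.lt_def]
    have hne : v ⟨s, by omega⟩ ≠ v ⟨t, ht⟩ := fun h => by
      have := congrArg Fin.val (v.injective h)
      simp at this
      omega
    rcases hW.origin_le _ _ _ _ _ e₁ e₂ (hv _ _ hst) with h | h
    · by_contra hc
      rcases (not_lt.1 hc).lt_or_eq with h' | h'
      · have := hv _ _ h'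
        rw [hpr, hpr] at this
        exact hasym _ _ h this
      · rw [← hpr, ← hpr, h'] at h
        exact hirr _ h
    · rw [← h] at e₂
      exact absurd rfl (hdet _ _ _ _ _ e₁ e₂ hne)
  have hiter : ∀ k (t : Fin n), ∃ s : Fin n, pred^[k] t = s ∧ v s = par^[k] (v t) := by
    intro k t
    induction k with
    | zero => exact ⟨t, rfl, rfl⟩
    | succ k ih =>
      obtain ⟨s, h1, h2⟩ := ih
      refine ⟨pr s, ?_, ?_⟩
      · rw [Function.iterate_succ_apply', h1, hpred]
      · rw [Function.iterate_succ_apply', ← h2, hpr]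
  have hinf : ∀ u, G.infStr u = LabeledGraph.backStr par la u := LabeledGraph.infStr_eq hG hE
  have hat : ∀ k (t : Fin n), ∃ a : Fin σ, (G.infStr (v t)).at k = (a : WithBot (Fin σ)) ∧
      lb (pred^[k] t) = (a : ℕ) + 1 := by
    intro k t
    obtain ⟨s, h1, h2⟩ := hiter k t
    refine ⟨la (v s), ?_, ?_⟩
    · rw [hinf, LabeledGraph.at_backStr, h2]
    · rw [h1, hlb]
  have hateq : ∀ k (s t : Fin n), (G.infStr (v s)).at k = (G.infStr (v t)).at k ↔
      lb (pred^[k] s) = lb (pred^[k] t) := by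
    intro k s t
    obtain ⟨a, h1, h2⟩ := hat k s
    obtain ⟨a', h3, h4⟩ := hat k t
    rw [h1, h2, h3, h4, WithBot.coe_inj, Fin.ext_iff]
    omega
  have hdiff : ∀ s t : Fin n, s < t → ∃ k, lb (pred^[k] s) ≠ lb (pred^[k] t) := by
    intro s t hst
    by_contra hc
    push Not at hc
    have : G.infStr (v s) = G.infStr (v t) := by
      apply Subtype.ext
      apply ofLex.injective
      funext k
      exact (hateq k s t).2 (hc k)
    have := v.injective (hinj this)
    exact hst.ne this
  have hd : ∀ p, 0 < p → p < n → ∃ k, lb (pred^[k] (p - 1)) ≠ lb (pred^[k] p) := by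
    intro p h0 hp
    exact hdiff ⟨p - 1, by omega⟩ ⟨p, hp⟩ (by rw [Fin.lt_def]; simp; omega)
  have hstr : ∀ s t : Fin n, s < t → G.infStr (v s) < G.infStr (v t) := by
    intro s t hst
    classical
    have hk := Nat.find_spec (hdiff s t hst)
    have hlow := fun j (hj : j < Nat.find (hdiff s t hst)) =>
      not_not.1 (Nat.find_min (hdiff s t hst) hj)
    set k := Nat.find (hdiff s t hst)
    refine Str.lt_of_at (k := k) (fun j hj => (hateq j s t).2 (hlow j hj)) ?_
    have h1 := iterate_pred_strict hpredlt hstrict hst t.2 hlow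
    have h2 := hmono _ _ h1.le (iterate_pred_lt hpredlt k t.2)
    obtain ⟨a, h3, h4⟩ := hat k s
    obtain ⟨a', h5, h6⟩ := hat k t
    rw [h3, h5, WithBot.coe_lt_coe, Fin.lt_def]
    omega
  refine ⟨lb, pred, firstDiff lb pred, model_of_distinct hn ?_ hmono hpredlt hstrict hd, ?_, ?_, ?_,
    ?_⟩
  · intro t ht
    rw [hlb ⟨t, ht⟩]
    omega
  · intro t ht
    rw [hlb ⟨t, ht⟩]
    exact (la (v ⟨t, ht⟩)).2
  · intro t ht
    have : FMIndex.inLabelAnswers G v (t + 1) = {lb t} := by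
      ext r
      simp only [FMIndex.inLabelAnswers, Set.mem_ofPred_eq, Set.mem_singleton_iff, hE]
      constructor
      · rintro ⟨k, a, hk, ha, u, -, hla⟩
        obtain rfl : (k : ℕ) = t := by omega
        rw [hlb, ← hla, ha]
      · rintro rfl
        exact ⟨⟨t, ht⟩, la (v ⟨t, ht⟩), rfl, (hlb ⟨t, ht⟩).symm, _, rfl, rfl⟩
    change sInf (FMIndex.inLabelAnswers G v (t + 1)) = lb t
    rw [this, csInf_singleton]
  · intro i hi j
    have hcond : 1 ≤ j + 1 ∧ 1 ≤ i + 1 ∧ i + 1 - 1 < n := ⟨by omega, by omega, by omega⟩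
    have hlist : (G.outl (v ⟨i, hi⟩)).map (fun a : Fin σ => (a : ℕ) + 1) =
        (targets n pred i).map lb := by
      have hsub : ∀ t ∈ targets n pred i, t < n ∧ pred t = i := by
        intro t ht
        simpa [targets] using ht
      have hs1 : ((G.outl (v ⟨i, hi⟩)).map (fun a : Fin σ => (a : ℕ) + 1)).Pairwise (· < ·) := by
        rw [List.pairwise_map]
        refine (Finset.sortedLT_sort _).pairwise.imp ?_
        intro a b hab
        rw [Fin.lt_def] at hab
        omega
      have hs2 : ((targets n pred i).map lb).Pairwise (· < ·) := by
        rw [List.pairwise_map]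
        have h1 : (targets n pred i).Pairwise (· < ·) := List.pairwise_lt_range.filter _
        refine h1.imp_of_mem ?_
        intro s t hs ht hst
        obtain ⟨hs1, hs2⟩ := hsub s hs
        obtain ⟨ht1, ht2⟩ := hsub t ht
        refine lt_of_le_of_ne (hmono s t hst.le ht1) fun he => ?_
        have := hstrict s t hst ht1 he
        omega
      apply List.Perm.eq_of_pairwise (le := (· < ·)) (fun a b _ _ h h' => absurd h' h.asymm) hs1 hs2
      rw [List.perm_ext_iff_of_nodup hs1.nodup hs2.nodup]
      intro r
      simp only [List.mem_map, LabeledGraph.mem_outl, LabeledGraph.HasOut, hE]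
      constructor
      · rintro ⟨a, ⟨u, hu1, hu2⟩, rfl⟩
        refine ⟨v.symm u, ?_, ?_⟩
        · simp only [targets, List.mem_filter, List.mem_range, Fin.is_lt, decide_eq_true_eq,
            true_and]
          rw [hpred]
          simp [pr, ← hu1]
        · rw [hlb]
          simp [hu2]
      · rintro ⟨t, ht, rfl⟩
        obtain ⟨ht1, ht2⟩ := hsub t ht
        refine ⟨la (v ⟨t, ht1⟩), ⟨v ⟨t, ht1⟩, ?_, rfl⟩, (hlb ⟨t, ht1⟩).symm⟩
        rw [← hpr]
        congr 1
        apply Fin.ext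
        exact ht2.symm.trans (hpred ⟨t, ht1⟩)
    rw [← hlist]
    simp only [FMIndex.ofGraph]
    rw [dif_pos hcond]
    simp [← List.map_eq_flatMap, Function.comp_def]
  · intro p h0 hp
    have hsort : G.sortedInfima = List.ofFn fun t => G.infStr (v t) := by
      classical
      have hpw : (List.ofFn fun t => G.infStr (v t)).Pairwise (· < ·) := by
        rw [List.pairwise_ofFn]
        exact hstr
      have himg : Finset.univ.image G.infStr = (List.ofFn fun t => G.infStr (v t)).toFinset := by
        ext x
        simp only [Finset.mem_image, Finset.mem_univ, true_and, List.mem_toFinset, List.mem_ofFn]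
        constructor
        · rintro ⟨u, rfl⟩
          exact ⟨v.symm u, by simp⟩
        · rintro ⟨t, rfl⟩
          exact ⟨v t, rfl⟩
      have := (List.toFinset_sort (· ≤ ·) hpw.nodup).2 (hpw.imp le_of_lt)
      rw [← himg] at this
      rw [← this, LabeledGraph.sortedInfima]
    have hget : ∀ q (hq : q < n), G.sortedInfima.getD q (Str.empty σ) = G.infStr (v ⟨q, hq⟩) := by
      intro q hq
      rw [hsort, List.getD_eq_getElem _ _ (by simpa using hq)]
      simp
    unfold LabeledGraph.reducedLCP
    rw [show p + 1 - 2 = p - 1 by omega, show p + 1 - 1 = p by omega, hget (p - 1) (by omega),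
      hget p hp]
    apply Str.lcp_eq
    intro k
    rw [← agree_iff_le_firstDiff (hd p h0 hp)]
    apply forall₂_congr
    intro j _
    have h1 := hateq j ⟨p - 1, by omega⟩ ⟨p, hp⟩
    rw [h1]
    obtain ⟨a, ha, -⟩ := hat j ⟨p - 1, by omega⟩
    rw [ha]
    simp

end WheelerLCP

namespace WheelerLCP

open Finset

set_option linter.constructorNameAsVariable false

/-! ## Bit arrays -/

/-- The words of the array `f` hold the characteristic function of `S`, `b` bits each. -/
def HasBits (b : ℕ) (f : ℕ → ℕ) (S : Set ℕ) : Prop :=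
  ∀ k o, (f k).testBit o = true ↔ o < b ∧ k * b + o ∈ S

/-- Number of ones among the `b` lowest bits. -/
def ones (b x : ℕ) : ℕ := #{o ∈ range b | x.testBit o = true}

open Classical in
/-- Number of elements of `S` below `a`. -/
noncomputable def rankOf (S : Set ℕ) (a : ℕ) : ℕ := #{c ∈ range a | c ∈ S}

namespace HasBits

variable {b : ℕ} {f : ℕ → ℕ} {S : Set ℕ}

theorem zero : HasBits b (fun _ => 0) ∅ := by simp [HasBits]

theorem lt (H : HasBits b f S) (k : ℕ) : f k < 2 ^ b := by
  apply Nat.lt_pow_two_of_testBit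
  intro o ho
  have := H k o
  rw [← Bool.not_eq_true, this]
  omega

theorem congr {g : ℕ → ℕ} (H : HasBits b f S) (h : ∀ k, g k = f k) : HasBits b g S := by
  intro k o
  rw [h]
  exact H k o

theorem insert (H : HasBits b f S) (hb : 0 < b) (a : ℕ) :
    HasBits b (Function.update f (a / b) (f (a / b) ||| 2 ^ (a % b))) (Insert.insert a S) := by
  intro k o
  have ha := Nat.div_add_mod a b
  have hm := Nat.mod_lt a hb
  by_cases hk : k = a / b
  · subst hk
    rw [Function.update_self, Nat.testBit_or, Bool.or_eq_true, H, Nat.testBit_two_pow,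
      decide_eq_true_eq, Set.mem_insert_iff]
    rw [mul_comm] at ha
    constructor
    · rintro (h | h)
      · exact ⟨h.1, Or.inr h.2⟩
      · exact ⟨by omega, Or.inl (by omega)⟩
    · rintro ⟨h1, h2 | h2⟩
      · exact Or.inr (by omega)
      · exact Or.inl ⟨h1, h2⟩
  · rw [Function.update_of_ne hk, H, Set.mem_insert_iff]
    constructor
    · rintro ⟨h1, h2⟩
      exact ⟨h1, Or.inr h2⟩
    · rintro ⟨h1, h2 | h2⟩
      · refine absurd ?_ hk
        rw [← h2, mul_comm, Nat.mul_add_div hb, Nat.div_eq_of_lt h1, add_zero]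
      · exact ⟨h1, h2⟩

theorem mem_iff (H : HasBits b f S) (hb : 0 < b) (a : ℕ) :
    a ∈ S ↔ f (a / b) / 2 ^ (a % b) % 2 = 1 := by
  have h := H (a / b) (a % b)
  rw [Nat.testBit_eq_decide_div_mod_eq, decide_eq_true_eq, mul_comm, Nat.div_add_mod] at h
  rw [h]
  simp [Nat.mod_lt a hb]

theorem rank_mul (H : HasBits b f S) (k r : ℕ) (hr : r ≤ b) :
    rankOf S (k * b + r) = rankOf S (k * b) + ones b (f k % 2 ^ r) := by
  classical
  unfold rankOf ones
  have h1 : {c ∈ range (k * b + r) | c ∈ S} = {c ∈ range (k * b) | c ∈ S} ∪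
      {o ∈ range b | (f k % 2 ^ r).testBit o = true}.image (k * b + ·) := by
    ext c
    simp only [mem_union, mem_filter, mem_range, mem_image, Nat.testBit_mod_two_pow,
      Bool.and_eq_true, decide_eq_true_eq]
    constructor
    · rintro ⟨hc, hS⟩
      rcases Nat.lt_or_ge c (k * b) with h | h
      · exact Or.inl ⟨h, hS⟩
      · obtain ⟨o, rfl⟩ := Nat.exists_eq_add_of_le h
        exact Or.inr ⟨o, ⟨by omega, by omega, (H k o).2 ⟨by omega, hS⟩⟩, rfl⟩
    · rintro (h | ⟨o, ⟨h1, h2, h3⟩, rfl⟩)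
      · exact ⟨by omega, h.2⟩
      · exact ⟨by omega, ((H k o).1 h3).2⟩
  have h2 := congrArg card h1
  rw [card_union_of_disjoint, card_image_of_injective _ (add_right_injective _)] at h2
  · convert h2
  · rw [disjoint_left]
    intro c hc hc'
    simp only [mem_filter, mem_range, mem_image] at hc hc'
    obtain ⟨o, -, rfl⟩ := hc'
    omega

theorem rank_eq (H : HasBits b f S) (hb : 0 < b) (a : ℕ) :
    rankOf S a = rankOf S (a / b * b) + ones b (f (a / b) % 2 ^ (a % b)) := by
  rw [← H.rank_mul _ _ (Nat.mod_lt a hb).le, mul_comm, Nat.div_add_mod]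

theorem rank_succ (H : HasBits b f S) (k : ℕ) :
    rankOf S ((k + 1) * b) = rankOf S (k * b) + ones b (f k) := by
  rw [add_mul, one_mul, H.rank_mul k b le_rfl, Nat.mod_eq_of_lt (H.lt k)]

end HasBits

theorem rankOf_zero (S : Set ℕ) : rankOf S 0 = 0 := by simp [rankOf]

theorem rankOf_mono (S : Set ℕ) {a c : ℕ} (h : a ≤ c) : rankOf S a ≤ rankOf S c := by
  unfold rankOf
  gcongr

theorem rankOf_le (S : Set ℕ) (a : ℕ) : rankOf S a ≤ a := by
  classical
  unfold rankOf
  exact (card_filter_le _ _).trans (by simp)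

theorem ones_zero (b : ℕ) : ones b 0 = 0 := by simp [ones]

theorem ones_le (b x : ℕ) : ones b x ≤ b := by
  unfold ones
  exact (card_filter_le _ _).trans (by simp)

theorem ones_half {b x : ℕ} (hx : x < 2 ^ b) : ones b x = ones b (x / 2) + x % 2 := by
  have h1 : ones (b + 1) x = ones b x := by
    unfold ones
    rw [range_add_one, filter_insert, if_neg]
    rw [Nat.testBit_lt_two_pow hx]
    simp
  have h2 : ∀ b, ones (b + 1) x = ones b (x / 2) + x % 2 := by
    intro b
    induction b with
    | zero =>
      unfold ones
      rcases Nat.mod_two_eq_zero_or_one x with h | h <;>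
        simp [range_one, filter_singleton, Nat.testBit_zero, h]
    | succ b ih =>
      have e : ∀ b x, ones (b + 1) x = ones b x + if x.testBit b = true then 1 else 0 := by
        intro b x
        unfold ones
        rw [range_add_one, filter_insert]
        split_ifs
        · rw [card_insert_of_notMem (by simp)]
        · simp
      rw [e, ih, e b (x / 2), Nat.testBit_add_one]
      omega
  rw [← h1, h2]

theorem testBit_log {x : ℕ} (hx : x ≠ 0) : x.testBit (Nat.log 2 x) = true := by
  rw [Nat.testBit_eq_decide_div_mod_eq, decide_eq_true_eq]
  have h1 := Nat.pow_log_le_self 2 hx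
  have h2 := Nat.lt_pow_succ_log_self (b := 2) (by omega) x
  have h3 : x / 2 ^ Nat.log 2 x = 1 := by
    apply Nat.div_eq_of_lt_le
    · omega
    · rw [pow_succ] at h2; omega
  rw [h3]

/-- Number of binary digits. -/
def bitLen (x : ℕ) : ℕ := if x = 0 then 0 else Nat.log 2 x + 1

theorem bitLen_half {x : ℕ} (hx : 0 < x) : bitLen x = bitLen (x / 2) + 1 := by
  unfold bitLen
  have h1 := Nat.log_div_base 2 x
  rcases Nat.lt_or_ge x 2 with h | h
  · obtain rfl : x = 1 := by omega
    simp
  · have h2 := Nat.log_pos (b := 2) (by omega) h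
    rw [if_neg (by omega), if_neg (by omega), h1]
    omega

/-! ## The program -/

namespace Ex

abbrev rd (x : Var) : Ex := .var x
abbrev lt (a b : Ex) : Ex := .op .lt a b
abbrev eq (a b : Ex) : Ex := .op .eq a b
abbrev shl (a b : Ex) : Ex := .op .shl a b
abbrev or (a b : Ex) : Ex := .op .or a b
abbrev xor (a b : Ex) : Ex := .op .xor a b

variable (ρ : Var → ℕ) (W k : ℕ) (a b : Ex)

@[simp] theorem ev_num : (ofNat(k) : Ex).ev ρ = ofNat(k) := rfl
@[simp] theorem ev_add : (a + b).ev ρ = a.ev ρ + b.ev ρ := rfl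
@[simp] theorem ev_sub : (a - b).ev ρ = a.ev ρ - b.ev ρ := rfl
@[simp] theorem ev_mul : (a * b).ev ρ = a.ev ρ * b.ev ρ := rfl
@[simp] theorem ev_div : (a / b).ev ρ = a.ev ρ / b.ev ρ := rfl
@[simp] theorem ev_mod : (a % b).ev ρ = a.ev ρ % b.ev ρ := rfl
@[simp] theorem ev_rd (x : Var) : (rd x).ev ρ = ρ x := rfl
@[simp] theorem ev_lt : (lt a b).ev ρ = if a.ev ρ < b.ev ρ then 1 else 0 := rfl
@[simp] theorem ev_eq : (eq a b).ev ρ = if a.ev ρ = b.ev ρ then 1 else 0 := rfl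
@[simp] theorem ev_shl : (shl a b).ev ρ = a.ev ρ * 2 ^ b.ev ρ := rfl
@[simp] theorem ev_or : (or a b).ev ρ = a.ev ρ ||| b.ev ρ := rfl
@[simp] theorem ev_xor : (xor a b).ev ρ = a.ev ρ ^^^ b.ev ρ := rfl

@[simp] theorem safe_num : (ofNat(k) : Ex).Safe W ρ ↔ ofNat(k) < W := Iff.rfl
@[simp] theorem safe_add :
    (a + b).Safe W ρ ↔ a.Safe W ρ ∧ b.Safe W ρ ∧ a.ev ρ + b.ev ρ < W := Iff.rfl
@[simp] theorem safe_sub :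
    (a - b).Safe W ρ ↔ a.Safe W ρ ∧ b.Safe W ρ ∧ b.ev ρ ≤ a.ev ρ ∧ a.ev ρ < W := Iff.rfl
@[simp] theorem safe_mul :
    (a * b).Safe W ρ ↔ a.Safe W ρ ∧ b.Safe W ρ ∧ a.ev ρ * b.ev ρ < W := Iff.rfl
@[simp] theorem safe_div : (a / b).Safe W ρ ↔ a.Safe W ρ ∧ b.Safe W ρ := by
  change _ ∧ _ ∧ True ↔ _; rw [and_true]
@[simp] theorem safe_mod : (a % b).Safe W ρ ↔ a.Safe W ρ ∧ b.Safe W ρ := by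
  change _ ∧ _ ∧ True ↔ _; rw [and_true]
@[simp] theorem safe_rd (x : Var) : (rd x).Safe W ρ ↔ True := Iff.rfl
@[simp] theorem safe_lt : (lt a b).Safe W ρ ↔ a.Safe W ρ ∧ b.Safe W ρ := by
  change _ ∧ _ ∧ True ↔ _; rw [and_true]
@[simp] theorem safe_eq : (eq a b).Safe W ρ ↔ a.Safe W ρ ∧ b.Safe W ρ := by
  change _ ∧ _ ∧ True ↔ _; rw [and_true]
@[simp] theorem safe_shl :
    (shl a b).Safe W ρ ↔ a.Safe W ρ ∧ b.Safe W ρ ∧ a.ev ρ * 2 ^ b.ev ρ < W := Iff.rfl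
@[simp] theorem safe_or : (or a b).Safe W ρ ↔ a.Safe W ρ ∧ b.Safe W ρ := by
  change _ ∧ _ ∧ True ↔ _; rw [and_true]
@[simp] theorem safe_xor : (xor a b).Safe W ρ ↔ a.Safe W ρ ∧ b.Safe W ρ := by
  change _ ∧ _ ∧ True ↔ _; rw [and_true]

@[simp] theorem time_num : (ofNat(k) : Ex).time = 1 := rfl
@[simp] theorem time_add : (a + b).time = a.time + b.time + 1 := rfl
@[simp] theorem time_sub : (a - b).time = a.time + b.time + 1 := rfl
@[simp] theorem time_mul : (a * b).time = a.time + b.time + 1 := rfl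
@[simp] theorem time_div : (a / b).time = a.time + b.time + 1 := rfl
@[simp] theorem time_mod : (a % b).time = a.time + b.time + 1 := rfl
@[simp] theorem time_rd (x : Var) : (rd x).time = 1 := rfl
@[simp] theorem time_op (o : BinOp) : (op o a b).time = a.time + b.time + 1 := rfl

end Ex

open Cmd Ex

/-- The least power `pw` of two with `n < pw ^ 2`, and its logarithm `b`. -/
def mkPow : Cmd :=
  asg .pw 1 ;; asg .b 0 ;;
  wh (lt (rd .pw * rd .pw) (rd .n + 1)) (asg .pw (rd .pw * 2) ;; asg .b (rd .b + 1))

/-- Tables of the numbers of ones and of binary digits of the numbers below `pw`. -/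
def mkTables : Cmd :=
  asg .x 1 ;;
  wh (lt (rd .x) (rd .pw))
    (ld .y .pop (rd .x / 2) ;; sto .pop (rd .x) (rd .y + rd .x % 2) ;;
     ld .y .sz (rd .x / 2) ;; sto .sz (rd .x) (rd .y + 1) ;; asg .x (rd .x + 1))

/-- The list of all labels that occur, in increasing order, and its length `m`. -/
def mkLabels : Cmd :=
  asg .m 0 ;; asg .prev 0 ;; asg .i 0 ;;
  wh (lt (rd .i) (rd .n))
    (inL .c (rd .i + 1) ;;
     .ite (eq (rd .c) (rd .prev)) .skip
       (sto .lab (rd .m) (rd .c) ;; asg .m (rd .m + 1) ;; asg .prev (rd .c)) ;;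
     asg .i (rd .i + 1))

/-- The number `h` of bits of a label rank. -/
def mkHeight : Cmd :=
  asg .h 0 ;; asg .hp 1 ;;
  wh (lt (rd .hp) (rd .m + 1)) (asg .hp (rd .hp * 2) ;; asg .h (rd .h + 1)) ;;
  asg .nn (rd .n + 1) ;; asg .hn (rd .h * rd .nn)

/-- Count the label rank `e` in each of the orders. -/
def countUp : Cmd :=
  asg .g 1 ;;
  wh (lt (rd .g) (rd .hp + 1))
    (asg .a (rd .g + rd .e % rd .g) ;; ld .y .cnt (rd .a) ;; sto .cnt (rd .a) (rd .y + 1) ;;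
     asg .g (rd .g * 2))

/-- Sizes of the groups of label ranks with the same low bits. -/
def mkCounts : Cmd :=
  asg .i 0 ;; asg .e 0 ;;
  wh (lt (rd .i) (rd .n + 1))
    (.ite (lt (rd .i) (rd .n))
       (inL .c (rd .i + 1) ;; ld .y .lab (rd .e) ;;
        .ite (eq (rd .y) (rd .c)) .skip (asg .e (rd .e + 1)))
       (asg .e (rd .hp - 1)) ;;
     countUp ;; asg .i (rd .i + 1))

/-- Insert `p` into the set for the next level. -/
def insertNext : Cmd :=
  asg .u (rd .p / rd .b) ;; ld .z .set (rd .u * 2 + (1 - rd .par)) ;;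
  .ite (eq (rd .z) 0)
    (sto .que (rd .nc * 2 + (1 - rd .par)) (rd .u) ;; asg .nc (rd .nc + 1)) .skip ;;
  sto .set (rd .u * 2 + (1 - rd .par)) (or (rd .z) (shl 1 (rd .p % rd .b)))

/-- Output the position of the cell `a` of the last order with the value `lev`. -/
def report : Cmd :=
  asg .p (rd .a - rd .hn) ;; outp (rd .p + 1) (rd .lev) ;; insertNext

/-- Whether the cell `a` is marked. -/
def isMarked : Ex := eq (rd .y / shl 1 (rd .a % rd .b) % 2) 1

def setMark : Cmd := sto .mark (rd .a / rd .b) (or (rd .y) (shl 1 (rd .a % rd .b)))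

/-- Mark the first cell `a` of a group, and report it if it is in the last order. -/
def markStart : Cmd :=
  .ite isMarked .skip
    (setMark ;;
     .ite (lt (rd .hn) (rd .a)) (.ite (lt (rd .a) (rd .hn + rd .n)) report .skip) .skip)

/-- First cells of the groups. -/
def mkStarts : Cmd :=
  asg .acc 0 ;; asg .g 1 ;;
  wh (lt (rd .g) (rd .hp * 2))
    ((ld .x .cnt (rd .g) ;; sto .cnt (rd .g) (rd .acc) ;; asg .a (rd .acc) ;;
      ld .y .mark (rd .a / rd .b)) ;;
     markStart ;; (asg .acc (rd .acc + rd .x) ;; asg .g (rd .g + 1)))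

/-- Store a one in the bit matrix at `a`. -/
def setBit : Cmd :=
  ld .z .bits (rd .a / rd .b) ;; sto .bits (rd .a / rd .b) (or (rd .z) (shl 1 (rd .a % rd .b)))

/-- Find the rank `e` of the label `c`. -/
def search : Cmd :=
  asg .e 0 ;; asg .st (rd .hp) ;;
  wh (lt 1 (rd .st))
    (asg .st (rd .st / 2) ;;
     .ite (lt (rd .e + rd .st) (rd .m))
       (ld .y .lab (rd .e + rd .st) ;;
        .ite (lt (rd .y) (rd .c + 1)) (asg .e (rd .e + rd .st)) .skip) .skip)

/-- Store the bits of the next edge, with label rank `e`, in each of the orders. -/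
def placeEdge : Cmd :=
  asg .g 1 ;;
  wh (lt (rd .g) (rd .hp))
    (asg .u (rd .g + rd .e % rd .g) ;; ld .a .cnt (rd .u) ;; sto .cnt (rd .u) (rd .a + 1) ;;
     .ite (eq (rd .e / rd .g % 2) 1) setBit .skip ;; asg .g (rd .g * 2))

/-- Store the bits of the out-degree `j` of node `i`. -/
def degBits : Cmd :=
  asg .g 1 ;; asg .a (rd .hn + rd .i) ;;
  wh (lt (rd .g) (rd .hp))
    (.ite (eq (rd .j / rd .g % 2) 1) setBit .skip ;; asg .a (rd .a + rd .nn) ;;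
     asg .g (rd .g * 2))

/-- Fill the bit matrix. -/
def fill : Cmd :=
  asg .i 0 ;; asg .j 0 ;;
  wh (lt (rd .i) (rd .n))
    (outL .c (rd .i + 1) (rd .j + 1) ;;
     .ite (eq (rd .c) 0) (degBits ;; asg .i (rd .i + 1) ;; asg .j 0)
       (search ;; placeEdge ;; asg .j (rd .j + 1))) ;;
  asg .e (rd .hp - 1) ;; placeEdge

/-- Numbers of ones before the words of the bit matrix. -/
def mkDir : Cmd :=
  asg .acc 0 ;; asg .k 0 ;;
  wh (lt (rd .k) (rd .hn * 2 / rd .b + 1))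
    (sto .dir (rd .k) (rd .acc) ;; ld .y .bits (rd .k) ;; ld .y .pop (rd .y) ;;
     asg .acc (rd .acc + rd .y) ;; asg .k (rd .k + 1))

/-- Number of ones before a place in the bit matrix. -/
def rank (r : Var) (e : Ex) : Cmd :=
  asg .y e ;; ld r .dir (rd .y / rd .b) ;; ld .z .bits (rd .y / rd .b) ;;
  ld .z .pop (rd .z % shl 1 (rd .y % rd .b)) ;; asg r (rd r + rd .z)

/-- Number `acc` of the edges leaving nodes with numbers below `i`. -/
def degSum : Cmd :=
  asg .acc 0 ;; asg .g 1 ;; asg .u (rd .hn) ;;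
  wh (lt (rd .g) (rd .hp))
    (rank .r1 (rd .u + rd .i) ;; rank .r2 (rd .u) ;;
     asg .acc (rd .acc + rd .g * (rd .r1 - rd .r2)) ;; asg .u (rd .u + rd .nn) ;;
     asg .g (rd .g * 2))

/-- Replace the cell `a` on the stack by its children. -/
def pushChildren : Cmd :=
  rank .r1 (rd .a) ;; asg .u (rd .a / rd .nn * rd .nn) ;; rank .r2 (rd .u) ;;
  rank .r3 (rd .u + rd .nn) ;;
  sto .stk (rd .sp) (rd .a + rd .nn - (rd .r1 - rd .r2)) ;;
  sto .stk (rd .sp + 1) (rd .u + rd .nn * 2 - (rd .r3 - rd .r1)) ;; asg .sp (rd .sp + 2)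

/-- Visit the cell on top of the stack. -/
def visit : Cmd :=
  asg .sp (rd .sp - 1) ;; ld .a .stk (rd .sp) ;; ld .y .mark (rd .a / rd .b) ;;
  .ite isMarked .skip (setMark ;; .ite (lt (rd .a) (rd .hn)) pushChildren report)

/-- Take the next position from the word `x`. -/
def takePos : Cmd :=
  ld .y .sz (rd .x) ;; asg .y (rd .y - 1) ;; asg .x (xor (rd .x) (shl 1 (rd .y))) ;;
  asg .i (rd .k * rd .b + rd .y) ;; degSum ;; sto .stk 0 (rd .acc) ;; asg .sp 1

/-- Take the next word from the current set. -/
def takeWord : Cmd :=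
  asg .cc (rd .cc - 1) ;; ld .k .que (rd .cc * 2 + rd .par) ;;
  ld .x .set (rd .k * 2 + rd .par) ;; sto .set (rd .k * 2 + rd .par) 0

def nextLevel : Cmd :=
  asg .cc (rd .nc) ;; asg .nc 0 ;; asg .par (1 - rd .par) ;; asg .lev (rd .lev + 1)

def mainLoop : Cmd :=
  asg .go 1 ;; asg .x 0 ;;
  wh (rd .go)
    (.ite (rd .sp) visit
      (.ite (rd .x) takePos
        (.ite (rd .cc) takeWord
          (.ite (rd .nc) nextLevel (asg .go 0)))))

def lcpCmd : Cmd :=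
  mkPow ;; mkTables ;; mkLabels ;; mkHeight ;; mkCounts ;; mkStarts ;; fill ;; mkDir ;; mainLoop

end WheelerLCP

namespace WheelerLCP

open Finset Cmd Ex

set_option linter.constructorNameAsVariable false
set_option linter.unusedSimpArgs false

/-! ## Preparation -/

theorem Tr.seq_wp {μ : Mach} {P Q : Cmd} {T : ℕ} {S : St} {R : St → Prop}
    (h : P.wp μ (fun S' => Tr μ Q T S' R) S) : Tr μ (P ;; Q) (P.cost μ.q + T) S R :=
  Tr.seq (tr_of_wp h)

/-- The invariant `I` holds again for a ghost state of potential lower by at least `t`. -/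
def Next {α : Type*} (I : α → St → Prop) (Φ : α → ℕ) (t : ℕ) (a : α) (S : St) : Prop :=
  ∃ a', I a' S ∧ t + Φ a' ≤ Φ a

theorem Tr.wh_wp {μ : Mach} {P : Cmd} {e : Ex} {T : ℕ} {S : St} {R : St → Prop} {α : Type*}
    (I : α → St → Prop) (Φ : α → ℕ) (hsafe : ∀ a S, I a S → e.Safe μ.W S.v)
    (step : ∀ a S, I a S → e.ev S.v ≠ 0 →
      P.wp μ (Next I Φ (P.cost μ.q + (e.time + 1)) a) S)
    {a : α} (hI : I a S) (hT : Φ a + e.time + 1 ≤ T)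
    (post : ∀ a S, I a S → e.ev S.v = 0 → R S) : Tr μ (.wh e P) T S R :=
  Tr.wh I Φ hsafe (fun a S h hv => ⟨_, tr_of_wp (step a S h hv)⟩) hI hT post

/-- The machine has enough space and long enough words for the program. -/
structure Par (μ : Mach) (n σ b h : ℕ) (lb pred V : ℕ → ℕ) : Prop where
  big : 1000 * (n + σ + b + 2 ^ b * 2 ^ b + h + 2 ^ h + h * (n + 1) + 1) ≤ μ.W
  X_pow : 2 ^ b ≤ μ.X
  X_hp : 2 * 2 ^ h ≤ μ.X
  X_bits : ∀ a ≤ 2 * (h * (n + 1)) + 2 * (n + 1), 2 * (a / b) + 1 < μ.X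
  X_stk : h + 3 ≤ μ.X
  b_pos : 0 < b
  h_pos : 0 < h
  n_lt : n < 2 ^ b * 2 ^ b
  b_min : ∀ k < b, 2 ^ k * 2 ^ k ≤ n
  m_lt : rk lb (n - 1) + 1 < 2 ^ h
  h_min : ∀ k < h, 2 ^ k ≤ rk lb (n - 1) + 1
  model : Model n lb pred V
  lb_le : ∀ t < n, lb t ≤ σ
  inLabel : ∀ t < n, μ.D.inLabel (t + 1) = lb t
  outLabel : ∀ i < n, ∀ j, μ.D.outLabel (i + 1) (j + 1) = ((targets n pred i).map lb).getD j 0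

variable {μ : Mach} {n σ b h : ℕ} {lb pred V : ℕ → ℕ}

theorem Par.pows (_P : Par μ n σ b h lb pred V) :
    0 < 2 ^ b ∧ 0 < 2 ^ h ∧ 2 ^ b ≤ 2 ^ b * 2 ^ b :=
  ⟨by positivity, by positivity, Nat.le_mul_of_pos_right _ (by positivity)⟩

theorem tr_mkPow (P : Par μ n σ b h lb pred V) {S : St} (hn : S.v .n = n) :
    Tr μ mkPow (30 * (b + 1)) S fun S' => S'.v .b = b ∧ S'.v .pw = 2 ^ b := by
  have hW := P.big
  obtain ⟨hp1, hp2, hp3⟩ := P.pows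
  unfold mkPow
  refine (Tr.seq_wp (T := 20 * b + 20) ?_).mono (by simp [Cmd.cost]; omega) fun _ h => h
  simp [Cmd.wp]
  repeat refine And.intro (by omega) ?_
  refine (Tr.seq_wp (T := 20 * b + 10) ?_).mono (by simp [Cmd.cost]; omega) fun _ h => h
  simp [Cmd.wp]
  repeat refine And.intro (by omega) ?_
  refine Tr.wh_wp (fun k S => k ≤ b ∧ S.v .n = n ∧ S.v .b = k ∧ S.v .pw = 2 ^ k)
    (fun k => 20 * (b - k)) ?_ ?_ (a := 0) ?_ ?_ ?_
  · rintro k S ⟨hk, h1, h2, h3⟩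
    have h4 : 2 ^ k * 2 ^ k ≤ 2 ^ b * 2 ^ b := by gcongr <;> omega
    simp [h1, h3]
    omega
  · rintro k S ⟨hk, h1, h2, h3⟩ hc
    simp [h1, h3] at hc
    have hkb : k < b := by
      rcases hk.lt_or_eq with h | rfl
      · exact h
      · have := P.n_lt; omega
    have h4 : 2 ^ (k + 1) ≤ 2 ^ b := Nat.pow_le_pow_right (by omega) hkb
    have h5 : 2 ^ (k + 1) = 2 ^ k * 2 := pow_succ 2 k
    simp [Cmd.wp, h1, h2, h3]
    repeat refine And.intro (by omega) ?_
    refine ⟨k + 1, ?_, ?_⟩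
    · simp [h1]
      omega
    · simp [Cmd.cost]
      omega
  · simp [hn]
  · simp
  · rintro k S ⟨hk, h1, h2, h3⟩ hc
    simp [h1, h3] at hc
    have : k = b := by
      by_contra hne
      have := P.b_min k (by omega)
      omega
    subst this
    exact ⟨h2, h3⟩

theorem tr_mkTables (P : Par μ n σ b h lb pred V) {S : St} (hpw : S.v .pw = 2 ^ b)
    (hpop : S.a .pop = fun _ => 0) (hsz : S.a .sz = fun _ => 0) :
    Tr μ mkTables (100 * 2 ^ b) S fun S' => (∀ x < 2 ^ b, S'.a .pop x = ones b x) ∧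
      ∀ x < 2 ^ b, S'.a .sz x = bitLen x := by
  have hW := P.big
  have hX := P.X_pow
  obtain ⟨hp1, hp2, hp3⟩ := P.pows
  have h1 : 1 ≤ 2 ^ b := Nat.one_le_two_pow
  unfold mkTables
  refine (Tr.seq_wp (T := 80 * 2 ^ b + 5) ?_).mono (by simp [Cmd.cost]; omega) fun _ h => h
  simp [Cmd.wp]
  repeat refine And.intro (by omega) ?_
  refine Tr.wh_wp (fun k S => k ≤ 2 ^ b ∧ 0 < k ∧ S.v .pw = 2 ^ b ∧ S.v .x = k ∧
    (∀ x < k, S.a .pop x = ones b x) ∧ ∀ x < k, S.a .sz x = bitLen x)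
    (fun k => 80 * (2 ^ b - k)) ?_ ?_ (a := 1) ?_ ?_ ?_
  · rintro k S ⟨hk, -, h1, h2, h3, h4⟩
    simp
  · rintro k S ⟨hk, hk0, h1, h2, h3, h4⟩ hc
    simp [h1, h2] at hc
    have h5 := h3 (k / 2) (by omega)
    have h6 := h4 (k / 2) (by omega)
    have h7 := ones_le b (k / 2)
    have h8 : bitLen (k / 2) ≤ k := by
      unfold bitLen
      split_ifs
      · omega
      · have := Nat.log_lt_self 2 (x := k / 2) (by omega); omega
    simp [Cmd.wp, h1, h2, h5, h6]
    repeat refine And.intro (by omega) ?_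
    refine ⟨k + 1, ⟨by omega, by omega, by simp [h1], by simp, ?_, ?_⟩, ?_⟩
    · intro x hx
      simp only [St.set_a, St.put_a_self, St.put_a_ne, ne_eq, reduceCtorEq, not_false_eq_true]
      by_cases hxk : x = k
      · subst hxk
        rw [Function.update_self, ones_half hc]
      · rw [Function.update_of_ne hxk]
        exact h3 x (by omega)
    · intro x hx
      simp only [St.set_a, St.put_a_self, St.put_a_ne, ne_eq, reduceCtorEq, not_false_eq_true]
      by_cases hxk : x = k
      · subst hxk
        rw [Function.update_self, bitLen_half hk0]
      · rw [Function.update_of_ne hxk]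
        exact h4 x (by omega)
    · simp [Cmd.cost]
      omega
  · simp [hpw, hpop, hsz, ones_zero, bitLen]
    omega
  · simp
    omega
  · rintro k S ⟨hk, hk0, h1, h2, h3, h4⟩ hc
    simp [h1, h2] at hc
    obtain rfl : k = 2 ^ b := by omega
    exact ⟨h3, h4⟩

theorem tr_mkLabels (P : Par μ n σ b h lb pred V) {S : St} (hn : S.v .n = n) :
    Tr μ mkLabels ((μ.q + 50) * (n + 1)) S fun S' => S'.v .m = rk lb (n - 1) + 1 ∧
      ∀ t < n, S'.a .lab (rk lb t) = lb t := by
  have hW := P.big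
  have hX := P.X_hp
  have hm := P.m_lt
  have hn0 := P.model.n_pos
  obtain ⟨hp1, hp2, hp3⟩ := P.pows
  unfold mkLabels
  refine (Tr.seq_wp (T := (μ.q + 50) * n + 20) ?_).mono
    (by simp [Cmd.cost]; rw [mul_add]; omega) fun _ h => h
  simp [Cmd.wp]
  repeat refine And.intro (by omega) ?_
  refine (Tr.seq_wp (T := (μ.q + 50) * n + 15) ?_).mono (by simp [Cmd.cost]; omega) fun _ h => h
  simp [Cmd.wp]
  repeat refine And.intro (by omega) ?_
  refine (Tr.seq_wp (T := (μ.q + 50) * n + 10) ?_).mono (by simp [Cmd.cost]; omega) fun _ h => h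
  simp [Cmd.wp]
  repeat refine And.intro (by omega) ?_
  refine Tr.wh_wp (fun k S => k ≤ n ∧ S.v .n = n ∧ S.v .i = k ∧
    S.v .m = (if k = 0 then 0 else rk lb (k - 1) + 1) ∧
    S.v .prev = (if k = 0 then 0 else lb (k - 1)) ∧ ∀ t < k, S.a .lab (rk lb t) = lb t)
    (fun k => (μ.q + 50) * (n - k)) ?_ ?_ (a := 0) ?_ ?_ ?_
  · rintro k S ⟨hk, h1, h2, h3, h4, h5⟩
    simp
  · rintro k S ⟨hk, h1, h2, h3, h4, h5⟩ hc
    simp [h1, h2] at hc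
    have hin := P.inLabel k hc
    have hlb := P.lb_le k hc
    have hpos := P.model.lb_pos k hc
    have hrk := rk_mono lb (show k ≤ n - 1 by omega)
    have hrk' := rk_mono lb (show k - 1 ≤ n - 1 by omega)
    have hmk : S.v .m ≤ rk lb (n - 1) + 1 := by rw [h3]; split_ifs <;> omega
    have hcost : (μ.q + 50) * (n - k) = (μ.q + 50) + (μ.q + 50) * (n - (k + 1)) := by
      rw [show n - k = n - (k + 1) + 1 by omega]; ring
    have hnew : lb k ≠ S.v .prev → S.v .m = rk lb k := by
      intro hne
      rw [h3]
      rcases k with _ | k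
      · simp [rk_zero]
      · simp only [h4, Nat.add_sub_cancel, if_neg (Nat.succ_ne_zero k)] at hne ⊢
        rw [rk_succ, if_pos hne.symm]
    have hold : lb k = S.v .prev → 0 < k ∧ rk lb (k - 1) = rk lb k ∧ lb (k - 1) = lb k := by
      intro he
      rw [h4] at he
      rcases k with _ | k
      · simp at he; omega
      · simp only [Nat.add_sub_cancel, if_neg (Nat.succ_ne_zero k)] at he ⊢
        rw [rk_succ, if_neg (by simpa using he.symm)]
        simp [he]
    simp [Cmd.wp, h2, hin]
    repeat refine And.intro (by omega) ?_
    refine ⟨fun he => ?_, fun hne => ?_⟩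
    · obtain ⟨hk0, e1, e2⟩ := hold he
      repeat refine And.intro (by omega) ?_
      refine ⟨k + 1, ⟨by omega, by simp [h1], by simp, ?_, ?_, ?_⟩, ?_⟩
      · simp [h3, hk0.ne', e1]
      · simp [h4, hk0.ne', e2]
      · simp
        intro t ht
        rcases (show t < k ∨ t = k by omega) with ht | rfl
        · exact h5 t ht
        · rw [← e1, h5 _ (by omega), e2]
      · simp [Cmd.cost]
        omega
    · have e1 := hnew hne
      simp [e1] at hmk ⊢
      repeat refine And.intro (by omega) ?_
      refine ⟨k + 1, ⟨by omega, by simp [h1], by simp, ?_, ?_, ?_⟩, ?_⟩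
      · simp
      · simp
      · simp
        intro t ht
        rcases (show t < k ∨ t = k by omega) with ht | rfl
        · rw [Function.update_of_ne, h5 t ht]
          have := rk_mono lb (show t ≤ k - 1 by omega)
          rw [h3, if_neg (by omega)] at e1
          omega
        · simp
      · simp [Cmd.cost]
        omega
  · simp [hn]
  · simp
  · rintro k S ⟨hk, h1, h2, h3, h4, h5⟩ hc
    simp [h1, h2] at hc
    obtain rfl : k = n := by omega
    rw [if_neg (by omega)] at h3
    exact ⟨h3, h5⟩

theorem tr_mkHeight (P : Par μ n σ b h lb pred V) {S : St} (hn : S.v .n = n)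
    (hm : S.v .m = rk lb (n - 1) + 1) :
    Tr μ mkHeight (50 * (h + 1)) S fun S' => S'.v .h = h ∧ S'.v .hp = 2 ^ h ∧
      S'.v .nn = n + 1 ∧ S'.v .hn = h * (n + 1) := by
  have hW := P.big
  have hmlt := P.m_lt
  obtain ⟨hp1, hp2, hp3⟩ := P.pows
  unfold mkHeight
  refine (Tr.seq_wp (T := 20 * h + 40) ?_).mono (by simp [Cmd.cost]; omega) fun _ h => h
  simp [Cmd.wp]
  repeat refine And.intro (by omega) ?_
  refine (Tr.seq_wp (T := 20 * h + 35) ?_).mono (by simp [Cmd.cost]; omega) fun _ h => h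
  simp [Cmd.wp]
  repeat refine And.intro (by omega) ?_
  refine (Tr.seq (T₁ := 20 * h + 10) (T₂ := 20) ?_).mono (by omega) fun _ h => h
  refine Tr.wh_wp (fun k S => k ≤ h ∧ S.v .n = n ∧ S.v .m = rk lb (n - 1) + 1 ∧ S.v .h = k ∧
    S.v .hp = 2 ^ k) (fun k => 20 * (h - k)) ?_ ?_ (a := 0) ?_ ?_ ?_
  · rintro k S ⟨hk, h1, h2, h3, h4⟩
    simp [h2]
    omega
  · rintro k S ⟨hk, h1, h2, h3, h4⟩ hc
    simp only [ev_lt, ev_rd, h4, ev_add, h2, ev_num] at hc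
    have hc' : 2 ^ k < rk lb (n - 1) + 1 + 1 := by by_contra hcon; simp [hcon] at hc
    have hkb : k < h := by
      rcases hk.lt_or_eq with h' | rfl
      · exact h'
      · omega
    have h4' : 2 ^ (k + 1) ≤ 2 ^ h := Nat.pow_le_pow_right (by omega) hkb
    have h5 : 2 ^ (k + 1) = 2 ^ k * 2 := pow_succ 2 k
    simp [Cmd.wp, h3, h4]
    repeat refine And.intro (by omega) ?_
    refine ⟨k + 1, ?_, ?_⟩
    · simp [h1, h2]
      omega
    · simp [Cmd.cost]
      omega
  · simp [hn, hm]
  · simp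
  · rintro k S ⟨hk, h1, h2, h3, h4⟩ hc
    simp only [ev_lt, ev_rd, h4, ev_add, h2, ev_num] at hc
    have hc' : ¬ 2 ^ k < rk lb (n - 1) + 1 + 1 := by by_contra hcon; simp [hcon] at hc
    have : k = h := by
      by_contra hne
      have := P.h_min k (by omega)
      omega
    subst this
    refine (tr_of_wp ?_).mono (show _ ≤ 20 by simp [Cmd.cost]) fun _ h => h
    simp [Cmd.wp, h1, h3, h4]
    omega

end WheelerLCP

namespace WheelerLCP

open Finset Cmd Ex

set_option linter.constructorNameAsVariable false
set_option linter.unusedSimpArgs false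

variable {μ : Mach} {n σ b h : ℕ} {lb pred V : ℕ → ℕ}

/-- The value for the group `g` of the order number `l < H` is stored at `2 ^ l + g`. -/
def HeapIs (H : ℕ) (f : ℕ → ℕ) (c : ℕ → ℕ → ℕ) : Prop :=
  ∀ l < H, ∀ g < 2 ^ l, f (2 ^ l + g) = c l g

theorem log_heap {l g : ℕ} (hg : g < 2 ^ l) : Nat.log 2 (2 ^ l + g) = l := by
  apply Nat.log_eq_of_pow_le_of_lt_pow
  · omega
  · rw [pow_succ]; omega

theorem heap_inj {l g l' g' : ℕ} (hg : g < 2 ^ l) (hg' : g' < 2 ^ l')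
    (he : 2 ^ l + g = 2 ^ l' + g') : l = l' ∧ g = g' := by
  have h1 := log_heap hg
  rw [he, log_heap hg'] at h1
  subst h1
  exact ⟨rfl, by omega⟩

theorem HeapIs.update {H : ℕ} {f : ℕ → ℕ} {c c' : ℕ → ℕ → ℕ} (hf : HeapIs H f c) {l₀ g₀ y : ℕ}
    (hg₀ : g₀ < 2 ^ l₀) (hy : c' l₀ g₀ = y)
    (hc : ∀ l g, g < 2 ^ l → (l ≠ l₀ ∨ g ≠ g₀) → c' l g = c l g) :
    HeapIs H (Function.update f (2 ^ l₀ + g₀) y) c' := by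
  intro l hl g hg
  by_cases he : 2 ^ l + g = 2 ^ l₀ + g₀
  · obtain ⟨rfl, rfl⟩ := heap_inj hg hg₀ he
    rw [Function.update_self, hy]
  · rw [Function.update_of_ne he, hf l hl g hg, hc l g hg]
    by_contra hcon
    push Not at hcon
    exact he (by rw [hcon.1, hcon.2])

theorem Par.two_pow_mod (P : Par μ n σ b h lb pred V) (a : ℕ) : 2 ^ (a % b) < 2 ^ b :=
  Nat.pow_lt_pow_right (by omega) (Nat.mod_lt a P.b_pos)

theorem tr_countUp (P : Par μ n σ b h lb pred V) {S : St} {c : ℕ → ℕ → ℕ} (hhp : S.v .hp = 2 ^ h)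
    (he : S.v .e < 2 ^ h) (hc : HeapIs (h + 1) (S.a .cnt) c) (hcW : ∀ l g, c l g + 2 < μ.W) :
    Tr μ countUp (60 * (h + 2)) S fun S' =>
      HeapIs (h + 1) (S'.a .cnt) fun l g => c l g + if S.v .e % 2 ^ l = g then 1 else 0 := by
  have hW := P.big
  have hX := P.X_hp
  obtain ⟨hp1, hp2, hp3⟩ := P.pows
  set e := S.v .e with hev
  unfold countUp
  refine (Tr.seq_wp (T := 60 * (h + 1) + 20) ?_).mono (by simp [Cmd.cost]; omega) fun _ h => h
  simp [Cmd.wp]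
  repeat refine And.intro (by omega) ?_
  refine Tr.wh_wp (fun k S => k ≤ h + 1 ∧ S.v .hp = 2 ^ h ∧ S.v .e = e ∧ S.v .g = 2 ^ k ∧
    HeapIs (h + 1) (S.a .cnt) fun l g => c l g + if l < k ∧ e % 2 ^ l = g then 1 else 0)
    (fun k => 60 * (h + 1 - k)) ?_ ?_ (a := 0) ?_ ?_ ?_
  · rintro k S ⟨hk, h1, h2, h3, h4⟩
    simp [h1]
    omega
  · rintro k S ⟨hk, h1, h2, h3, h4⟩ hc0
    simp only [ev_lt, ev_rd, h1, h3, ev_add, ev_num] at hc0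
    have hkh : k ≤ h := by
      by_contra hcon
      obtain rfl : k = h + 1 := by omega
      rw [pow_succ] at hc0
      rw [if_neg (by omega)] at hc0
      exact hc0 rfl
    have h5 : 2 ^ k ≤ 2 ^ h := Nat.pow_le_pow_right (by omega) hkh
    have h6 : 0 < 2 ^ k := by positivity
    have h7 : e % 2 ^ k < 2 ^ k := Nat.mod_lt _ h6
    have h8 := h4 k (by omega) (e % 2 ^ k) h7
    simp only [lt_irrefl, false_and, if_false, add_zero] at h8
    have h9 := hcW k (e % 2 ^ k)
    simp [Cmd.wp, h2, h3, h8]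
    repeat refine And.intro (by omega) ?_
    refine ⟨k + 1, ⟨by omega, by simp [h1], by simp [h2], ?_, ?_⟩, ?_⟩
    · simp [pow_succ]
    · simp only [St.set_a, St.put_a_self]
      refine h4.update h7 (by simp) ?_
      intro l g hg hne
      congr 2
      apply propext
      constructor
      · rintro ⟨hl, rfl⟩
        refine ⟨?_, rfl⟩
        rcases hne with hne | hne
        · omega
        · by_contra hcon
          obtain rfl : l = k := by omega
          exact hne rfl
      · rintro ⟨hl, rfl⟩
        exact ⟨by omega, rfl⟩
    · simp [Cmd.cost]
      omega
  · refine ⟨by omega, by simp [hhp], by simp [hev], by simp, ?_⟩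
    simpa using hc
  · simp
  · rintro k S ⟨hk, h1, h2, h3, h4⟩ hc0
    simp only [ev_lt, ev_rd, h1, h3, ev_add, ev_num] at hc0
    have hkh : k = h + 1 := by
      by_contra hcon
      have h5 : 2 ^ k ≤ 2 ^ h := Nat.pow_le_pow_right (by omega) (by omega)
      rw [if_pos (by omega)] at hc0
      omega
    subst hkh
    intro l hl g hg
    rw [h4 l hl g hg]
    simp [hl]

/-- Label rank of a node, or the sentinel. -/
def rkOrTop (n h : ℕ) (lb : ℕ → ℕ) (t : ℕ) : ℕ := if t < n then rk lb t else 2 ^ h - 1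

theorem card_rkOrTop (M : Model n lb pred V) (Q : ℕ → Prop) [DecidablePred Q] :
    #{t ∈ range (n + 1) | Q (rkOrTop n h lb t)} =
      #{y ∈ range (n + 1) | Q (labelSeq n h lb pred y)} := by
  have h1 : #{y ∈ range n | Q (labelSeq n h lb pred y)} = #{t ∈ range n | Q (rkOrTop n h lb t)} := by
    have := Model.card_labelSeq (h := h) (lb := lb) (pred := pred) (le_refl n) Q
    rw [M.length_edges_all] at this
    rw [this]
    congr 1
    apply filter_congr
    intro t ht
    rw [mem_range] at ht
    simp [rkOrTop, ht, M.pred_lt t ht]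
  rw [range_add_one, filter_insert, filter_insert, M.labelSeq_last]
  have h2 : rkOrTop n h lb n = 2 ^ h - 1 := by simp [rkOrTop]
  rw [h2]
  split_ifs
  · rw [card_insert_of_notMem (by simp), card_insert_of_notMem (by simp), h1]
  · exact h1.symm

theorem tr_mkCounts (P : Par μ n σ b h lb pred V) {S : St} (hn : S.v .n = n)
    (hhp : S.v .hp = 2 ^ h) (hlab : ∀ t < n, S.a .lab (rk lb t) = lb t)
    (hcnt : S.a .cnt = fun _ => 0) :
    Tr μ mkCounts ((μ.q + 60 * (h + 2) + 60) * (n + 2)) S fun S' =>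
      HeapIs (h + 1) (S'.a .cnt) fun l g =>
        #{y ∈ range (n + 1) | labelSeq n h lb pred y % 2 ^ l = g} := by
  have hW := P.big
  have hX := P.X_hp
  have hmlt := P.m_lt
  have hn0 := P.model.n_pos
  obtain ⟨hp1, hp2, hp3⟩ := P.pows
  unfold mkCounts
  set C := μ.q + 60 * (h + 2) + 60 with hC
  refine (Tr.seq_wp (T := C * (n + 1) + 20) ?_).mono (by simp [Cmd.cost]; rw [mul_add C n 2]; rw [mul_add C n 1]; omega)
    fun _ h => h
  simp [Cmd.wp]
  repeat refine And.intro (by omega) ?_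
  refine (Tr.seq_wp (T := C * (n + 1) + 10) ?_).mono (by simp [Cmd.cost]; omega) fun _ h => h
  simp [Cmd.wp]
  repeat refine And.intro (by omega) ?_
  refine Tr.wh (fun k S => k ≤ n + 1 ∧ S.v .n = n ∧ S.v .hp = 2 ^ h ∧ S.v .i = k ∧
    (∀ t < n, S.a .lab (rk lb t) = lb t) ∧ S.v .e = rkOrTop n h lb (k - 1) ∧
    HeapIs (h + 1) (S.a .cnt) fun l g => #{t ∈ range k | rkOrTop n h lb t % 2 ^ l = g})
    (fun k => C * (n + 1 - k)) ?_ ?_ (a := 0) ?_ ?_ ?_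
  · rintro k S ⟨hk, h1, h2, h3, h4, h5⟩
    simp [h1]
    omega
  · rintro k S ⟨hk, h1, h2, h3, h4, h5, h6⟩ hc0
    simp only [ev_lt, ev_rd, h1, h3, ev_add, ev_num] at hc0
    have hkn : k < n + 1 := by by_contra hcon; simp [hcon] at hc0
    have hcost : C * (n + 1 - k) = C + C * (n + 1 - (k + 1)) := by
      rw [show n + 1 - k = n + 1 - (k + 1) + 1 by omega]; ring
    refine ⟨(μ.q + 40) + (60 * (h + 2) + 10), ?_⟩
    refine Tr.seq (T₁ := μ.q + 40) (T₂ := 60 * (h + 2) + 10)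
      (Tr.mono (R := fun S' => S'.v .e = rkOrTop n h lb k ∧ Frame _ S S')
        (T₁ := μ.q + 40) (Tr.frame ?_) le_rfl ?_)
    · refine (tr_of_wp ?_).mono (by simp [Cmd.cost]; omega) fun _ h => h
      simp only [Cmd.wp, safe_lt, safe_rd, ev_lt, ev_rd, h1, h3]
      refine ⟨⟨trivial, trivial⟩, fun hlt => ?_, fun hge => ?_⟩
      · have hlt : k < n := by by_contra hcon; simp [hcon] at hlt
        have hin := P.inLabel k hlt
        have hlb := P.lb_le k hlt
        have hrk := rk_mono lb (show k ≤ n - 1 by omega)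
        have e5 : S.v .e = rk lb (k - 1) := by
          rw [h5, rkOrTop, if_pos (by omega)]
        have e6 := h4 (k - 1) (by omega)
        have hrk' := rk_mono lb (show k - 1 ≤ n - 1 by omega)
        have hlb' := P.lb_le (k - 1) (by omega)
        simp [hin, e5, h3, e6]
        repeat refine And.intro (by omega) ?_
        rw [rkOrTop, if_pos hlt]
        rcases k with _ | k
        · simp
        · simp only [Nat.add_sub_cancel, rk_succ]
          refine ⟨fun heq => ?_, fun hne => ?_⟩
          · simp [heq]
          · simp only [Nat.add_sub_cancel] at hrk'
            refine ⟨⟨by omega, by omega⟩, by omega, ?_⟩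
            rw [if_pos hne]
      · have hge : k = n := by by_contra hcon; simp [show k < n by omega] at hge
        simp [h2, rkOrTop, hge]
        omega
    · rintro S₁ ⟨g1, g2⟩
      have f1 : S₁.v .n = n := by rw [g2.v .n rfl, h1]
      have f2 : S₁.v .hp = 2 ^ h := by rw [g2.v .hp rfl, h2]
      have f3 : S₁.v .i = k := by rw [g2.v .i rfl, h3]
      have f4 : S₁.a .lab = S.a .lab := g2.a .lab rfl
      have f5 : S₁.a .cnt = S.a .cnt := g2.a .cnt rfl
      have f6 : rkOrTop n h lb k < 2 ^ h := by
        unfold rkOrTop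
        split_ifs
        · have := rk_mono lb (show k ≤ n - 1 by omega)
          omega
        · omega
      refine Tr.seq (T₁ := 60 * (h + 2)) (T₂ := 10)
        ((tr_countUp P f2 (by rw [g1]; exact f6) (f5 ▸ h6) ?_).frame.mono le_rfl ?_)
      · intro l g
        have : #{t ∈ range k | rkOrTop n h lb t % 2 ^ l = g} ≤ k :=
          (card_filter_le _ _).trans (by simp)
        omega
      · rintro S₂ ⟨g3, g4⟩
        refine (tr_of_wp ?_).mono (by simp [Cmd.cost]) fun _ h => h
        have f7 : S₂.v .i = k := by rw [g4.v .i rfl, f3]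
        simp only [Cmd.wp, safe_add, safe_rd, safe_num, ev_rd, ev_num, f7, ev_add]
        refine ⟨⟨trivial, by omega, by omega⟩, by omega, k + 1, ⟨by omega, ?_, ?_, ?_, ?_, ?_, ?_⟩, ?_⟩
        · simp [g4.v .n rfl, f1]
        · simp [g4.v .hp rfl, f2]
        · simp
        · simp only [St.set_a]
          rw [g4.a .lab rfl, f4]
          exact h4
        · simp [g4.v .e rfl, g1]
        · simp only [St.set_a]
          intro l hl g hg
          rw [g3 l hl g hg, g1]
          beta_reduce
          rw [range_add_one, filter_insert]
          split_ifs with hif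
          · rw [card_insert_of_notMem (by simp)]
          · rfl
        · rw [show n + 1 - (k + 1) = n - k by omega] at hcost
          simp
          omega
  · refine ⟨by omega, by simp [hn], by simp [hhp], by simp, ?_, ?_, ?_⟩
    · simpa using hlab
    · simp [rkOrTop, hn0, rk_zero]
    · simp [hcnt, HeapIs]
  · simp
  · rintro k S ⟨hk, h1, h2, h3, h4, h5, h6⟩ hc0
    simp only [ev_lt, ev_rd, h1, h3, ev_add, ev_num] at hc0
    have hkn : k = n + 1 := by
      by_contra hcon
      rw [if_pos (by omega)] at hc0
      omega
    subst hkn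
    intro l hl g hg
    rw [h6 l hl g hg]
    exact card_rkOrTop P.model fun y => y % 2 ^ l = g

end WheelerLCP

namespace WheelerLCP

open Finset Cmd Ex

set_option linter.constructorNameAsVariable false
set_option linter.unusedSimpArgs false

variable {μ : Mach} {n σ b h : ℕ} {lb pred V : ℕ → ℕ}

/-! ## The bit matrix -/

theorem exists_rk_eq (lb : ℕ → ℕ) {T j : ℕ} (hj : j ≤ rk lb T) : ∃ s ≤ T, rk lb s = j := by
  induction T with
  | zero => exact ⟨0, le_rfl, by rw [rk_zero] at hj ⊢; omega⟩
  | succ T ih =>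
    rcases Nat.lt_or_ge (rk lb T) j with hlt | hge
    · refine ⟨T + 1, le_rfl, ?_⟩
      have := rk_succ lb T
      split_ifs at this <;> omega
    · obtain ⟨s, hs, he⟩ := ih hge
      exact ⟨s, by omega, he⟩

theorem tr_search (P : Par μ n σ b h lb pred V) {S : St} (hhp : S.v .hp = 2 ^ h)
    (hm : S.v .m = rk lb (n - 1) + 1) (hlab : ∀ t < n, S.a .lab (rk lb t) = lb t) {t : ℕ}
    (ht : t < n) (hc : S.v .c = lb t) :
    Tr μ search (60 * (h + 1)) S fun S' => S'.v .e = rk lb t := by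
  have hW := P.big
  have hX := P.X_hp
  have hmlt := P.m_lt
  obtain ⟨hp1, hp2, hp3⟩ := P.pows
  have hrt := rk_mono lb (show t ≤ n - 1 by omega)
  have hlt := P.lb_le t ht
  unfold search
  refine (Tr.seq_wp (T := 60 * h + 30) ?_).mono (by simp [Cmd.cost]; omega) fun _ h => h
  simp [Cmd.wp]
  repeat refine And.intro (by omega) ?_
  refine (Tr.seq_wp (T := 60 * h + 10) ?_).mono (by simp [Cmd.cost]; omega) fun _ h => h
  simp [Cmd.wp]
  repeat refine And.intro (by omega) ?_
  refine Tr.wh_wp (fun k S => k ≤ h ∧ S.v .m = rk lb (n - 1) + 1 ∧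
    (∀ t < n, S.a .lab (rk lb t) = lb t) ∧ S.v .c = lb t ∧ S.v .st = 2 ^ k ∧
    S.v .e ≤ rk lb t ∧ rk lb t < S.v .e + 2 ^ k)
    (fun k => 60 * k) ?_ ?_ (a := h) ?_ ?_ ?_
  · rintro k S -
    simp
    omega
  · rintro k S ⟨hk, h1, h2, h3, h4, h5, h6⟩ hc0
    simp [h4] at hc0
    obtain ⟨k, rfl⟩ : ∃ j, k = j + 1 := ⟨k - 1, by omega⟩
    have h7 : 2 ^ (k + 1) = 2 * 2 ^ k := by rw [pow_succ]; ring
    have h8 : 2 ^ (k + 1) ≤ 2 ^ h := Nat.pow_le_pow_right (by omega) hk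
    have h9 : 0 < 2 ^ k := by positivity
    simp only [Cmd.wp, safe_div, safe_rd, safe_num, ev_div, ev_rd, ev_num, h4, h7,
      Nat.mul_div_cancel_left _ (show 0 < 2 by omega)]
    refine ⟨⟨trivial, by omega⟩, by omega, ?_⟩
    simp [h1, h3]
    repeat refine And.intro (by omega) ?_
    refine ⟨fun hlt' => ?_, fun hge => ?_⟩
    · obtain ⟨s, hs, hse⟩ := exists_rk_eq lb (T := n - 1) (j := S.v .e + 2 ^ k) (by omega)
      have hsn : s < n := by have := P.model.n_pos; omega
      have hls := h2 s hsn
      have hle := P.lb_le s hsn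
      rw [hse] at hls
      have hiff := P.model.rk_lt_iff ht hsn
      simp [hls]
      repeat refine And.intro (by omega) ?_
      refine ⟨fun hcmp => ?_, fun hcmp => ⟨k, ?_, ?_⟩⟩
      · repeat refine And.intro (by omega) ?_
        refine ⟨k, ?_, by simp [Cmd.cost]; omega⟩
        refine ⟨by omega, by simp [h1], by simpa using h2, by simp [h3], by simp, ?_, ?_⟩
        · simp; omega
        · simp; omega
      · refine ⟨by omega, by simp [h1], by simpa using h2, by simp [h3], by simp, ?_, ?_⟩
        · simp; omega
        · simp; omega
      · simp [Cmd.cost]; omega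
    · refine ⟨k, ?_, ?_⟩
      · refine ⟨by omega, by simp [h1], by simpa using h2, by simp [h3], by simp, ?_, ?_⟩
        · simp; omega
        · simp; omega
      · simp [Cmd.cost]; omega
  · refine ⟨le_rfl, by simp [hm], by simpa using hlab, by simp [hc], by simp [hhp], by simp, ?_⟩
    simp; omega
  · simp
  · rintro k S ⟨hk, h1, h2, h3, h4, h5, h6⟩ hc0
    simp [h4] at hc0
    subst hc0
    simp at h6
    omega

theorem testBit_iff {e k : ℕ} : e.testBit k = true ↔ e / 2 ^ k % 2 = 1 := by
  rw [Nat.testBit_eq_decide_div_mod_eq, decide_eq_true_eq]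

theorem tr_placeEdge (P : Par μ n σ b h lb pred V) {S : St} {c : ℕ → ℕ → ℕ} {B : Set ℕ}
    (hb : S.v .b = b) (hhp : S.v .hp = 2 ^ h)
    (he : S.v .e < 2 ^ h) (hc : HeapIs h (S.a .cnt) c) (hB : HasBits b (S.a .bits) B)
    (hcW : ∀ l < h, c l (S.v .e % 2 ^ l) ≤ 2 * (h * (n + 1))) :
    Tr μ placeEdge (80 * (h + 1)) S fun S' =>
      HeapIs h (S'.a .cnt) (fun l g => c l g + if S.v .e % 2 ^ l = g then 1 else 0) ∧
      HasBits b (S'.a .bits)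
        (B ∪ {a | ∃ l < h, (S.v .e).testBit l = true ∧ a = c l (S.v .e % 2 ^ l)}) := by
  have hW := P.big
  have hX := P.X_hp
  obtain ⟨hp1, hp2, hp3⟩ := P.pows
  set e := S.v .e with hev
  unfold placeEdge
  refine (Tr.seq_wp (T := 80 * h + 20) ?_).mono (by simp [Cmd.cost]; omega) fun _ h => h
  simp [Cmd.wp]
  repeat refine And.intro (by omega) ?_
  refine Tr.wh_wp (fun k S => k ≤ h ∧ S.v .b = b ∧ S.v .hp = 2 ^ h ∧ S.v .e = e ∧ S.v .g = 2 ^ k ∧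
    (HeapIs h (S.a .cnt) fun l g => c l g + if l < k ∧ e % 2 ^ l = g then 1 else 0) ∧
    HasBits b (S.a .bits) (B ∪ {a | ∃ l < k, e.testBit l = true ∧ a = c l (e % 2 ^ l)}))
    (fun k => 80 * (h - k)) ?_ ?_ (a := 0) ?_ ?_ ?_
  · simp
  · rintro k S ⟨hk, h0, h1, h2, h3, h4, h5⟩ hc0
    simp only [ev_lt, ev_rd, h1, h3] at hc0
    have hkh : k < h := by
      by_contra hcon
      obtain rfl : k = h := by omega
      simp at hc0
    have h5' : 2 ^ k ≤ 2 ^ h := Nat.pow_le_pow_right (by omega) hkh.le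
    have h6 : 0 < 2 ^ k := by positivity
    have h7 : e % 2 ^ k < 2 ^ k := Nat.mod_lt _ h6
    have h8 := h4 k (by omega) (e % 2 ^ k) h7
    simp only [lt_irrefl, false_and, if_false, add_zero] at h8
    have h9 := hcW k hkh
    have hXb := P.X_bits (c k (e % 2 ^ k)) (by omega)
    have hbit := h5.lt (c k (e % 2 ^ k) / b)
    have hpow := P.two_pow_mod (c k (e % 2 ^ k))
    have hheap : HeapIs h (Function.update (S.a .cnt) (2 ^ k + e % 2 ^ k) (c k (e % 2 ^ k) + 1))
        fun l g => c l g + if l < k + 1 ∧ e % 2 ^ l = g then 1 else 0 := by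
      refine h4.update h7 (by simp) ?_
      intro l g hg hne
      congr 2
      apply propext
      constructor
      · rintro ⟨hl, rfl⟩
        refine ⟨?_, rfl⟩
        rcases hne with hne | hne
        · omega
        · by_contra hcon
          obtain rfl : l = k := by omega
          exact hne rfl
      · rintro ⟨hl, rfl⟩
        exact ⟨by omega, rfl⟩
    simp [Cmd.wp, h2, h3, h8, setBit, h0]
    repeat refine And.intro (by omega) ?_
    constructor
    all_goals
      intro hbt
      repeat refine And.intro (by omega) ?_
      refine ⟨k + 1, ⟨by omega, by simp [h0], by simp [h1], by simp [h2], by simp [pow_succ], ?_, ?_⟩,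
        ?_⟩
    · simpa using hheap
    · have := h5.insert P.b_pos (c k (e % 2 ^ k))
      simp
      convert this using 1
      ext a
      simp only [Set.mem_union, Set.mem_ofPred_eq, Set.mem_insert_iff]
      constructor
      · rintro (ha | ⟨l, hl, h', rfl⟩)
        · exact Or.inr (Or.inl ha)
        · rcases hl.lt_or_eq with hl | rfl
          · exact Or.inr (Or.inr ⟨l, hl, h', rfl⟩)
          · exact Or.inl rfl
      · rintro (rfl | ha | ⟨l, hl, h', rfl⟩)
        · exact Or.inr ⟨k, by omega, testBit_iff.2 hbt, rfl⟩
        · exact Or.inl ha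
        · exact Or.inr ⟨l, by omega, h', rfl⟩
    · simp [Cmd.cost]
      omega
    · simpa using hheap
    · simp
      convert h5 using 1
      ext a
      simp only [Set.mem_union, Set.mem_ofPred_eq]
      constructor
      · rintro (ha | ⟨l, hl, h', rfl⟩)
        · exact Or.inl ha
        · rcases hl.lt_or_eq with hl | rfl
          · exact Or.inr ⟨l, hl, h', rfl⟩
          · rw [testBit_iff] at h'; omega
      · rintro (ha | ⟨l, hl, h', rfl⟩)
        · exact Or.inl ha
        · exact Or.inr ⟨l, by omega, h', rfl⟩
    · simp [Cmd.cost]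
      omega
  · refine ⟨by omega, by simp [hb], by simp [hhp], by simp [hev], by simp, ?_, ?_⟩
    · simpa using hc
    · simpa using hB
  · simp
  · rintro k S ⟨hk, h0, h1, h2, h3, h4, h5⟩ hc0
    simp only [ev_lt, ev_rd, h1, h3] at hc0
    have hkh : k = h := by
      by_contra hcon
      have h5 : 2 ^ k < 2 ^ h := Nat.pow_lt_pow_right (by omega) (by omega)
      rw [if_pos (by omega)] at hc0
      omega
    subst hkh
    refine ⟨?_, h5⟩
    intro l hl g hg
    rw [h4 l hl g hg]
    simp [hl]

theorem tr_degBits (P : Par μ n σ b h lb pred V) {S : St} {B : Set ℕ} (hb : S.v .b = b)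
    (hhp : S.v .hp = 2 ^ h) (hnn : S.v .nn = n + 1) (hhn : S.v .hn = h * (n + 1))
    (hi : S.v .i < n) (hj : S.v .j < 2 ^ h) (hB : HasBits b (S.a .bits) B) :
    Tr μ degBits (80 * (h + 1)) S fun S' => HasBits b (S'.a .bits)
      (B ∪ {a | ∃ l < h, (S.v .j).testBit l = true ∧ a = (h + l) * (n + 1) + S.v .i}) := by
  have hW := P.big
  obtain ⟨hp1, hp2, hp3⟩ := P.pows
  set i := S.v .i with hiv
  set j := S.v .j with hjv
  unfold degBits
  refine (Tr.seq_wp (T := 80 * h + 40) ?_).mono (by simp [Cmd.cost]; omega) fun _ h => h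
  simp [Cmd.wp]
  repeat refine And.intro (by omega) ?_
  refine (Tr.seq_wp (T := 80 * h + 20) ?_).mono (by simp [Cmd.cost]; omega) fun _ h => h
  simp [Cmd.wp, hhn, ← hiv]
  repeat refine And.intro (by omega) ?_
  refine Tr.wh_wp (fun k S => k ≤ h ∧ S.v .b = b ∧ S.v .hp = 2 ^ h ∧ S.v .nn = n + 1 ∧
    S.v .j = j ∧ S.v .g = 2 ^ k ∧ S.v .a = (h + k) * (n + 1) + i ∧ HasBits b (S.a .bits)
      (B ∪ {a | ∃ l < k, j.testBit l = true ∧ a = (h + l) * (n + 1) + i}))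
    (fun k => 80 * (h - k)) ?_ ?_ (a := 0) ?_ ?_ ?_
  · simp
  · rintro k S ⟨hk, h0, h1, h2, h2', h3, h4, h5⟩ hc0
    simp only [ev_lt, ev_rd, h1, h3] at hc0
    have hkh : k < h := by
      by_contra hcon
      obtain rfl : k = h := by omega
      simp at hc0
    have h5' : 2 ^ k ≤ 2 ^ h := Nat.pow_le_pow_right (by omega) hkh.le
    have h6 : 0 < 2 ^ k := by positivity
    have h7 : (h + k) * (n + 1) + (n + 1) ≤ 2 * (h * (n + 1)) := by
      have : (h + k + 1) * (n + 1) ≤ (2 * h) * (n + 1) := Nat.mul_le_mul_right _ (by omega)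
      linarith
    have h8 : (h + (k + 1)) * (n + 1) = (h + k) * (n + 1) + (n + 1) := by ring
    set c := (h + k) * (n + 1) + i with hcv
    have hXb := P.X_bits c (by omega)
    have hbit := h5.lt (c / b)
    have hpow := P.two_pow_mod c
    simp [Cmd.wp, h2, h2', h3, h4, setBit, h0]
    repeat refine And.intro (by omega) ?_
    constructor
    all_goals
      intro hbt
      repeat refine And.intro (by omega) ?_
      refine ⟨k + 1, ⟨by omega, by simp [h0], by simp [h1], by simp [h2], by simp [h2'],
        by simp [pow_succ], by simp; omega, ?_⟩, ?_⟩
    · have := h5.insert P.b_pos c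
      simp
      convert this using 1
      ext a
      simp only [Set.mem_union, Set.mem_ofPred_eq, Set.mem_insert_iff]
      constructor
      · rintro (ha | ⟨l, hl, h', rfl⟩)
        · exact Or.inr (Or.inl ha)
        · rcases hl.lt_or_eq with hl | rfl
          · exact Or.inr (Or.inr ⟨l, hl, h', rfl⟩)
          · exact Or.inl rfl
      · rintro (rfl | ha | ⟨l, hl, h', rfl⟩)
        · exact Or.inr ⟨k, by omega, testBit_iff.2 hbt, rfl⟩
        · exact Or.inl ha
        · exact Or.inr ⟨l, by omega, h', rfl⟩
    · simp [Cmd.cost]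
      omega
    · simp
      convert h5 using 1
      ext a
      simp only [Set.mem_union, Set.mem_ofPred_eq]
      constructor
      · rintro (ha | ⟨l, hl, h', rfl⟩)
        · exact Or.inl ha
        · rcases hl.lt_or_eq with hl | rfl
          · exact Or.inr ⟨l, hl, h', rfl⟩
          · rw [testBit_iff] at h'; omega
      · rintro (ha | ⟨l, hl, h', rfl⟩)
        · exact Or.inl ha
        · exact Or.inr ⟨l, by omega, h', rfl⟩
    · simp [Cmd.cost]
      omega
  · exact ⟨by omega, by simp [hb], by simp [hhp], by simp [hnn], by simp [← hjv], by simp, by simp,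
      by simpa using hB⟩
  · simp
  · rintro k S ⟨hk, h0, h1, h2, h2', h3, h4, h5⟩ hc0
    simp only [ev_lt, ev_rd, h1, h3] at hc0
    have hkh : k = h := by
      by_contra hcon
      have h5 : 2 ^ k < 2 ^ h := Nat.pow_lt_pow_right (by omega) (by omega)
      rw [if_pos (by omega)] at hc0
      omega
    subst hkh
    exact h5

end WheelerLCP

namespace WheelerLCP

open Finset Cmd Ex

set_option linter.constructorNameAsVariable false
set_option linter.unusedSimpArgs false

variable {μ : Mach} {n σ b h : ℕ} {lb pred V : ℕ → ℕ}

theorem pos_succ (N : ℕ) (ε : ℕ → ℕ) (l g x : ℕ) :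
    pos N ε l g (x + 1) = pos N ε l g x + if ε x % 2 ^ l = g then 1 else 0 := by
  unfold pos
  rw [range_add_one, filter_insert]
  split_ifs
  · rw [card_insert_of_notMem (by simp)]
    ring
  · rfl

theorem labelSeq_edges {i j : ℕ} (hi : i < n)
    (hj : j < (targets n pred i).length) :
    labelSeq n h lb pred ((edges n pred i).length + j) = rk lb (targets n pred i)[j] := by
  have hp := isPrefix_edges n pred (show i + 1 ≤ n by omega)
  have hl : (edges n pred i).length + j < (edges n pred (i + 1)).length := by
    rw [edges_succ, List.length_append]; omega
  have hl' := hl.trans_le hp.length_le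
  unfold labelSeq
  rw [List.getD_eq_getElem _ _ (by simpa using hl'), List.getElem_map, ← hp.getElem hl]
  congr 1
  simp [edges_succ]

theorem Model.length_targets (M : Model n lb pred V) (i : ℕ) :
    (targets n pred i).length ≤ rk lb (n - 1) + 1 := by
  have h1 : (targets n pred i).length = #{t ∈ range n | pred t = i} := by
    rw [card_range_filter, targets, ← List.countP_eq_length_filter]
  rw [h1, ← card_range (rk lb (n - 1) + 1)]
  apply card_le_card_of_injOn (rk lb)
  · intro t ht
    simp only [coe_filter, mem_range, Set.mem_ofPred_eq] at ht
    have := rk_mono lb (show t ≤ n - 1 by omega)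
    simp
    omega
  · intro s hs t ht hst
    simp only [coe_filter, mem_range, Set.mem_ofPred_eq] at hs ht
    rcases lt_trichotomy s t with hlt | heq | hgt
    · have h2 := M.pred_strict s t hlt ht.1 ((M.rk_eq_iff hlt.le ht.1).1 hst)
      omega
    · exact heq
    · have h2 := M.pred_strict t s hgt hs.1 ((M.rk_eq_iff hgt.le hs.1).1 hst.symm)
      omega

/-- The set of places of ones in the bit matrix after `x` edges and `i` nodes. -/
def matBits (n h : ℕ) (ε deg : ℕ → ℕ) (x i : ℕ) : Set ℕ :=
  {a | (∃ l < h, ∃ y < x, (ε y).testBit l = true ∧ a = place (n + 1) ε l y) ∨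
    ∃ l < h, ∃ k < i, (deg k).testBit l = true ∧ a = (h + l) * (n + 1) + k}

theorem matBits_succ_left (n h : ℕ) (ε deg : ℕ → ℕ) (x i : ℕ) :
    matBits n h ε deg (x + 1) i = matBits n h ε deg x i ∪
      {a | ∃ l < h, (ε x).testBit l = true ∧ a = pos (n + 1) ε l (ε x % 2 ^ l) x} := by
  ext a
  simp only [matBits, Set.mem_union, Set.mem_ofPred_eq]
  constructor
  · rintro (⟨l, hl, y, hy, h1, h2⟩ | h')
    · rcases (Nat.le_of_lt_succ hy).lt_or_eq with hy | rfl
      · exact Or.inl (Or.inl ⟨l, hl, y, hy, h1, h2⟩)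
      · exact Or.inr ⟨l, hl, h1, h2⟩
    · exact Or.inl (Or.inr h')
  · rintro ((⟨l, hl, y, hy, h1, h2⟩ | h') | ⟨l, hl, h1, h2⟩)
    · exact Or.inl ⟨l, hl, y, by omega, h1, h2⟩
    · exact Or.inr h'
    · exact Or.inl ⟨l, hl, x, by omega, h1, h2⟩

theorem matBits_succ_right (n h : ℕ) (ε deg : ℕ → ℕ) (x i : ℕ) :
    matBits n h ε deg x (i + 1) = matBits n h ε deg x i ∪
      {a | ∃ l < h, (deg i).testBit l = true ∧ a = (h + l) * (n + 1) + i} := by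
  ext a
  simp only [matBits, Set.mem_union, Set.mem_ofPred_eq]
  constructor
  · rintro (h' | ⟨l, hl, y, hy, h1, h2⟩)
    · exact Or.inl (Or.inl h')
    · rcases (Nat.le_of_lt_succ hy).lt_or_eq with hy | rfl
      · exact Or.inl (Or.inr ⟨l, hl, y, hy, h1, h2⟩)
      · exact Or.inr ⟨l, hl, h1, h2⟩
  · rintro ((h' | ⟨l, hl, y, hy, h1, h2⟩) | ⟨l, hl, h1, h2⟩)
    · exact Or.inl h'
    · exact Or.inr ⟨l, hl, y, by omega, h1, h2⟩
    · exact Or.inr ⟨l, hl, i, by omega, h1, h2⟩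

theorem Par.pos_le_mul (P : Par μ n σ b h lb pred V) {l g x : ℕ} (hl : l < h) (hg : g < 2 ^ l)
    (hx : x ≤ n) : pos (n + 1) (labelSeq n h lb pred) l g x < h * (n + 1) := by
  have h1 := pos_lt (h := h) (N := n + 1) (ε := labelSeq n h lb pred) (by omega)
    (by simpa using P.model.labelSeq_last) hl.le hg (show x < n + 1 by omega)
  have h2 : (l + 1) * (n + 1) ≤ h * (n + 1) := Nat.mul_le_mul_right _ hl
  omega

/-- Registers that are constant after the preparation. -/
structure Consts (n₀ b₀ h₀ : ℕ) (S : St) : Prop where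
  n : S.v .n = n₀
  b : S.v .b = b₀
  hp : S.v .hp = 2 ^ h₀
  nn : S.v .nn = n₀ + 1
  hn : S.v .hn = h₀ * (n₀ + 1)

theorem Consts.frame {c : Cmd} {S S' : St} (H : Consts n b h S) (F : Frame c S S')
    (hc : (c.wr .n || c.wr .b || c.wr .hp || c.wr .nn || c.wr .hn) = false) :
    Consts n b h S' := by
  simp only [Bool.or_eq_false_iff] at hc
  obtain ⟨⟨⟨⟨h1, h2⟩, h3⟩, h4⟩, h5⟩ := hc
  exact ⟨(F.v _ h1).trans H.n, (F.v _ h2).trans H.b, (F.v _ h3).trans H.hp, (F.v _ h4).trans H.nn,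
    (F.v _ h5).trans H.hn⟩

theorem tr_fill (P : Par μ n σ b h lb pred V) {S : St} (hC : Consts n b h S)
    (hm : S.v .m = rk lb (n - 1) + 1) (hlab : ∀ t < n, S.a .lab (rk lb t) = lb t)
    (hcnt : HeapIs h (S.a .cnt) fun l g => pos (n + 1) (labelSeq n h lb pred) l g 0)
    (hbits : S.a .bits = fun _ => 0) :
    Tr μ fill ((μ.q + 150 * (h + 1) + 50) * (2 * n + 2)) S fun S' => HasBits b (S'.a .bits)
      (matBits n h (labelSeq n h lb pred) (fun i => (targets n pred i).length) (n + 1) n) := by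
  have hW := P.big
  have hmlt := P.m_lt
  have hn0 := P.model.n_pos
  obtain ⟨hp1, hp2, hp3⟩ := P.pows
  set ε := labelSeq n h lb pred with hε
  set deg := fun i => (targets n pred i).length with hdeg
  set A := μ.q + 150 * (h + 1) + 50 with hA
  unfold fill
  have hsum : A * (2 * n + 2) = A * (2 * n) + A + A := by ring
  refine (Tr.seq_wp (T := A * (2 * n) + 20 + (80 * (h + 1) + 30)) ?_).mono
    (by simp [Cmd.cost]; omega) fun _ h => h
  simp [Cmd.wp]
  repeat refine And.intro (by omega) ?_
  refine (Tr.seq_wp (T := A * (2 * n) + 10 + (80 * (h + 1) + 30)) ?_).mono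
    (by simp [Cmd.cost]; omega) fun _ h => h
  simp [Cmd.wp]
  repeat refine And.intro (by omega) ?_
  refine Tr.seq (Tr.mono (R := fun S' => Consts n b h S' ∧
    (HeapIs h (S'.a .cnt) fun l g => pos (n + 1) ε l g n) ∧
    HasBits b (S'.a .bits) (matBits n h ε deg n n)) (T₁ := A * (2 * n) + 10) ?_ le_rfl ?_)
  · refine Tr.wh (fun (w : ℕ × ℕ) S => w.1 ≤ n ∧ (w.1 < n → w.2 ≤ deg w.1) ∧ (w.1 = n → w.2 = 0) ∧
      Consts n b h S ∧ S.v .m = rk lb (n - 1) + 1 ∧ (∀ t < n, S.a .lab (rk lb t) = lb t) ∧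
      S.v .i = w.1 ∧ S.v .j = w.2 ∧
      (HeapIs h (S.a .cnt) fun l g => pos (n + 1) ε l g ((edges n pred w.1).length + w.2)) ∧
      HasBits b (S.a .bits) (matBits n h ε deg ((edges n pred w.1).length + w.2) w.1))
      (fun w => A * ((n - ((edges n pred w.1).length + w.2)) + (n - w.1))) ?_ ?_ (a := (0, 0))
      ?_ ?_ ?_
    · simp
    · rintro ⟨i, j⟩ S ⟨hi, hj, -, hC, hm, hlab, hvi, hvj, hcnt, hbits⟩ hc0
      simp only [ev_lt, ev_rd, hC.n, hvi] at hc0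
      have hin : i < n := by by_contra hcon; simp [hcon] at hc0
      replace hj := hj hin
      simp only at hj hvi hvj hcnt hbits ⊢
      have hlen := P.model.length_targets i
      have hle := P.model.length_edges_le (show i + 1 ≤ n by omega)
      rw [edges_succ, List.length_append] at hle
      have hdi : deg i = (targets n pred i).length := rfl
      have houtq := P.outLabel i hin j
      have hout : μ.D.outLabel (i + 1) (j + 1) ≤ σ := by
        rw [houtq]
        rcases Nat.lt_or_ge j (deg i) with hlt | hge
        · rw [List.getD_eq_getElem _ _ (by simpa using hlt), List.getElem_map]
          apply P.lb_le
          have := List.getElem_mem (l := targets n pred i) (hdi ▸ hlt)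
          simp only [targets, List.mem_filter, List.mem_range] at this
          exact this.1
        · rw [List.getD_eq_default _ _ (by simpa using hge)]
          omega
      have hcostj : A * (n - ((edges n pred i).length + j) + (n - i)) =
          A + A * (n - ((edges n pred i).length + j) + (n - (i + 1))) := by
        rw [show n - i = n - (i + 1) + 1 by omega]; ring
      refine ⟨(μ.q + 10) + (4 + (140 * (h + 1) + 20)), ?_⟩
      refine (Tr.seq_wp (T := 4 + (140 * (h + 1) + 20)) ?_).mono (by simp [Cmd.cost]; omega)
        fun _ h => h
      simp only [Cmd.wp, safe_add, safe_rd, safe_num, ev_rd, ev_num, ev_add, hvi, hvj, true_and]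
      repeat refine And.intro (by omega) ?_
      refine (Tr.ite (T := 140 * (h + 1) + 20) (by simp; omega) (fun hv => ?_)
        fun hv => ?_).mono (by simp) fun _ h => h
      · have hz : μ.D.outLabel (i + 1) (j + 1) = 0 := by
          by_contra hcon
          simp [hcon] at hv
        have hje : j = deg i := by
          by_contra hcon
          have hlt : j < (targets n pred i).length := by omega
          rw [houtq, List.getD_eq_getElem _ _ (by simpa using hlt), List.getElem_map] at hz
          have hmem := List.getElem_mem hlt
          simp only [targets, List.mem_filter, List.mem_range] at hmem
          have := P.model.lb_pos _ hmem.1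
          simp only [targets] at hz
          omega
        have hlen' : (edges n pred (i + 1)).length = (edges n pred i).length + j := by
          rw [edges_succ, List.length_append, hje]
        refine (Tr.seq (T₁ := 80 * (h + 1)) (T₂ := 20) ((tr_degBits P (B := matBits n h ε deg
          ((edges n pred i).length + j) i) ?_ ?_ ?_ ?_ ?_ ?_ ?_).frame.mono le_rfl ?_)).mono
          (by omega) fun _ h => h
        · simp [hC.b]
        · simp [hC.hp]
        · simp [hC.nn]
        · simp [hC.hn]
        · simp [hvi, hin]
        · simp [hvj]; omega
        · simpa using hbits
        · rintro S₁ ⟨h1, F⟩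
          have hCi : Consts n b h S₁ := Consts.frame (S := S.set .c _) ⟨by simp [hC.n],
            by simp [hC.b], by simp [hC.hp], by simp [hC.nn], by simp [hC.hn]⟩ F rfl
          have f1 : S₁.v .i = i := by rw [F.v .i rfl]; simp [hvi]
          have f2 : S₁.v .m = _ := (F.v .m rfl).trans (by simpa using hm)
          have f3 : S₁.a .lab = _ := F.a .lab rfl
          have f4 : S₁.a .cnt = _ := F.a .cnt rfl
          refine (tr_of_wp ?_).mono (by simp [Cmd.cost]) fun _ h => h
          simp only [Cmd.wp, safe_add, safe_rd, safe_num, ev_rd, ev_num, ev_add, f1, true_and]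
          repeat refine And.intro (by omega) ?_
          refine ⟨(i + 1, 0), ⟨by omega, by simp, by simp, ?_, by simpa using f2, ?_, by simp, by simp,
            ?_, ?_⟩, ?_⟩
          · exact ⟨by simp [hCi.n], by simp [hCi.b], by simp [hCi.hp], by simp [hCi.nn],
              by simp [hCi.hn]⟩
          · simpa [f3] using hlab
          · simpa [f4, hlen'] using hcnt
          · rw [hlen', matBits_succ_right]
            simpa [hvi, hvj, hje] using h1
          · rw [hlen', add_zero, hcostj]
            simp only [time_op, time_rd]
            omega
      · have hz : μ.D.outLabel (i + 1) (j + 1) ≠ 0 := by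
          intro hcon
          simp [hcon] at hv
        have hlt : j < (targets n pred i).length := by
          by_contra hcon
          rw [houtq, List.getD_eq_default _ _ (by simpa using hcon)] at hz
          exact hz rfl
        have hmem := List.getElem_mem hlt
        have hseq := labelSeq_edges (h := h) (lb := lb) hin hlt
        rw [← hε] at hseq
        set t := (targets n pred i)[j] with htv
        simp only [targets, List.mem_filter, List.mem_range] at hmem
        have htn := hmem.1
        have hout' : μ.D.outLabel (i + 1) (j + 1) = lb t := by
          rw [houtq, List.getD_eq_getElem _ _ (by simpa using hlt), List.getElem_map]
        have hrk := rk_mono lb (show t ≤ n - 1 by omega)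
        have hcosti : A * (n - ((edges n pred i).length + j) + (n - i)) =
            A + A * (n - ((edges n pred i).length + (j + 1)) + (n - i)) := by
          rw [show n - ((edges n pred i).length + j) = n - ((edges n pred i).length + (j + 1)) + 1
            by omega]
          ring
        refine (Tr.seq (T₁ := 60 * (h + 1)) (T₂ := 80 * (h + 1) + 20) ((tr_search P (t := t)
          ?_ ?_ ?_ htn ?_).frame.mono le_rfl ?_)).mono (by omega) fun _ h => h
        · simp [hC.hp]
        · simp [hm]
        · simpa using hlab
        · simp [hout']
        · rintro S₁ ⟨h1, F⟩
          have hCi : Consts n b h S₁ := Consts.frame (S := S.set .c _) ⟨by simp [hC.n],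
            by simp [hC.b], by simp [hC.hp], by simp [hC.nn], by simp [hC.hn]⟩ F rfl
          have f1 : S₁.v .i = i := by rw [F.v .i rfl]; simp [hvi]
          have f1' : S₁.v .j = j := by rw [F.v .j rfl]; simp [hvj]
          have f2 : S₁.v .m = _ := (F.v .m rfl).trans (by simpa using hm)
          have f3 : S₁.a .lab = _ := F.a .lab rfl
          have f4 : S₁.a .cnt = S.a .cnt := F.a .cnt rfl
          have f5 : S₁.a .bits = S.a .bits := F.a .bits rfl
          refine Tr.seq ((tr_placeEdge P hCi.b hCi.hp (by rw [h1]; omega) (f4 ▸ hcnt)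
            (f5 ▸ hbits) ?_).frame.mono le_rfl ?_)
          · intro l hl
            have := P.pos_le_mul hl (Nat.mod_lt (S₁.v .e) (show 0 < 2 ^ l by positivity))
              (show (edges n pred i).length + j ≤ n by omega)
            rw [← hε] at this
            omega
          · rintro S₂ ⟨⟨h2, h3⟩, F'⟩
            have hCi' := hCi.frame F' rfl
            have g1 : S₂.v .i = i := (F'.v .i rfl).trans f1
            have g2 : S₂.v .j = j := (F'.v .j rfl).trans f1'
            have g3 : S₂.v .m = _ := (F'.v .m rfl).trans f2
            have g4 : S₂.a .lab = _ := F'.a .lab rfl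
            refine (tr_of_wp ?_).mono (by simp [Cmd.cost]) fun _ h => h
            simp only [Cmd.wp, safe_add, safe_rd, safe_num, ev_rd, ev_num, ev_add, g2, true_and]
            repeat refine And.intro (by omega) ?_
            refine ⟨(i, j + 1), ⟨by omega, fun _ => by simp only; omega, by simp only; omega, ?_, by simpa using g3, ?_,
              by simp [g1], by simp, ?_, ?_⟩, ?_⟩
            · exact ⟨by simp [hCi'.n], by simp [hCi'.b], by simp [hCi'.hp], by simp [hCi'.nn],
                by simp [hCi'.hn]⟩
            · simpa [g4, f3] using hlab
            · intro l hl g hg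
              have := h2 l hl g hg
              rw [h1] at this
              simp only [St.set_a] at this ⊢
              rw [← add_assoc, pos_succ, hseq]
              exact this
            · rw [← add_assoc, matBits_succ_left, hseq]
              rw [h1] at h3
              simpa using h3
            · rw [hcosti]
              simp only [time_op, time_rd]
              omega
    · refine ⟨by omega, by simp, by simp, ?_, by simp [hm], by simpa using hlab, by simp, by simp,
        ?_, ?_⟩
      · exact ⟨by simp [hC.n], by simp [hC.b], by simp [hC.hp], by simp [hC.nn], by simp [hC.hn]⟩
      · simpa [edges] using hcnt
      · have : matBits n h ε deg 0 0 = ∅ := by ext; simp [matBits]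
        simpa [edges, this, hbits] using HasBits.zero
    · simp [edges, two_mul]
    · rintro ⟨i, j⟩ S ⟨hi, -, hj, hC, hm, hlab, hvi, hvj, hcnt, hbits⟩ hc0
      simp only [ev_lt, ev_rd, hC.n, hvi] at hc0
      have hin : i = n := by
        by_contra hcon
        rw [if_pos (by simp only at hi; omega)] at hc0
        omega
      subst hin
      obtain rfl := hj rfl
      simp only [P.model.length_edges_all, add_zero] at hcnt hbits
      exact ⟨hC, hcnt, hbits⟩
  · rintro S ⟨hC, hcnt, hbits⟩
    refine (Tr.seq_wp (T := 80 * (h + 1)) ?_).mono (by simp [Cmd.cost]; omega) fun _ h => h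
    simp [Cmd.wp, hC.hp]
    repeat refine And.intro (by omega) ?_
    refine (tr_placeEdge P (B := matBits n h ε deg n n) (c := fun l g => pos (n + 1) ε l g n)
      ?_ ?_ ?_ ?_ ?_ ?_).mono le_rfl ?_
    · simp [hC.b]
    · simp [hC.hp]
    · simp
    · simpa using hcnt
    · simpa using hbits
    · intro l hl
      have := P.pos_le_mul hl (Nat.mod_lt (2 ^ h - 1) (show 0 < 2 ^ l by positivity)) (le_refl n)
      simp [hε]
      omega
    · rintro S' ⟨-, h2⟩
      rw [matBits_succ_left, hε, P.model.labelSeq_last]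
      simpa using h2

theorem tr_mkDir (P : Par μ n σ b h lb pred V) {S : St} (hC : Consts n b h S) {B : Set ℕ}
    (hbits : HasBits b (S.a .bits) B) (hpop : ∀ x < 2 ^ b, S.a .pop x = ones b x) :
    Tr μ mkDir (60 * (2 * (h * (n + 1)) / b + 2)) S fun S' =>
      ∀ k ≤ 2 * (h * (n + 1)) / b, S'.a .dir k = rankOf B (k * b) := by
  have hW := P.big
  have hX := P.X_pow
  have hbp := P.b_pos
  obtain ⟨hp1, hp2, hp3⟩ := P.pows
  set K := 2 * (h * (n + 1)) / b with hK
  have hXK := P.X_bits (2 * (h * (n + 1))) (by omega)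
  have hKb : K * b ≤ 2 * (h * (n + 1)) := Nat.div_mul_le_self _ _
  have hKl : K ≤ 2 * (h * (n + 1)) := Nat.div_le_self _ _
  unfold mkDir
  refine (Tr.seq_wp (T := 60 * (K + 1) + 20) ?_).mono (by simp [Cmd.cost]; omega) fun _ h => h
  simp [Cmd.wp]
  repeat refine And.intro (by omega) ?_
  refine (Tr.seq_wp (T := 60 * (K + 1) + 10) ?_).mono (by simp [Cmd.cost]; omega) fun _ h => h
  simp [Cmd.wp]
  repeat refine And.intro (by omega) ?_
  refine Tr.wh_wp (fun k S => k ≤ K + 1 ∧ Consts n b h S ∧ HasBits b (S.a .bits) B ∧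
    (∀ x < 2 ^ b, S.a .pop x = ones b x) ∧ S.v .k = k ∧ S.v .acc = rankOf B (k * b) ∧
    ∀ k' < k, S.a .dir k' = rankOf B (k' * b))
    (fun k => 60 * (K + 1 - k)) ?_ ?_ (a := 0) ?_ ?_ ?_
  · rintro k S ⟨hk, hC, -⟩
    simp [hC.hn, hC.b]
    rw [mul_comm _ 2, ← hK]
    omega
  · rintro k S ⟨hk, hC, h1, h2, h3, h4, h5⟩ hc0
    simp only [ev_lt, ev_rd, ev_mul, ev_num, ev_add, ev_div, h3, hC.hn, hC.b] at hc0
    have hkK : k ≤ K := by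
      by_contra hcon
      rw [mul_comm _ 2, ← hK, if_neg (by omega)] at hc0
      exact hc0 rfl
    have h6 := h1.lt k
    have h7 := h2 _ h6
    have h8 := rankOf_le B (k * b)
    have h9 : k * b ≤ K * b := Nat.mul_le_mul_right _ hkK
    have h10 := ones_le b (S.a .bits k)
    simp [Cmd.wp, h3, h4, h7]
    repeat refine And.intro (by omega) ?_
    refine ⟨k + 1, ⟨by omega, ?_, by simpa using h1, by simpa using h2, by simp, ?_, ?_⟩, ?_⟩
    · exact ⟨by simp [hC.n], by simp [hC.b], by simp [hC.hp], by simp [hC.nn], by simp [hC.hn]⟩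
    · simp [h1.rank_succ]
    · intro k' hk'
      simp
      by_cases he : k' = k
      · simp [he]
      · simp [he, h5 k' (by omega)]
    · simp [Cmd.cost]
      omega
  · refine ⟨by omega, ?_, by simpa using hbits, by simpa using hpop, by simp, by simp [rankOf_zero],
      by simp⟩
    exact ⟨by simp [hC.n], by simp [hC.b], by simp [hC.hp], by simp [hC.nn], by simp [hC.hn]⟩
  · simp
  · rintro k S ⟨hk, hC, h1, h2, h3, h4, h5⟩ hc0
    simp only [ev_lt, ev_rd, ev_mul, ev_num, ev_add, ev_div, h3, hC.hn, hC.b] at hc0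
    have hkK : k = K + 1 := by
      by_contra hcon
      rw [mul_comm _ 2, ← hK, if_pos (by omega)] at hc0
      omega
    intro k' hk'
    exact h5 k' (by omega)

end WheelerLCP

namespace WheelerLCP

open Finset Cmd Ex

set_option linter.constructorNameAsVariable false
set_option linter.unusedSimpArgs false

variable {μ : Mach} {n σ b h : ℕ} {lb pred V : ℕ → ℕ}

theorem Tr.wh_next {μ : Mach} {P : Cmd} {e : Ex} {T : ℕ} {S : St} {R : St → Prop} {α : Type*}
    (I : α → St → Prop) (Φ : α → ℕ) (hsafe : ∀ a S, I a S → e.Safe μ.W S.v)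
    (step : ∀ a S, I a S → e.ev S.v ≠ 0 → ∃ T, Tr μ P T S (Next I Φ (T + (e.time + 1)) a))
    {a : α} (hI : I a S) (hT : Φ a + e.time + 1 ≤ T)
    (post : ∀ a S, I a S → e.ev S.v = 0 → R S) : Tr μ (.wh e P) T S R :=
  Tr.wh I Φ hsafe step hI hT post

/-! ## Sets with a queue of nonempty words -/

/-- The words with indices `k * 2 + c` of `set` hold the bits of `A`, and the first `r` entries with
indices `t * 2 + c` of `que` are the numbers of the nonempty ones. -/
structure SetRep (b c : ℕ) (set que : ℕ → ℕ) (r : ℕ) (A : Finset ℕ) : Prop where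
  bits : HasBits b (fun k => set (k * 2 + c)) {a | a ∈ A}
  inj : ∀ s < r, ∀ t < r, que (s * 2 + c) = que (t * 2 + c) → s = t
  mem : ∀ k, set (k * 2 + c) ≠ 0 ↔ ∃ t < r, que (t * 2 + c) = k

namespace SetRep

variable {c r : ℕ} {set que set' que' : ℕ → ℕ} {A : Finset ℕ}

theorem empty (hs : ∀ k, set (k * 2 + c) = 0) : SetRep b c set que 0 ∅ where
  bits := by simp [HasBits, hs]
  inj := by simp
  mem := by simp [hs]

theorem congr (H : SetRep b c set que r A) (hs : ∀ k, set' (k * 2 + c) = set (k * 2 + c))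
    (hq : ∀ k, que' (k * 2 + c) = que (k * 2 + c)) : SetRep b c set' que' r A where
  bits := H.bits.congr fun k => hs k
  inj := by simpa only [hq] using H.inj
  mem := by simpa only [hs, hq] using H.mem

theorem ne_zero_iff (H : SetRep b c set que r A) (hb : 0 < b) (k : ℕ) :
    set (k * 2 + c) ≠ 0 ↔ ∃ a ∈ A, a / b = k := by
  constructor
  · intro h0
    have h1 := testBit_log h0
    obtain ⟨h2, h3⟩ := (H.bits k _).1 h1
    refine ⟨_, h3, ?_⟩
    rw [mul_comm, Nat.mul_add_div hb, Nat.div_eq_of_lt h2, add_zero]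
  · rintro ⟨a, ha, rfl⟩ h0
    have := (H.bits (a / b) (a % b)).2
      ⟨Nat.mod_lt a hb, by rw [mul_comm, Nat.div_add_mod]; exact ha⟩
    simp [h0] at this

theorem le_card (H : SetRep b c set que r A) (hb : 0 < b) : r ≤ #(A.image (· / b)) := by
  rw [← card_range r]
  apply card_le_card_of_injOn fun t => que (t * 2 + c)
  · intro t ht
    obtain ⟨a, ha, h1⟩ := (H.ne_zero_iff hb _).1 ((H.mem _).2 ⟨t, by simpa using ht, rfl⟩)
    simp only [coe_image, Set.mem_image]
    exact ⟨a, ha, h1⟩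
  · intro s hs t ht hst
    exact H.inj s (by simpa using hs) t (by simpa using ht) hst

theorem insert_of_zero (H : SetRep b c set que r A) (hb : 0 < b) {p : ℕ}
    (h0 : set (p / b * 2 + c) = 0) :
    SetRep b c (Function.update set (p / b * 2 + c) (set (p / b * 2 + c) ||| 2 ^ (p % b)))
      (Function.update que (r * 2 + c) (p / b)) (r + 1) (insert p A) where
  bits := by
    have h1 := H.bits.insert hb p
    simp only [mem_insert]
    refine (h1.congr fun k => ?_ : _)
    by_cases hk : k = p / b
    · subst hk; simp
    · rw [Function.update_of_ne (by omega), Function.update_of_ne hk]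
  inj := by
    have key : ∀ t < r, que (t * 2 + c) ≠ p / b := fun t ht he =>
      (H.mem (p / b)).2 ⟨t, ht, he⟩ h0
    intro s hs t ht hst
    rcases (Nat.le_of_lt_succ hs).lt_or_eq with hs | rfl <;>
      rcases (Nat.le_of_lt_succ ht).lt_or_eq with ht | rfl
    · rw [Function.update_of_ne (by omega), Function.update_of_ne (by omega)] at hst
      exact H.inj s hs t ht hst
    · rw [Function.update_of_ne (by omega), Function.update_self] at hst
      exact absurd hst (key s hs)
    · rw [Function.update_self, Function.update_of_ne (by omega)] at hst
      exact absurd hst.symm (key t ht)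
    · rfl
  mem := by
    intro k
    by_cases hk : k = p / b
    · subst hk
      simp only [Function.update_self, ne_eq]
      refine ⟨fun _ => ⟨r, by omega, by simp⟩, fun _ hor => ?_⟩
      rw [Nat.or_eq_zero_iff] at hor
      have : 0 < 2 ^ (p % b) := by positivity
      omega
    · rw [Function.update_of_ne (by omega), H.mem]
      constructor
      · rintro ⟨t, ht, he⟩
        exact ⟨t, by omega, by rw [Function.update_of_ne (by omega), he]⟩
      · rintro ⟨t, ht, he⟩
        rcases (Nat.le_of_lt_succ ht).lt_or_eq with ht | rfl
        · rw [Function.update_of_ne (by omega)] at he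
          exact ⟨t, ht, he⟩
        · rw [Function.update_self] at he
          exact absurd he.symm hk

theorem insert_of_ne_zero (H : SetRep b c set que r A) (hb : 0 < b) {p : ℕ}
    (h0 : set (p / b * 2 + c) ≠ 0) :
    SetRep b c (Function.update set (p / b * 2 + c) (set (p / b * 2 + c) ||| 2 ^ (p % b)))
      que r (insert p A) where
  bits := by
    have h1 := H.bits.insert hb p
    simp only [mem_insert]
    refine (h1.congr fun k => ?_ : _)
    by_cases hk : k = p / b
    · subst hk; simp
    · rw [Function.update_of_ne (by omega), Function.update_of_ne hk]
  inj := H.inj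
  mem := by
    intro k
    by_cases hk : k = p / b
    · subst hk
      rw [← H.mem]
      simp only [Function.update_self, ne_eq]
      refine ⟨fun _ => h0, fun _ hor => ?_⟩
      rw [Nat.or_eq_zero_iff] at hor
      omega
    · rw [Function.update_of_ne (by omega), H.mem]

theorem lt_of_zero (H : SetRep b c set que r A) (hb : 0 < b) {p : ℕ}
    (h0 : set (p / b * 2 + c) = 0) (hA : ∀ a ∈ A, a < n) (hp : p < n) : r ≤ n / b := by
  have h1 := (H.insert_of_zero hb h0).le_card hb
  have h2 : #((insert p A).image (· / b)) ≤ #(range (n / b + 1)) := by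
    apply card_le_card
    intro k hk
    obtain ⟨a, ha, rfl⟩ := mem_image.1 hk
    rw [mem_range]
    have : a < n := by
      rcases mem_insert.1 ha with rfl | ha
      · exact hp
      · exact hA a ha
    exact Nat.lt_succ_of_le (Nat.div_le_div_right this.le)
  rw [card_range] at h2
  omega

end SetRep

theorem tr_report (P : Par μ n σ b h lb pred V) {S : St} (hC : Consts n b h S) {p c : ℕ}
    (hp : p < n) (ha : S.v .a = h * (n + 1) + p) (hlev : S.v .lev < μ.W) (hpar : S.v .par ≤ 1)
    (hc : 1 - S.v .par = c) {A : Finset ℕ}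
    (hA : SetRep b c (S.a .set) (S.a .que) (S.v .nc) A) (hAn : ∀ a ∈ A, a < n) :
    Tr μ report 120 S fun S' => S'.out = S.out ++ [(p + 1, S.v .lev)] ∧
      SetRep b c (S'.a .set) (S'.a .que) (S'.v .nc) (insert p A) ∧
      (∀ k, S'.a .set (k * 2 + S.v .par) = S.a .set (k * 2 + S.v .par)) ∧
      (∀ k, S'.a .que (k * 2 + S.v .par) = S.a .que (k * 2 + S.v .par)) ∧
      S'.v .nc ≤ S.v .nc + 1 := by
  have hW := P.big
  have hbp := P.b_pos
  have hX := P.X_bits n (by omega)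
  have hpb : p / b ≤ n / b := Nat.div_le_div_right hp.le
  have hpb' := Nat.div_le_self p b
  have hnb := Nat.div_le_self n b
  have hpow := P.two_pow_mod p
  obtain ⟨hp1, hp2, hp3⟩ := P.pows
  have hbit : S.a .set (p / b * 2 + c) < 2 ^ b := hA.bits.lt (p / b)
  have hne : ∀ k, k * 2 + S.v .par ≠ p / b * 2 + c ∧ k * 2 + S.v .par ≠ S.v .nc * 2 + c := by
    intro k; omega
  refine (tr_of_wp ?_).mono (by simp [report, insertNext, Cmd.cost]) fun _ h => h
  simp [report, insertNext, Cmd.wp, ha, hC.hn, hC.b, hc]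
  repeat refine And.intro (by omega) ?_
  constructor
  · intro h0
    have hle := hA.lt_of_zero hbp h0 hAn hp
    repeat refine And.intro (by omega) ?_
    refine ⟨?_, fun k => ?_, fun k => ?_⟩
    · have := hA.insert_of_zero hbp h0
      simpa [h0] using this
    · rw [Function.update_of_ne (hne k).1]
    · rw [Function.update_of_ne (hne k).2]
  · intro h0
    repeat refine And.intro (by omega) ?_
    refine ⟨?_, fun k => ?_⟩
    · exact hA.insert_of_ne_zero hbp h0
    · rw [Function.update_of_ne (hne k).1]

/-! ## First cells -/

/-- The first cell of the group stored at `k` in the heap. -/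
def startAt (N : ℕ) (ε : ℕ → ℕ) (k : ℕ) : ℕ := pos N ε (Nat.log 2 k) (k - 2 ^ Nat.log 2 k) 0

theorem startAt_heap (N : ℕ) (ε : ℕ → ℕ) {l g : ℕ} (hg : g < 2 ^ l) :
    startAt N ε (2 ^ l + g) = pos N ε l g 0 := by
  rw [startAt, log_heap hg, Nat.add_sub_cancel_left]

theorem exists_heap {k H : ℕ} (hk : 0 < k) (hkH : k < 2 ^ H) :
    ∃ l < H, ∃ g < 2 ^ l, k = 2 ^ l + g := by
  have h1 := Nat.pow_log_le_self 2 hk.ne'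
  have h2 := Nat.lt_pow_succ_log_self (b := 2) (by omega) k
  rw [pow_succ] at h2
  exact ⟨Nat.log 2 k, Nat.log_lt_of_lt_pow hk.ne' hkH, k - 2 ^ Nat.log 2 k, by omega, by omega⟩

theorem card_filter_lt_succ (s : Finset ℕ) (f : ℕ → ℕ) (g : ℕ) :
    #{y ∈ s | f y < g + 1} = #{y ∈ s | f y < g} + #{y ∈ s | f y = g} := by
  rw [← card_union_of_disjoint]
  · congr 1
    ext y
    simp only [mem_filter, mem_union]
    constructor
    · rintro ⟨h1, h2⟩
      rcases (Nat.le_of_lt_succ h2).lt_or_eq with h | h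
      · exact Or.inl ⟨h1, h⟩
      · exact Or.inr ⟨h1, h⟩
    · rintro (⟨h1, h2⟩ | ⟨h1, h2⟩) <;> exact ⟨h1, by omega⟩
  · rw [disjoint_left]
    intro y h1 h2
    simp only [mem_filter] at h1 h2
    omega

theorem startAt_succ (N : ℕ) (ε : ℕ → ℕ) {l g : ℕ} (hg : g < 2 ^ l) :
    startAt N ε (2 ^ l + g + 1) = startAt N ε (2 ^ l + g) + #{y ∈ range N | ε y % 2 ^ l = g} := by
  rw [startAt_heap N ε hg]
  have key := card_filter_lt_succ (range N) (fun y => ε y % 2 ^ l) g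
  rcases Nat.lt_or_ge (g + 1) (2 ^ l) with hlt | hge
  · rw [add_assoc, startAt_heap N ε hlt]
    simp only [pos, range_zero, filter_empty, card_empty, add_zero]
    omega
  · have hgl : g + 1 = 2 ^ l := by omega
    have h1 : 2 ^ l + g + 1 = 2 ^ (l + 1) + 0 := by rw [pow_succ]; omega
    rw [h1, startAt_heap N ε (by positivity)]
    have h2 : {y ∈ range N | ε y % 2 ^ l < g + 1} = range N := by
      apply filter_true_of_mem
      intro y _
      rw [hgl]
      exact Nat.mod_lt _ (by positivity)
    rw [h2, card_range] at key
    simp only [pos, range_zero, filter_empty, card_empty, add_zero, Nat.not_lt_zero, filter_false,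
      add_mul, one_mul]
    omega

/-- State while the first cells are marked; `M` is the set of marked cells. -/
structure StartInv (n b h : ℕ) (M : Finset ℕ) (S : St) : Prop where
  marks : HasBits b (S.a .mark) {a | a ∈ M}
  par : S.v .par = 0
  lev : S.v .lev = 0
  nxt : SetRep b 1 (S.a .set) (S.a .que) (S.v .nc) {p ∈ range n | 0 < p ∧ h * (n + 1) + p ∈ M}
  set_zero : ∀ k, S.a .set (k * 2) = 0
  nodup : (S.out.map Prod.fst).Nodup
  mem_out : ∀ i, i ∈ S.out.map Prod.fst ↔
    ∃ p, i = p + 1 ∧ 0 < p ∧ p < n ∧ h * (n + 1) + p ∈ M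
  out_val : ∀ r ∈ S.out, r.2 = 0

theorem StartInv.congr {M : Finset ℕ} {S S' : St} (H : StartInv n b h M S)
    (h1 : S'.a .mark = S.a .mark) (h2 : S'.v .par = S.v .par) (h3 : S'.v .lev = S.v .lev)
    (h4 : S'.a .set = S.a .set) (h5 : S'.a .que = S.a .que) (h6 : S'.v .nc = S.v .nc)
    (h7 : S'.out = S.out) : StartInv n b h M S' where
  marks := h1 ▸ H.marks
  par := h2.trans H.par
  lev := h3.trans H.lev
  nxt := by rw [h4, h5, h6]; exact H.nxt
  set_zero := h4 ▸ H.set_zero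
  nodup := h7 ▸ H.nodup
  mem_out := h7 ▸ H.mem_out
  out_val := h7 ▸ H.out_val

theorem tr_markStart (P : Par μ n σ b h lb pred V) {S : St} (hC : Consts n b h S) {M : Finset ℕ}
    (H : StartInv n b h M S) (ha : S.v .a ≤ 2 * (h * (n + 1)) + 2 * (n + 1))
    (hy : S.v .y = S.a .mark (S.v .a / b)) :
    Tr μ markStart 300 S (StartInv n b h (insert (S.v .a) M)) := by
  have hW := P.big
  have hbp := P.b_pos
  obtain ⟨hp1, hp2, hp3⟩ := P.pows
  set a := S.v .a with hav
  have hX := P.X_bits a ha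
  have hpow := P.two_pow_mod a
  have hmem := H.marks.mem_iff hbp a
  simp only [Set.mem_ofPred_eq] at hmem
  have hbl := H.marks.lt (a / b)
  unfold markStart
  refine (Tr.ite (T := 250) ?_ ?_ ?_).mono (by simp [isMarked]) fun _ h => h
  · simp [isMarked, hC.b, ← hav]
    omega
  · intro hm
    have haM : a ∈ M := by
      rw [hmem]
      by_contra hcon
      simp [isMarked, hC.b, ← hav, hy, hcon] at hm
    refine (tr_of_wp ?_).mono (by simp [Cmd.cost]) fun _ h => h
    rw [insert_eq_of_mem haM]
    exact H
  · intro hm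
    have haM : a ∉ M := by
      rw [hmem]
      intro hcon
      simp [isMarked, hC.b, ← hav, hy, hcon] at hm
    have hmarks : HasBits b (Function.update (S.a .mark) (a / b) (S.a .mark (a / b) ||| 2 ^ (a % b)))
        {x | x ∈ insert a M} := by
      have e : {x | x ∈ insert a M} = insert a {x | x ∈ M} := by
        ext x
        exact Finset.mem_insert
      rw [e]
      exact H.marks.insert hbp a
    have hskip : ¬ (h * (n + 1) < a ∧ a < h * (n + 1) + n) → StartInv n b h (insert a M)
        (S.put .mark (a / b) (S.a .mark (a / b) ||| 2 ^ (a % b))) := by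
      intro hout
      have hset : ∀ q, 0 < q → q < n → (h * (n + 1) + q ∈ insert a M ↔ h * (n + 1) + q ∈ M) := by
        intro q _ _
        rw [mem_insert, or_iff_right]
        omega
      refine ⟨by simpa using hmarks, H.par, H.lev, ?_, by simpa using H.set_zero, H.nodup, ?_,
        H.out_val⟩
      · have e : {p ∈ range n | 0 < p ∧ h * (n + 1) + p ∈ insert a M} =
            {p ∈ range n | 0 < p ∧ h * (n + 1) + p ∈ M} := by
          apply filter_congr
          intro q hq
          exact and_congr_right fun h0 => hset q h0 (mem_range.1 hq)
        rw [e]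
        exact H.nxt
      · intro i
        rw [St.put_out, H.mem_out]
        constructor
        · rintro ⟨q, h0, h1, h2, h3⟩
          exact ⟨q, h0, h1, h2, (hset q h1 h2).2 h3⟩
        · rintro ⟨q, h0, h1, h2, h3⟩
          exact ⟨q, h0, h1, h2, (hset q h1 h2).1 h3⟩
    refine (Tr.seq_wp (T := 200) ?_).mono (by simp [setMark, Cmd.cost]) fun _ h => h
    simp only [setMark, Cmd.wp, safe_div, safe_rd, safe_or, safe_shl, safe_mod, safe_num, ev_or,
      ev_div, ev_rd, ev_shl, ev_mod, ev_num, hC.b, ← hav, hy, one_mul, true_and, and_true]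
    repeat refine And.intro (by omega) ?_
    refine (Tr.ite (T := 160) (by simp) ?_ ?_).mono (by simp) fun _ h => h
    · intro hlo
      refine (Tr.ite (T := 130) (by simp [hC.hn, hC.n]; omega) ?_ ?_).mono (by simp) fun _ h => h
      · intro hhi
        simp [hC.hn, hC.n, ← hav] at hlo hhi
        obtain ⟨p, hp⟩ := Nat.exists_eq_add_of_lt hlo
        obtain ⟨p, hp⟩ : ∃ p, a = h * (n + 1) + p := ⟨p + 1, by omega⟩
        refine (tr_report P (p := p) (c := 1)
          (A := {p ∈ range n | 0 < p ∧ h * (n + 1) + p ∈ M}) ?_ (by omega) ?_ ?_ ?_ ?_ ?_ ?_).frame.mono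
          (by omega) ?_
        · exact ⟨by simp [hC.n], by simp [hC.b], by simp [hC.hp], by simp [hC.nn], by simp [hC.hn]⟩
        · simp [← hav, hp]
        · simp [H.lev]; omega
        · simp [H.par]
        · simp [H.par]
        · simpa using H.nxt
        · intro a ha
          simp only [mem_filter, mem_range] at ha
          exact ha.1
        · rintro S' ⟨⟨h1, h2, h3, h4, h5⟩, F⟩
          have hset : ∀ q, 0 < q → q < n → (h * (n + 1) + q ∈ insert a M ↔
              q = p ∨ h * (n + 1) + q ∈ M) := by
            intro q _ _
            rw [mem_insert, hp]
            simp
          refine ⟨?_, ?_, ?_, ?_, ?_, ?_, ?_, ?_⟩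
          · rw [F.a .mark rfl]
            simpa using hmarks
          · rw [F.v .par rfl]; simpa using H.par
          · rw [F.v .lev rfl]; simpa using H.lev
          · convert h2 using 1
            ext q
            simp only [mem_filter, mem_range, mem_insert, Finset.mem_insert]
            constructor
            · rintro ⟨hq1, hq2, hq3⟩
              rcases hq3 with hq3 | hq3
              · left; omega
              · right; exact ⟨hq1, hq2, hq3⟩
            · rintro (rfl | ⟨hq1, hq2, hq3⟩)
              · exact ⟨by omega, by omega, Or.inl hp.symm⟩
              · exact ⟨hq1, hq2, Or.inr hq3⟩
          · intro k
            have := h3 k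
            simp [H.par, H.set_zero] at this
            exact this
          · rw [h1]
            simp only [List.map_append, List.map_cons, List.map_nil, St.put_out]
            rw [List.nodup_append]
            refine ⟨H.nodup, by simp, ?_⟩
            intro x hx y hy hxy
            simp only [List.mem_singleton] at hy
            obtain ⟨q, hq1, hq2, hq3, hq4⟩ := (H.mem_out x).1 hx
            obtain rfl : q = p := by omega
            exact haM (hp ▸ hq4)
          · intro i
            rw [h1]
            simp only [List.map_append, List.map_cons, List.map_nil, List.mem_append,
              List.mem_singleton, St.put_out]
            rw [H.mem_out]
            constructor
            · rintro (⟨q, hq1, hq2, hq3, hq4⟩ | rfl)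
              · exact ⟨q, hq1, hq2, hq3, mem_insert_of_mem hq4⟩
              · exact ⟨p, rfl, by omega, by omega, by rw [hp]; exact mem_insert_self _ _⟩
            · rintro ⟨q, hq1, hq2, hq3, hq4⟩
              rcases (hset q hq2 hq3).1 hq4 with rfl | hq4
              · exact Or.inr hq1
              · exact Or.inl ⟨q, hq1, hq2, hq3, hq4⟩
          · rw [h1]
            intro r hr
            simp only [List.mem_append, List.mem_singleton, St.put_out, St.put_v] at hr
            rcases hr with hr | rfl
            · exact H.out_val r hr
            · simp [H.lev]
      · intro hhi
        simp [hC.hn, hC.n, ← hav] at hlo hhi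
        exact (tr_of_wp (c := .skip) (hskip (by omega))).mono (by simp [Cmd.cost]) fun _ h => h
    · intro hlo
      simp [hC.hn, ← hav] at hlo
      exact (tr_of_wp (c := .skip) (hskip (by omega))).mono (by simp [Cmd.cost]) fun _ h => h

/-- All first cells of groups. -/
def starts (n h : ℕ) (ε : ℕ → ℕ) : Finset ℕ := (Ico 1 (2 ^ (h + 1))).image (startAt (n + 1) ε)

theorem mem_starts {ε : ℕ → ℕ} {a : ℕ} :
    a ∈ starts n h ε ↔ ∃ l ≤ h, ∃ g < 2 ^ l, a = pos (n + 1) ε l g 0 := by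
  simp only [starts, mem_image, mem_Ico]
  constructor
  · rintro ⟨k, ⟨h1, h2⟩, rfl⟩
    obtain ⟨l, hl, g, hg, rfl⟩ := exists_heap h1 h2
    exact ⟨l, by omega, g, hg, startAt_heap _ _ hg⟩
  · rintro ⟨l, hl, g, hg, rfl⟩
    refine ⟨2 ^ l + g, ⟨?_, ?_⟩, startAt_heap _ _ hg⟩
    · have : 0 < 2 ^ l := by positivity
      omega
    · have : 2 ^ (l + 1) ≤ 2 ^ (h + 1) := Nat.pow_le_pow_right (by omega) (by omega)
      rw [pow_succ] at this
      omega

theorem tr_mkStarts (P : Par μ n σ b h lb pred V) {S : St} (hC : Consts n b h S)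
    (hcnt : HeapIs (h + 1) (S.a .cnt) fun l g =>
      #{y ∈ range (n + 1) | labelSeq n h lb pred y % 2 ^ l = g})
    (H : StartInv n b h ∅ S) :
    Tr μ mkStarts (500 * (2 * 2 ^ h)) S fun S' =>
      StartInv n b h (starts n h (labelSeq n h lb pred)) S' ∧
      HeapIs (h + 1) (S'.a .cnt) fun l g => pos (n + 1) (labelSeq n h lb pred) l g 0 := by
  have hW := P.big
  have hX := P.X_hp
  obtain ⟨hp1, hp2, hp3⟩ := P.pows
  set ε := labelSeq n h lb pred with hε
  have hpow : 2 ^ (h + 1) = 2 * 2 ^ h := by rw [pow_succ]; ring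
  unfold mkStarts
  refine (Tr.seq_wp (T := 400 * (2 * 2 ^ h) + 20) ?_).mono (by simp [Cmd.cost]; omega) fun _ h => h
  simp [Cmd.wp]
  repeat refine And.intro (by omega) ?_
  refine (Tr.seq_wp (T := 400 * (2 * 2 ^ h) + 10) ?_).mono (by simp [Cmd.cost]; omega) fun _ h => h
  simp [Cmd.wp]
  repeat refine And.intro (by omega) ?_
  refine Tr.wh_next (fun k S => 1 ≤ k ∧ k ≤ 2 ^ (h + 1) ∧ Consts n b h S ∧ S.v .g = k ∧
    S.v .acc = startAt (n + 1) ε k ∧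
    StartInv n b h ((Ico 1 k).image (startAt (n + 1) ε)) S ∧
    (∀ j, 1 ≤ j → j < k → S.a .cnt j = startAt (n + 1) ε j) ∧
    (∀ l ≤ h, ∀ g < 2 ^ l, k ≤ 2 ^ l + g → S.a .cnt (2 ^ l + g) =
      #{y ∈ range (n + 1) | ε y % 2 ^ l = g}))
    (fun k => 400 * (2 * 2 ^ h - k)) ?_ ?_ (a := 1) ?_ ?_ ?_
  · rintro k S ⟨h1, h2, hC, h3, h4, h5, h6⟩
    simp [hC.hp]
    omega
  · rintro k S ⟨h1, h2, hC, h3, h4, h5, h6, h7⟩ hc0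
    simp only [ev_lt, ev_rd, ev_mul, ev_num, h3, hC.hp] at hc0
    have hk : k < 2 ^ (h + 1) := by
      by_contra hcon
      rw [if_neg (by omega)] at hc0
      exact hc0 rfl
    obtain ⟨l, hl, g, hg, hkg⟩ := exists_heap h1 hk
    have hcell : startAt (n + 1) ε k < h * (n + 1) + (n + 1) := by
      rw [hkg, startAt_heap _ _ hg]
      have h8 := pos_lt (h := h) (N := n + 1) (ε := ε) (x := 0) (by omega)
        (by simpa using P.model.labelSeq_last) (show l ≤ h by omega) hg (by omega)
      have h9 : (l + 1) * (n + 1) ≤ (h + 1) * (n + 1) := Nat.mul_le_mul_right _ hl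
      have h10 : (h + 1) * (n + 1) = h * (n + 1) + (n + 1) := by ring
      omega
    have hnext : startAt (n + 1) ε (k + 1) =
        startAt (n + 1) ε k + #{y ∈ range (n + 1) | ε y % 2 ^ l = g} := by
      rw [hkg]; exact startAt_succ _ _ hg
    have hck := h7 l (by omega) g hg hkg.le
    rw [← hkg] at hck
    set x := #{y ∈ range (n + 1) | ε y % 2 ^ l = g} with hx
    have hxn : x ≤ n + 1 := (card_filter_le _ _).trans (by simp)
    have hXa := P.X_bits (startAt (n + 1) ε k) (by omega)
    have hbl := h5.marks.lt (startAt (n + 1) ε k / b)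
    refine ⟨380, ?_⟩
    refine (Tr.seq_wp (T := 330) ?_).mono (by simp [Cmd.cost]) fun _ h => h
    simp only [Cmd.wp, safe_rd, ev_rd, h3, hck, true_and]
    simp [h3, h4, hC.b]
    repeat refine And.intro (by omega) ?_
    refine Tr.seq (T₁ := 300) (T₂ := 30) ((tr_markStart P
      (M := (Ico 1 k).image (startAt (n + 1) ε)) ?_ ?_ ?_ ?_).frame.mono le_rfl ?_)
    · exact ⟨by simp [hC.n], by simp [hC.b], by simp [hC.hp], by simp [hC.nn], by simp [hC.hn]⟩
    · exact h5.congr (by simp) (by simp) (by simp) (by simp) (by simp) (by simp) (by simp)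
    · simp; omega
    · simp
    · rintro S' ⟨g1, F⟩
      have hC' : Consts n b h S' := ⟨by simp [F.v .n rfl, hC.n], by simp [F.v .b rfl, hC.b],
        by simp [F.v .hp rfl, hC.hp], by simp [F.v .nn rfl, hC.nn], by simp [F.v .hn rfl, hC.hn]⟩
      have e1 : S'.v .g = k := by simp [F.v .g rfl, h3]
      have e2 : S'.v .acc = startAt (n + 1) ε k := by simp [F.v .acc rfl, h4]
      have e3 : S'.v .x = x := by simp [F.v .x rfl]
      have e4 : S'.a .cnt = Function.update (S.a .cnt) k (startAt (n + 1) ε k) := by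
        simp [F.a .cnt rfl, h3, h4]
      refine (tr_of_wp ?_).mono (by simp [Cmd.cost]) fun _ h => h
      simp only [Cmd.wp, safe_add, safe_rd, safe_num, ev_add, ev_rd, ev_num, e2, e3, true_and]
      simp only [St.set_v_ne _ _ (show Var.g ≠ Var.acc by decide), e1]
      repeat refine And.intro (by omega) ?_
      refine ⟨k + 1, ⟨by omega, by omega, ?_, by simp, by simp [hnext], ?_, ?_, ?_⟩, ?_⟩
      · exact ⟨by simp [hC'.n], by simp [hC'.b], by simp [hC'.hp], by simp [hC'.nn],
          by simp [hC'.hn]⟩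
      · have e5 : (Ico 1 (k + 1)).image (startAt (n + 1) ε) =
            insert (startAt (n + 1) ε k) ((Ico 1 k).image (startAt (n + 1) ε)) := by
          rw [← image_insert]
          congr 1
          ext j
          simp only [mem_Ico, mem_insert]
          omega
        rw [e5]
        rw [St.set_v_ne _ _ (by decide), St.set_v_self] at g1
        exact g1.congr rfl (by simp) (by simp) rfl rfl (by simp) rfl
      · intro j hj1 hj2
        simp only [St.set_a, e4]
        by_cases hjk : j = k
        · simp [hjk]
        · rw [Function.update_of_ne hjk]
          exact h6 j hj1 (by omega)
      · intro l' hl' g' hg' hle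
        simp only [St.set_a, e4]
        rw [Function.update_of_ne (by omega)]
        exact h7 l' hl' g' hg' (by omega)
      · simp
        omega
  · refine ⟨le_rfl, by omega, ?_, by simp, ?_, ?_, ?_, ?_⟩
    · exact ⟨by simp [hC.n], by simp [hC.b], by simp [hC.hp], by simp [hC.nn], by simp [hC.hn]⟩
    · have := startAt_heap (n + 1) ε (l := 0) (g := 0) (by simp)
      simp [pos] at this
      simp [this]
    · exact H.congr rfl (by simp) (by simp) rfl rfl (by simp) rfl
    · intro j h1 h2
      omega
    · intro l hl g hg _
      simpa using hcnt l (by omega) g hg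
  · simp
    omega
  · rintro k S ⟨h1, h2, hC, h3, h4, h5, h6, h7⟩ hc0
    simp only [ev_lt, ev_rd, ev_mul, ev_num, h3, hC.hp] at hc0
    have hk : k = 2 ^ (h + 1) := by
      by_contra hcon
      rw [if_pos (by omega)] at hc0
      omega
    subst hk
    refine ⟨h5, ?_⟩
    intro l hl g hg
    have h8 : 2 ^ (l + 1) ≤ 2 ^ (h + 1) := Nat.pow_le_pow_right (by omega) (by omega)
    rw [pow_succ] at h8
    have h9 : 0 < 2 ^ l := by positivity
    rw [h6 _ (by omega) (by omega), startAt_heap _ _ hg]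

theorem StartInv.searchInv {ε Dg c₀ c₁ : ℕ → ℕ} {S : St} (L : Layout n h ε Dg V c₀ c₁)
    (H : StartInv n b h (starts n h ε) S) :
    SearchInv n h ε Dg V c₀ c₁ (starts n h ε) [] ∅ ∅ ∅
      {p ∈ range n | 0 < p ∧ h * (n + 1) + p ∈ starts n h ε} 0 S.out := by
  have key : ∀ p, 0 < p → p < n → h * (n + 1) + p ∈ starts n h ε → V p = 0 := by
    intro p h0 hp hm
    obtain ⟨l, hl, g, hg, he⟩ := mem_starts.1 hm
    have h1 := L.pos_lt hl hg (Nat.zero_le n)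
    obtain rfl : l = h := by
      by_contra hne
      have : (l + 1) * (n + 1) ≤ h * (n + 1) := Nat.mul_le_mul_right _ (by omega)
      omega
    exact (L.val_zero p h0 hp).2 ⟨g, hg, he.symm⟩
  refine ⟨?_, trivial, by simp, ?_, by simp, ?_, ?_, ?_, by simp, by simp, H.nodup, H.mem_out, ?_, ?_⟩
  · intro a ha
    obtain ⟨l, hl, g, hg, rfl⟩ := mem_starts.1 ha
    have h1 := L.pos_lt hl hg (Nat.zero_le n)
    have : (l + 1) * (n + 1) ≤ (h + 1) * (n + 1) := Nat.mul_le_mul_right _ (by omega)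
    omega
  · intro a ha hlt
    obtain ⟨l, hl, g, hg, rfl⟩ := mem_starts.1 ha
    have hlh : l < h := by
      have := le_pos (N := n + 1) (ε := ε) l g 0
      by_contra hc
      have : h * (n + 1) ≤ l * (n + 1) := Nat.mul_le_mul_right _ (by omega)
      omega
    rw [L.child₀ l hlh g hg 0 (Nat.zero_le n), L.child₁ l hlh g hg 0 (Nat.zero_le n)]
    exact ⟨Or.inl (mem_starts.2 ⟨l + 1, hlh, g, by rw [pow_succ]; omega, rfl⟩),
      Or.inl (mem_starts.2 ⟨l + 1, hlh, g + 2 ^ l, by rw [pow_succ]; omega, rfl⟩)⟩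
  · intro c hc
    exact mem_starts.2 ⟨h, le_rfl, c, hc, rfl⟩
  · intro p h0 hp hm
    exact (key p h0 hp hm).le
  · intro p
    simp only [mem_filter, mem_range]
    constructor
    · rintro ⟨h1, h2, h3⟩
      exact ⟨h2, h1, h3, key p h2 h1 h3⟩
    · rintro ⟨h1, h2, h3, _⟩
      exact ⟨h2, h1, h3⟩
  · rintro ⟨i, v⟩ hr
    obtain ⟨p, h0, h1, h2, h3⟩ := (H.mem_out i).1 (List.mem_map.2 ⟨_, hr, rfl⟩)
    have h4 := H.out_val _ hr
    have h5 := key p h1 h2 h3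
    simp only at h4
    exact ⟨p, by rw [h0, h4, h5], h5.le⟩
  · refine List.Pairwise.imp_of_mem (R := fun _ _ => True) ?_ ?_
    · intro r r' hr hr' _
      rw [H.out_val r hr, H.out_val r' hr']
    · exact List.pairwise_of_forall (by simp)

end WheelerLCP

namespace WheelerLCP

open Finset Cmd Ex

set_option linter.constructorNameAsVariable false
set_option linter.unusedSimpArgs false

variable {μ : Mach} {n σ b h : ℕ} {lb pred V : ℕ → ℕ}

/-! ## Ranks -/

theorem rankOf_succ (S : Set ℕ) [DecidablePred (· ∈ S)] (a : ℕ) :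
    rankOf S (a + 1) = rankOf S a + if a ∈ S then 1 else 0 := by
  unfold rankOf
  rw [range_add_one, filter_insert]
  split_ifs
  · rw [card_insert_of_notMem (by simp)]
  · rfl

section Rows

variable {ε deg : ℕ → ℕ}

theorem mem_matBits_cell {l a : ℕ} (hl : l < h) (h1 : l * (n + 1) ≤ a) (h2 : a < (l + 1) * (n + 1)) :
    a ∈ matBits n h ε deg (n + 1) n ↔ cellBit (n + 1) ε l a := by
  have hh : (l + 1) * (n + 1) ≤ h * (n + 1) := Nat.mul_le_mul_right _ hl
  constructor
  · rintro (⟨l', hl', y, hy, hb, rfl⟩ | ⟨l', hl', k, hk, hb, rfl⟩)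
    · have : l' = l := by
        rw [← place_div (ε := ε) (l := l') hy]
        exact Nat.div_eq_of_lt_le h1 h2
      subst this
      exact ⟨y, hy, rfl, hb⟩
    · rw [add_mul] at h2
      omega
  · rintro ⟨y, hy, rfl, hb⟩
    exact Or.inl ⟨l, hl, y, hy, hb, rfl⟩

theorem mem_matBits_deg {l k : ℕ} (hl : l < h) (hk : k < n) :
    (h + l) * (n + 1) + k ∈ matBits n h ε deg (n + 1) n ↔ (deg k).testBit l = true := by
  constructor
  · rintro (⟨l', hl', y, hy, hb, he⟩ | ⟨l', hl', k', hk', hb, he⟩)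
    · have h1 := place_lt (ε := ε) (l := l') hy
      have h2 : (l' + 1) * (n + 1) ≤ h * (n + 1) := Nat.mul_le_mul_right _ hl'
      rw [← he, add_mul] at h1
      omega
    · have h1 := congrArg (· / (n + 1)) he
      simp only [mul_comm _ (n + 1), Nat.mul_add_div (Nat.succ_pos n),
        Nat.div_eq_of_lt (show k < n + 1 by omega), Nat.div_eq_of_lt (show k' < n + 1 by omega)] at h1
      obtain rfl : l = l' := by omega
      obtain rfl : k = k' := by omega
      exact hb
  · intro hb
    exact Or.inr ⟨l, hl, k, hk, hb, rfl⟩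

theorem rank_deg {l i : ℕ} (hl : l < h) (hi : i ≤ n) :
    rankOf (matBits n h ε deg (n + 1) n) ((h + l) * (n + 1) + i) =
      rankOf (matBits n h ε deg (n + 1) n) ((h + l) * (n + 1)) +
        #{k ∈ range i | (deg k).testBit l = true} := by
  classical
  induction i with
  | zero => simp
  | succ i ih =>
    rw [← add_assoc, rankOf_succ, ih (by omega), range_add_one, filter_insert,
      if_congr (mem_matBits_deg hl (by omega)) rfl rfl]
    split_ifs
    · rw [card_insert_of_notMem (by simp)]
      ring
    · rfl

end Rows

theorem sum_mod_two_pow_succ (f : ℕ → ℕ) (i l : ℕ) :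
    ∑ k ∈ range i, f k % 2 ^ (l + 1) =
      ∑ k ∈ range i, f k % 2 ^ l + 2 ^ l * #{k ∈ range i | (f k).testBit l = true} := by
  rw [card_filter, mul_sum, ← sum_add_distrib]
  apply sum_congr rfl
  intro k _
  rw [mod_two_pow_succ]
  cases (f k).testBit l <;> simp

theorem sum_length_targets (n : ℕ) (pred : ℕ → ℕ) (i : ℕ) :
    ∑ k ∈ range i, (targets n pred k).length = (edges n pred i).length := by
  induction i with
  | zero => simp [edges]
  | succ i ih => rw [sum_range_succ, ih, edges_succ, List.length_append]

/-- The places of ones in the completed bit matrix. -/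
def bitSet (n h : ℕ) (lb pred : ℕ → ℕ) : Set ℕ :=
  matBits n h (labelSeq n h lb pred) (fun i => (targets n pred i).length) (n + 1) n

theorem Par.layout (P : Par μ n σ b h lb pred V) :
    Layout n h (labelSeq n h lb pred) (fun i => (edges n pred i).length) V
      (child₀ (n + 1) (rankOf (bitSet n h lb pred)))
      (child₁ (n + 1) (rankOf (bitSet n h lb pred))) := by
  classical
  have hpos : ∀ l < h, ∀ g < 2 ^ l, ∀ x ≤ n,
      pos (n + 1) (labelSeq n h lb pred) l g x < (l + 1) * (n + 1) := fun l hl g hg x hx =>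
    pos_lt (h := h) (by omega) (by simpa using P.model.labelSeq_last) hl.le hg (by omega)
  have hR : rankOf (bitSet n h lb pred) = fun a => #{c ∈ range a | c ∈ bitSet n h lb pred} := by
    ext a
    unfold rankOf
    congr
  refine P.model.layout P.m_lt ?_ ?_
  · intro l hl g hg x hx
    rw [hR]
    exact child₀_pos (by omega) hg (fun a h1 h2 => mem_matBits_cell hl h1 h2) (hpos l hl g hg x hx)
  · intro l hl g hg x hx
    rw [hR]
    exact child₁_pos (by omega) (fun a h1 h2 => mem_matBits_cell hl h1 h2) (hpos l hl g hg x hx)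

/-- The tables and the bit matrix with its directory. -/
structure Tables (n b h : ℕ) (B : Set ℕ) (S : St) : Prop where
  bits : HasBits b (S.a .bits) B
  dir : ∀ k ≤ 2 * (h * (n + 1)) / b, S.a .dir k = rankOf B (k * b)
  pop : ∀ x < 2 ^ b, S.a .pop x = ones b x
  sz : ∀ x < 2 ^ b, S.a .sz x = bitLen x

theorem Tables.congr {B : Set ℕ} {S S' : St} (H : Tables n b h B S) (h1 : S'.a .bits = S.a .bits)
    (h2 : S'.a .dir = S.a .dir) (h3 : S'.a .pop = S.a .pop) (h4 : S'.a .sz = S.a .sz) :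
    Tables n b h B S' :=
  ⟨h1 ▸ H.bits, h2 ▸ H.dir, h3 ▸ H.pop, h4 ▸ H.sz⟩

theorem tr_rank (P : Par μ n σ b h lb pred V) {S : St} {B : Set ℕ} (hb : S.v .b = b)
    (H : Tables n b h B S) {r : Var} (hr : r ≠ .y ∧ r ≠ .z ∧ r ≠ .b) {e : Ex}
    (he : e.Safe μ.W S.v) (hle : e.ev S.v ≤ 2 * (h * (n + 1))) :
    Tr μ (rank r e) (e.time + 50) S fun S' => S'.v r = rankOf B (e.ev S.v) := by
  have hW := P.big
  have hXb := P.X_pow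
  have hbp := P.b_pos
  obtain ⟨hp1, hp2, hp3⟩ := P.pows
  obtain ⟨hr1, hr2, hr3⟩ := hr
  set a := e.ev S.v with ha
  have hX := P.X_bits a (by omega)
  have h1 : a / b ≤ 2 * (h * (n + 1)) / b := Nat.div_le_div_right hle
  have h2 := H.dir _ h1
  have h3 := H.bits.lt (a / b)
  have hpow := P.two_pow_mod a
  have h4 : S.a .bits (a / b) % 2 ^ (a % b) < 2 ^ b := (Nat.mod_le _ _).trans_lt h3
  have h5 := H.pop _ h4
  have h6 := H.bits.rank_eq hbp a
  have h7 := rankOf_le B a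
  refine (tr_of_wp ?_).mono (by simp [rank, Cmd.cost]) fun _ h => h
  simp [rank, Cmd.wp, ← ha, hb, h2, h5, hr1, hr2, hr3, hr1.symm, hr2.symm, hr3.symm]
  refine ⟨he, ?_⟩
  omega

theorem tr_degSum (P : Par μ n σ b h lb pred V) {S : St} (hC : Consts n b h S)
    (H : Tables n b h (bitSet n h lb pred) S) (hi : S.v .i ≤ n) :
    Tr μ degSum (200 * (h + 1)) S fun S' => S'.v .acc = (edges n pred (S.v .i)).length := by
  have hW := P.big
  have hm := P.m_lt
  obtain ⟨hp1, hp2, hp3⟩ := P.pows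
  set i := S.v .i with hiv
  set deg := fun k => (targets n pred k).length with hdeg
  have hsum : ∑ k ∈ range i, deg k ≤ n := by
    rw [hdeg, sum_length_targets]
    exact P.model.length_edges_le hi
  unfold degSum
  refine (Tr.seq_wp (T := 200 * h + 50) ?_).mono (by simp [Cmd.cost]; omega) fun _ h => h
  simp [Cmd.wp]
  repeat refine And.intro (by omega) ?_
  refine (Tr.seq_wp (T := 200 * h + 40) ?_).mono (by simp [Cmd.cost]; omega) fun _ h => h
  simp [Cmd.wp]
  repeat refine And.intro (by omega) ?_
  refine (Tr.seq_wp (T := 200 * h + 30) ?_).mono (by simp [Cmd.cost]; omega) fun _ h => h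
  simp [Cmd.wp, hC.hn]
  repeat refine And.intro (by omega) ?_
  refine Tr.wh_next (fun l S => l ≤ h ∧ Consts n b h S ∧ Tables n b h (bitSet n h lb pred) S ∧
    S.v .i = i ∧ S.v .g = 2 ^ l ∧ S.v .u = (h + l) * (n + 1) ∧
    S.v .acc = ∑ k ∈ range i, deg k % 2 ^ l)
    (fun l => 200 * (h - l)) ?_ ?_ (a := 0) ?_ ?_ ?_
  · simp
  · rintro l S ⟨hl, hC, H, h1, h2, h3, h4⟩ hc0
    simp only [ev_lt, ev_rd, h2, hC.hp] at hc0
    have hlh : l < h := by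
      by_contra hcon
      obtain rfl : l = h := by omega
      simp at hc0
    have h5 : 2 ^ l ≤ 2 ^ h := Nat.pow_le_pow_right (by omega) hl
    have h6 : (h + l) * (n + 1) + (n + 1) ≤ 2 * (h * (n + 1)) := by
      have : (h + l + 1) * (n + 1) ≤ (2 * h) * (n + 1) := Nat.mul_le_mul_right _ (by omega)
      linarith
    have h7 := rank_deg (ε := labelSeq n h lb pred) (deg := deg) hlh hi
    have h8 : rankOf (matBits n h (labelSeq n h lb pred) deg (n + 1) n) =
      rankOf (bitSet n h lb pred) := rfl
    rw [h8] at h7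
    have h9 := sum_mod_two_pow_succ deg i l
    have h10 : ∑ k ∈ range i, deg k % 2 ^ (l + 1) ≤ n :=
      (sum_le_sum fun k _ => Nat.mod_le _ _).trans hsum
    have h11 : (h + (l + 1)) * (n + 1) = (h + l) * (n + 1) + (n + 1) := by ring
    set c := #{k ∈ range i | (deg k).testBit l = true} with hcv
    refine ⟨190, ?_⟩
    refine (Tr.seq (T₁ := 53) (T₂ := 137) ((tr_rank P hC.b H (by decide) (by simp; omega)
      (by simp; omega)).frame.mono (by simp) ?_)).mono (by omega) fun _ h => h
    rintro S₁ ⟨g1, F₁⟩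
    simp only [ev_add, ev_rd, h3, h1] at g1
    have hC₁ := hC.frame F₁ rfl
    have H₁ := H.congr (F₁.a .bits rfl) (F₁.a .dir rfl) (F₁.a .pop rfl) (F₁.a .sz rfl)
    have u₁ : S₁.v .u = (h + l) * (n + 1) := (F₁.v .u rfl).trans h3
    refine (Tr.seq (T₁ := 51) (T₂ := 80) ((tr_rank P hC₁.b H₁ (by decide) (by simp)
      (by simp; omega)).frame.mono (by simp) ?_)).mono (by omega) fun _ h => h
    rintro S₂ ⟨g2, F₂⟩
    simp only [ev_add, ev_rd, u₁] at g2
    have hC₂ := hC₁.frame F₂ rfl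
    have H₂ := H₁.congr (F₂.a .bits rfl) (F₂.a .dir rfl) (F₂.a .pop rfl) (F₂.a .sz rfl)
    have u₂ : S₂.v .u = (h + l) * (n + 1) := (F₂.v .u rfl).trans u₁
    have r₂ : S₂.v .r1 = rankOf (bitSet n h lb pred) ((h + l) * (n + 1)) + c := by
      rw [F₂.v .r1 rfl, g1, h7]
    have i₂ : S₂.v .i = i := by rw [F₂.v .i rfl, F₁.v .i rfl, h1]
    have e₂ : S₂.v .g = 2 ^ l := by rw [F₂.v .g rfl, F₁.v .g rfl, h2]
    have a₂ : S₂.v .acc = ∑ k ∈ range i, deg k % 2 ^ l := by rw [F₂.v .acc rfl, F₁.v .acc rfl, h4]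
    have hrl := rankOf_le (bitSet n h lb pred) ((h + l) * (n + 1))
    have hcn : c ≤ n := (card_filter_le _ _).trans (by simpa using hi)
    refine (tr_of_wp ?_).mono (by simp [Cmd.cost]) fun _ h => h
    simp [Cmd.wp, g2, u₂, r₂, e₂, a₂, hC₂.nn]
    repeat refine And.intro (by omega) ?_
    refine ⟨l + 1, ⟨by omega, ?_, ?_, by simp [i₂], by simp [pow_succ], ?_, ?_⟩, ?_⟩
    · exact ⟨by simp [hC₂.n], by simp [hC₂.b], by simp [hC₂.hp], by simp [hC₂.nn], by simp [hC₂.hn]⟩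
    · exact H₂.congr rfl rfl rfl rfl
    · simp [h11]
    · simp [h9]
    · simp
      omega
  · refine ⟨by omega, ?_, H.congr rfl rfl rfl rfl, by simp [hiv], by simp, by simp, by simp [Nat.mod_one]⟩
    exact ⟨by simp [hC.n], by simp [hC.b], by simp [hC.hp], by simp [hC.nn], by simp [hC.hn]⟩
  · simp
  · rintro l S ⟨hl, hC, H, h1, h2, h3, h4⟩ hc0
    simp only [ev_lt, ev_rd, h2, hC.hp] at hc0
    have hlh : l = h := by
      by_contra hcon
      have h5 : 2 ^ l < 2 ^ h := Nat.pow_lt_pow_right (by omega) (by omega)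
      rw [if_pos (by omega)] at hc0
      omega
    subst hlh
    rw [h4, ← sum_length_targets]
    apply sum_congr rfl
    intro k _
    have := P.model.length_targets k
    rw [Nat.mod_eq_of_lt (by simp only [hdeg]; omega)]

theorem tr_pushChildren (P : Par μ n σ b h lb pred V) {S : St} (hC : Consts n b h S)
    (H : Tables n b h (bitSet n h lb pred) S) (ha : S.v .a < h * (n + 1))
    (hsp : S.v .sp + 2 ≤ h + 3) :
    Tr μ pushChildren 300 S fun S' => S'.v .sp = S.v .sp + 2 ∧
      S'.a .stk = Function.update (Function.update (S.a .stk) (S.v .sp)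
        (child₀ (n + 1) (rankOf (bitSet n h lb pred)) (S.v .a))) (S.v .sp + 1)
        (child₁ (n + 1) (rankOf (bitSet n h lb pred)) (S.v .a)) := by
  have hW := P.big
  have hX := P.X_stk
  obtain ⟨hp1, hp2, hp3⟩ := P.pows
  set R := rankOf (bitSet n h lb pred) with hR
  set a := S.v .a with hav
  set u := a / (n + 1) * (n + 1) with hu
  have h1 : u ≤ a := Nat.div_mul_le_self _ _
  have h2 : a < u + (n + 1) := by
    have := Nat.lt_div_mul_add (a := a) (Nat.succ_pos n)
    omega
  have h3 : u + (n + 1) ≤ h * (n + 1) := by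
    have h4 : a / (n + 1) < h := (Nat.div_lt_iff_lt_mul (Nat.succ_pos n)).2 ha
    have h5 : (a / (n + 1) + 1) * (n + 1) ≤ h * (n + 1) := Nat.mul_le_mul_right _ h4
    rw [add_mul, one_mul] at h5
    exact h5
  have R1 : R u ≤ R a := rankOf_mono _ h1
  have R2 : R a ≤ R (u + (n + 1)) := rankOf_mono _ h2.le
  have R3 : R (u + (n + 1)) ≤ u + (n + 1) := rankOf_le _ _
  have R4 : R a ≤ a := rankOf_le _ _
  have e₀ : child₀ (n + 1) R a = a + (n + 1) - (R a - R u) := rfl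
  have e₁ : child₁ (n + 1) R a = u + (n + 1) * 2 - (R (u + (n + 1)) - R a) := by
    unfold child₁
    rw [show (a / (n + 1) + 2) * (n + 1) = u + (n + 1) * 2 by rw [hu]; ring,
      show (a / (n + 1) + 1) * (n + 1) = u + (n + 1) by rw [hu]; ring]
  unfold pushChildren
  refine (Tr.seq (T₁ := 51) (T₂ := 240) ((tr_rank P hC.b H (by decide) (by simp)
    (by simp [← hav]; omega)).frame.mono (by simp) ?_)).mono (by omega) fun _ h => h
  rintro S₁ ⟨g1, F₁⟩
  simp only [ev_rd, ← hav] at g1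
  have hC₁ := hC.frame F₁ rfl
  have H₁ := H.congr (F₁.a .bits rfl) (F₁.a .dir rfl) (F₁.a .pop rfl) (F₁.a .sz rfl)
  have a₁ : S₁.v .a = a := F₁.v .a rfl
  have p₁ : S₁.v .sp = S.v .sp := F₁.v .sp rfl
  have t₁ : S₁.a .stk = S.a .stk := F₁.a .stk rfl
  refine (Tr.seq_wp (T := 220) ?_).mono (by simp [Cmd.cost]) fun _ h => h
  simp only [Cmd.wp, safe_mul, safe_div, safe_rd, ev_mul, ev_div, ev_rd, a₁, hC₁.nn, true_and, ← hu]
  repeat refine And.intro (by omega) ?_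
  refine (Tr.seq (T₁ := 51) (T₂ := 160) ((tr_rank P (S := S₁.set .u u) (by simp [hC₁.b])
    (H₁.congr rfl rfl rfl rfl) (by decide) (by simp)
    (by simp; omega)).frame.mono (by simp) ?_)).mono (by omega) fun _ h => h
  rintro S₂ ⟨g2, F₂⟩
  simp only [ev_rd, St.set_v_self] at g2
  have hC₂ : Consts n b h S₂ := Consts.frame (S := S₁.set .u u) ⟨by simp [hC₁.n], by simp [hC₁.b],
    by simp [hC₁.hp], by simp [hC₁.nn], by simp [hC₁.hn]⟩ F₂ rfl
  have H₂ := H₁.congr (F₂.a .bits rfl) (F₂.a .dir rfl) (F₂.a .pop rfl) (F₂.a .sz rfl)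
  have a₂ : S₂.v .a = a := by simp [F₂.v .a rfl, a₁]
  have u₂ : S₂.v .u = u := by simp [F₂.v .u rfl]
  have p₂ : S₂.v .sp = S.v .sp := by simp [F₂.v .sp rfl, p₁]
  have t₂ : S₂.a .stk = S.a .stk := by simp [F₂.a .stk rfl, t₁]
  have r₂ : S₂.v .r1 = R a := by simp [F₂.v .r1 rfl, g1, hR]
  refine (Tr.seq (T₁ := 53) (T₂ := 100) ((tr_rank P hC₂.b H₂ (by decide)
    (by simp [hC₂.nn, u₂]; omega) (by simp [hC₂.nn, u₂]; omega)).frame.mono (by simp) ?_)).mono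
    (by omega) fun _ h => h
  rintro S₃ ⟨g3, F₃⟩
  simp only [ev_rd, ev_add, hC₂.nn, u₂] at g3
  have hC₃ := hC₂.frame F₃ rfl
  have a₃ : S₃.v .a = a := by simp [F₃.v .a rfl, a₂]
  have u₃ : S₃.v .u = u := by simp [F₃.v .u rfl, u₂]
  have p₃ : S₃.v .sp = S.v .sp := by simp [F₃.v .sp rfl, p₂]
  have t₃ : S₃.a .stk = S.a .stk := by simp [F₃.a .stk rfl, t₂]
  have r₃ : S₃.v .r1 = R a := by simp [F₃.v .r1 rfl, r₂]
  have s₃ : S₃.v .r2 = R u := by simp [F₃.v .r2 rfl, g2, hR]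
  refine (tr_of_wp ?_).mono (by simp [Cmd.cost]) fun _ h => h
  simp [Cmd.wp, a₃, u₃, p₃, r₃, s₃, g3, hC₃.nn, t₃, e₀, e₁, ← hR]
  omega

end WheelerLCP

namespace WheelerLCP

open Finset Cmd Ex

set_option linter.constructorNameAsVariable false
set_option linter.unusedSimpArgs false

variable {μ : Mach} {n σ b h : ℕ} {lb pred V : ℕ → ℕ}

/-! ## The main loop -/

theorem Layout.val_lt {ε Dg c₀ c₁ : ℕ → ℕ} (L : Layout n h ε Dg V c₀ c₁) {p : ℕ} (h0 : 0 < p)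
    (hp : p < n) : V p < n := by
  have key : ∀ v p, 0 < p → p < n → V p = v → v + 1 ≤ #{q ∈ range n | V q ≤ v} := by
    intro v
    induction v with
    | zero =>
      intro p h0 hp hv
      exact card_pos.2 ⟨p, by simp [hp, hv]⟩
    | succ v ih =>
      intro p h0 hp hv
      obtain ⟨i, c, hi0, hin, -, hVi, -⟩ := L.val_succ p v h0 hp hv
      have h1 := ih i hi0 hin hVi
      have h2 : #{q ∈ range n | V q ≤ v} < #{q ∈ range n | V q ≤ v + 1} := by
        apply card_lt_card
        refine ⟨fun q hq => ?_, fun hs => ?_⟩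
        · simp only [mem_filter] at hq ⊢
          exact ⟨hq.1, by omega⟩
        · have := hs (show p ∈ {q ∈ range n | V q ≤ v + 1} by simp [hp, hv])
          simp only [mem_filter] at this
          omega
      omega
  have h1 := key _ p h0 hp rfl
  have h2 : #{q ∈ range n | V q ≤ V p} ≤ n := (card_filter_le _ _).trans (by simp)
  omega

namespace SetRep

variable {c r : ℕ} {set que : ℕ → ℕ} {A : Finset ℕ}

theorem eq_empty (H : SetRep b c set que 0 A) (hb : 0 < b) : A = ∅ := by
  rw [eq_empty_iff_forall_notMem]
  intro a ha
  have := (H.mem (a / b)).1 ((H.ne_zero_iff hb _).2 ⟨a, ha, rfl⟩)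
  simp at this

theorem word_eq_zero (H : SetRep b c set que 0 A) (k : ℕ) : set (k * 2 + c) = 0 := by
  by_contra hk
  have := (H.mem k).1 hk
  simp at this

theorem take (H : SetRep b c set que (r + 1) A) (hb : 0 < b) :
    SetRep b c (Function.update set (que (r * 2 + c) * 2 + c) 0) que r
      {a ∈ A | a / b ≠ que (r * 2 + c)} where
  bits := by
    intro k o
    simp only [mem_filter, Set.mem_ofPred_eq]
    by_cases hk : k = que (r * 2 + c)
    · subst hk
      simp only [Function.update_self, Nat.zero_testBit, Bool.false_eq_true, false_iff]
      rintro ⟨ho, -, hne⟩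
      apply hne
      rw [mul_comm, Nat.mul_add_div hb, Nat.div_eq_of_lt ho, add_zero]
    · rw [Function.update_of_ne (by omega)]
      have := H.bits k o
      simp only [Set.mem_ofPred_eq] at this
      rw [this]
      constructor
      · rintro ⟨h1, h2⟩
        refine ⟨h1, h2, ?_⟩
        rwa [mul_comm, Nat.mul_add_div hb, Nat.div_eq_of_lt h1, add_zero]
      · rintro ⟨h1, h2, _⟩
        exact ⟨h1, h2⟩
  inj := fun s hs t ht => H.inj s (by omega) t (by omega)
  mem := by
    intro k
    by_cases hk : k = que (r * 2 + c)
    · subst hk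
      simp only [Function.update_self, ne_eq, not_true, false_iff]
      rintro ⟨t, ht, he⟩
      have := H.inj t (by omega) r (by omega) he
      omega
    · rw [Function.update_of_ne (by omega), H.mem]
      constructor
      · rintro ⟨t, ht, he⟩
        refine ⟨t, ?_, he⟩
        rcases (Nat.le_of_lt_succ ht).lt_or_eq with h | rfl
        · exact h
        · exact absurd he.symm hk
      · rintro ⟨t, ht, he⟩
        exact ⟨t, by omega, he⟩

theorem le_div (H : SetRep b c set que r A) (hb : 0 < b) (hA : ∀ a ∈ A, a < n) :
    r ≤ n / b + 1 := by
  refine (H.le_card hb).trans ?_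
  rw [← card_range (n / b + 1)]
  apply card_le_card
  intro k hk
  obtain ⟨a, ha, rfl⟩ := mem_image.1 hk
  rw [mem_range]
  exact Nat.lt_succ_of_le (Nat.div_le_div_right (hA a ha).le)

end SetRep

/-- The list `s`, with its top first, is stored as a stack in the array `f`. -/
def StackIs (f : ℕ → ℕ) : List ℕ → Prop
  | [] => True
  | a :: s => f s.length = a ∧ StackIs f s

theorem StackIs.update {f : ℕ → ℕ} {s : List ℕ} (H : StackIs f s) {k : ℕ} (hk : s.length ≤ k)
    (y : ℕ) : StackIs (Function.update f k y) s := by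
  induction s with
  | nil => trivial
  | cons a s ih =>
    rw [List.length_cons] at hk
    exact ⟨by rw [Function.update_of_ne (by omega)]; exact H.1, ih H.2 (by omega)⟩

/-- Abstract state of the search. -/
structure Ghost where
  M : Finset ℕ
  stk : List ℕ
  I : Finset ℕ
  xs : Finset ℕ
  cur : Finset ℕ
  nxt : Finset ℕ
  cc : ℕ
  nc : ℕ
  go : ℕ

structure LoopInv (n b h : ℕ) (lb pred V : ℕ → ℕ) (g : Ghost) (S : St) : Prop where
  consts : Consts n b h S
  tables : Tables n b h (bitSet n h lb pred) S
  search : SearchInv n h (labelSeq n h lb pred) (fun i => (edges n pred i).length) V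
    (child₀ (n + 1) (rankOf (bitSet n h lb pred))) (child₁ (n + 1) (rankOf (bitSet n h lb pred)))
    g.M g.stk g.I g.xs g.cur g.nxt (S.v .lev) S.out
  marks : HasBits b (S.a .mark) {a | a ∈ g.M}
  sp : S.v .sp = g.stk.length
  stk : StackIs (S.a .stk) g.stk
  word_lt : S.v .x < 2 ^ b
  word : ∀ i, i ∈ g.xs ↔ ∃ o, (S.v .x).testBit o = true ∧ i = S.v .k * b + o
  par : S.v .par ≤ 1
  cur : SetRep b (S.v .par) (S.a .set) (S.a .que) g.cc g.cur
  cc : S.v .cc = g.cc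
  nxt : SetRep b (1 - S.v .par) (S.a .set) (S.a .que) g.nc g.nxt
  nc : S.v .nc = g.nc
  lev_le : S.v .lev ≤ n
  go : S.v .go = g.go
  go_le : g.go ≤ 1
  disj_xs : Disjoint g.I g.xs
  disj_cur : Disjoint g.I g.cur
  disj : Disjoint g.xs g.cur
  done : g.go = 0 → g.stk = [] ∧ g.xs = ∅ ∧ g.cur = ∅ ∧ g.nxt = ∅

/-- Potential of the search. -/
def potential (n h : ℕ) (g : Ghost) : ℕ :=
  1000 * ((h + 1) * (n + 1) - #g.M) + 100 * g.stk.length + 400 * (h + 1) * (n - #g.I) +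
    100 * g.cc + 200 * g.nc + 100 * g.go

namespace LoopInv

variable {g : Ghost} {S : St}

theorem card_M (H : LoopInv n b h lb pred V g S) {a : ℕ} (ha : a < (h + 1) * (n + 1))
    (haM : a ∉ g.M) : #(insert a g.M) = #g.M + 1 ∧ #g.M + 1 ≤ (h + 1) * (n + 1) := by
  have h1 := card_insert_of_notMem haM
  refine ⟨h1, h1 ▸ ?_⟩
  rw [← card_range ((h + 1) * (n + 1))]
  apply card_le_card
  intro x hx
  rw [mem_range]
  rcases mem_insert.1 hx with rfl | hx
  · exact ha
  · exact H.search.mem_lt x hx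

theorem card_I (H : LoopInv n b h lb pred V g S) {i : ℕ} (hi : i ∈ g.xs) :
    #(insert i g.I) = #g.I + 1 ∧ #g.I + 1 ≤ n := by
  have h1 := card_insert_of_notMem (disjoint_right.1 H.disj_xs hi)
  refine ⟨h1, h1 ▸ ?_⟩
  rw [← card_range n]
  apply card_le_card
  intro x hx
  rw [mem_range]
  rcases mem_insert.1 hx with rfl | hx
  · exact ((H.search.todo x).1 (Or.inr (Or.inl hi))).2.1
  · exact ((H.search.todo x).1 (Or.inl hx)).2.1

theorem top_lt (P : Par μ n σ b h lb pred V) (H : LoopInv n b h lb pred V g S) {a : ℕ}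
    (ha : a ∈ g.stk) : a < (h + 1) * (n + 1) := by
  obtain ⟨i, hi, l, hl, c, hc, rfl⟩ := H.search.stk_pos a ha
  have h1 := P.layout.pos_lt hl hc
    (P.model.length_edges_le ((H.search.todo i).1 (Or.inl hi)).2.1.le)
  have h2 : (l + 1) * (n + 1) ≤ (h + 1) * (n + 1) := Nat.mul_le_mul_right _ (by omega)
  omega

theorem tr_visit (P : Par μ n σ b h lb pred V) (H : LoopInv n b h lb pred V g S)
    (hgo : g.go = 1) {a : ℕ} {s : List ℕ} (hs : g.stk = a :: s) :
    ∃ T, Tr μ visit T S (Next (LoopInv n b h lb pred V) (potential n h) (T + 20) g) := by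
  have hW := P.big
  have hbp := P.b_pos
  have hXs := P.X_stk
  obtain ⟨hp1, hp2, hp3⟩ := P.pows
  have hC := H.consts
  have hlt := H.top_lt P (a := a) (by simp [hs])
  have hmul : (h + 1) * (n + 1) = h * (n + 1) + (n + 1) := by ring
  have hX := P.X_bits a (by omega)
  have hpow := P.two_pow_mod a
  have hmem := H.marks.mem_iff hbp a
  simp only [Set.mem_ofPred_eq] at hmem
  have hbl := H.marks.lt (a / b)
  have hok := H.search.stk_ok
  have hst := H.stk
  have hsp := H.sp
  have hsearch := H.search
  rw [hs] at hok hst hsp hsearch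
  rw [List.length_cons] at hsp
  have hsl : s.length ≤ h := hok.1.trans (Nat.lt_succ_iff.1
    ((Nat.div_lt_iff_lt_mul (Nat.succ_pos n)).2 hlt))
  have htop := hst.1
  set S₀ := ((S.set .sp s.length).set .a a).set .y (S.a .mark (a / b)) with hS₀
  have hC₀ : Consts n b h S₀ := ⟨by simp [hS₀, hC.n], by simp [hS₀, hC.b], by simp [hS₀, hC.hp],
    by simp [hS₀, hC.nn], by simp [hS₀, hC.hn]⟩
  have main : ∀ T, Tr μ (.ite isMarked .skip (setMark ;; .ite (lt (rd .a) (rd .hn)) pushChildren report))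
      T S₀ (Next (LoopInv n b h lb pred V) (potential n h) (T + 60) g) →
      ∃ T, Tr μ visit T S (Next (LoopInv n b h lb pred V) (potential n h) (T + 20) g) := by
    intro T hT
    refine ⟨T + 40, ?_⟩
    unfold visit
    refine (Tr.seq_wp (T := T + 30) ?_).mono (by simp [Cmd.cost]; omega) fun _ h => h
    simp [Cmd.wp, hsp]
    repeat refine And.intro (by omega) ?_
    refine (Tr.seq_wp (T := T + 20) ?_).mono (by simp [Cmd.cost]; omega) fun _ h => h
    simp [Cmd.wp, htop]
    repeat refine And.intro (by omega) ?_
    refine (Tr.seq_wp (T := T) ?_).mono (by simp [Cmd.cost]; omega) fun _ h => h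
    simp [Cmd.wp, hC.b]
    repeat refine And.intro (by omega) ?_
    exact hT
  by_cases haM : a ∈ g.M
  · apply main 20
    refine (Tr.ite (T := 1) ?_ ?_ ?_).mono (by simp [isMarked]) fun _ h => h
    · simp [isMarked, hS₀, hC.b]
      omega
    · intro _
      refine (tr_of_wp (c := .skip) ?_).mono (by simp [Cmd.cost]) fun _ h => h
      refine ⟨{ g with stk := s }, ⟨hC₀, H.tables.congr rfl rfl rfl rfl, ?_, H.marks, by simp [hS₀],
        hst.2, by simpa [hS₀] using H.word_lt, by simpa [hS₀] using H.word,
        by simpa [hS₀] using H.par, by simpa [hS₀] using H.cur, by simpa [hS₀] using H.cc,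
        by simpa [hS₀] using H.nxt, by simpa [hS₀] using H.nc, by simpa [hS₀] using H.lev_le,
        by simpa [hS₀] using H.go, H.go_le, H.disj_xs, H.disj_cur, H.disj, ?_⟩, ?_⟩
      · have := hsearch.pop_marked haM
        simpa [hS₀] using this
      · intro h0
        simp [hgo] at h0
      · simp [potential, hs]
        omega
    · intro hm
      rw [hmem] at haM
      simp [isMarked, hS₀, hC.b, haM] at hm
  · have hcard := H.card_M hlt haM
    have hmarks : HasBits b (Function.update (S.a .mark) (a / b) (S.a .mark (a / b) ||| 2 ^ (a % b)))
        {x | x ∈ insert a g.M} := by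
      have e : {x | x ∈ insert a g.M} = insert a {x | x ∈ g.M} := by
        ext x
        exact Finset.mem_insert
      rw [e]
      exact H.marks.insert hbp a
    apply main 400
    refine (Tr.ite (T := 350) ?_ ?_ ?_).mono (by simp [isMarked]) fun _ h => h
    · simp [isMarked, hS₀, hC.b]
      omega
    · intro hm
      rw [hmem] at haM
      simp [isMarked, hS₀, hC.b, haM] at hm
    · intro _
      refine (Tr.seq_wp (T := 310) ?_).mono (by simp [setMark, Cmd.cost]) fun _ h => h
      simp [setMark, Cmd.wp, hS₀, hC.b]
      repeat refine And.intro (by omega) ?_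
      rw [← hS₀]
      set S₁ := S₀.put .mark (a / b) (S.a .mark (a / b) ||| 2 ^ (a % b)) with hS₁
      have hC₁ : Consts n b h S₁ := ⟨hC₀.n, hC₀.b, hC₀.hp, hC₀.nn, hC₀.hn⟩
      have a₁ : S₁.v .a = a := by simp [hS₁, hS₀]
      refine (Tr.ite (T := 300) (by simp) ?_ ?_).mono (by simp) fun _ h => h
      · intro hin
        have hin : a < h * (n + 1) := by
          by_contra hcon
          simp [a₁, hC₁.hn, hcon] at hin
        have hT₁ : Tables n b h (bitSet n h lb pred) S₁ := H.tables.congr (by simp [hS₁, hS₀])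
          (by simp [hS₁, hS₀]) (by simp [hS₁, hS₀]) (by simp [hS₁, hS₀])
        have p₁ : S₁.v .sp = s.length := by simp [hS₁, hS₀]
        have t₁ : S₁.a .stk = S.a .stk := by simp [hS₁, hS₀]
        refine (tr_pushChildren P hC₁ hT₁ (by rw [a₁]; exact hin) (by omega)).frame.mono le_rfl ?_
        rintro S' ⟨⟨g1, g2⟩, F⟩
        rw [a₁, p₁, t₁] at g2
        rw [p₁] at g1
        have hnew := hsearch.pop_inner P.layout hin
        set d₀ := child₀ (n + 1) (rankOf (bitSet n h lb pred)) a
        set d₁ := child₁ (n + 1) (rankOf (bitSet n h lb pred)) a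
        refine ⟨{ g with M := insert a g.M, stk := d₁ :: d₀ :: s }, ⟨hC₁.frame F rfl,
          hT₁.congr (F.a .bits rfl) (F.a .dir rfl) (F.a .pop rfl) (F.a .sz rfl), ?_, ?_, ?_, ?_, ?_,
          ?_, ?_, ?_, ?_, ?_, ?_, ?_, ?_, H.go_le, H.disj_xs, H.disj_cur, H.disj, ?_⟩, ?_⟩
        · rw [F.v .lev rfl, F.out rfl]
          simpa [hS₁, hS₀] using hnew
        · rw [F.a .mark rfl]
          simpa [hS₁, hS₀] using hmarks
        · simp [g1]
        · rw [g2]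
          refine ⟨by simp, ?_, ?_⟩
          · simp
          · exact (hst.2.update le_rfl _).update (by omega) _
        · rw [F.v .x rfl]; simpa [hS₁, hS₀] using H.word_lt
        · rw [F.v .x rfl, F.v .k rfl]; simpa [hS₁, hS₀] using H.word
        · rw [F.v .par rfl]; simpa [hS₁, hS₀] using H.par
        · rw [F.v .par rfl, F.a .set rfl, F.a .que rfl]; simpa [hS₁, hS₀] using H.cur
        · rw [F.v .cc rfl]; simpa [hS₁, hS₀] using H.cc
        · rw [F.v .par rfl, F.a .set rfl, F.a .que rfl]; simpa [hS₁, hS₀] using H.nxt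
        · rw [F.v .nc rfl]; simpa [hS₁, hS₀] using H.nc
        · rw [F.v .lev rfl]; simpa [hS₁, hS₀] using H.lev_le
        · rw [F.v .go rfl]; simpa [hS₁, hS₀] using H.go
        · intro h0
          simp [hgo] at h0
        · simp only [potential, hs, List.length_cons, hcard.1]
          omega
      · intro hout
        have hout : h * (n + 1) ≤ a := by
          by_contra hcon
          simp [a₁, hC₁.hn, Nat.lt_of_not_le hcon] at hout
        obtain ⟨p, hap, hp0, hpn, hV⟩ := hsearch.top_cell P.layout haM hout
        have hnew := hsearch
        rw [hap] at hnew
        have hnew := hnew.pop_top (hap ▸ haM) hp0 hpn hV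
        rw [← hap] at hnew
        have l₁ : S₁.v .lev = S.v .lev := by simp [hS₁, hS₀]
        have q₁ : S₁.v .par = S.v .par := by simp [hS₁, hS₀]
        have c₁ : S₁.v .nc = g.nc := by simp [hS₁, hS₀, H.nc]
        have hlev := H.lev_le
        refine (tr_report P hC₁ (A := g.nxt) (c := 1 - S.v .par) hpn (by rw [a₁, hap])
          (by omega) (by rw [q₁]; exact H.par) (by rw [q₁]) ?_ ?_).frame.mono (by omega) ?_
        · rw [c₁]
          simpa [hS₁, hS₀] using H.nxt
        · intro q hq
          exact ((H.search.mem_nxt q).1 hq).2.1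
        · rintro S' ⟨⟨g1, g2, g3, g4, g5⟩, F⟩
          rw [q₁] at g3 g4
          refine ⟨{ g with M := insert a g.M, stk := s, nxt := insert p g.nxt, nc := S'.v .nc },
            ⟨hC₁.frame F rfl,
            ?_, ?_, ?_, ?_, ?_, ?_,
            ?_, ?_, ?_, ?_, ?_, rfl, ?_, ?_, H.go_le, H.disj_xs, H.disj_cur, H.disj, ?_⟩, ?_⟩
          · exact H.tables.congr (by simp [F.a .bits rfl, hS₁, hS₀])
              (by simp [F.a .dir rfl, hS₁, hS₀]) (by simp [F.a .pop rfl, hS₁, hS₀])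
              (by simp [F.a .sz rfl, hS₁, hS₀])
          · rw [F.v .lev rfl, g1]
            simpa [hS₁, hS₀] using hnew
          · rw [F.a .mark rfl]
            simpa [hS₁, hS₀] using hmarks
          · rw [F.v .sp rfl]; simp [hS₁, hS₀]
          · rw [F.a .stk rfl]; simpa [hS₁, hS₀] using hst.2
          · rw [F.v .x rfl]; simpa [hS₁, hS₀] using H.word_lt
          · rw [F.v .x rfl, F.v .k rfl]; simpa [hS₁, hS₀] using H.word
          · rw [F.v .par rfl]; simpa [hS₁, hS₀] using H.par
          · rw [F.v .par rfl, q₁]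
            exact H.cur.congr (by simpa [hS₁, hS₀] using g3) (by simpa [hS₁, hS₀] using g4)
          · rw [F.v .cc rfl]; simpa [hS₁, hS₀] using H.cc
          · rw [F.v .par rfl, q₁]
            exact g2
          · rw [F.v .lev rfl]; simpa [hS₁, hS₀] using H.lev_le
          · rw [F.v .go rfl]; simpa [hS₁, hS₀] using H.go
          · intro h0
            simp [hgo] at h0
          · simp only [potential, hs, List.length_cons, hcard.1]
            omega

end LoopInv

end WheelerLCP

namespace WheelerLCP

open Finset Cmd Ex

set_option linter.constructorNameAsVariable false
set_option linter.unusedSimpArgs false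

variable {μ : Mach} {n σ b h : ℕ} {lb pred V : ℕ → ℕ}

theorem bitLen_eq {x : ℕ} (hx : x ≠ 0) : bitLen x = Nat.log 2 x + 1 := by simp [bitLen, hx]

namespace LoopInv

variable {g : Ghost} {S : St}

theorem xs_eq_empty (H : LoopInv n b h lb pred V g S) (hx : S.v .x = 0) : g.xs = ∅ := by
  rw [eq_empty_iff_forall_notMem]
  intro i hi
  obtain ⟨o, ho, -⟩ := (H.word i).1 hi
  simp [hx] at ho

theorem tr_takePos (P : Par μ n σ b h lb pred V) (H : LoopInv n b h lb pred V g S)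
    (hgo : g.go = 1) (hs : g.stk = []) (hx : S.v .x ≠ 0) :
    ∃ T, Tr μ takePos T S (Next (LoopInv n b h lb pred V) (potential n h) (T + 20) g) := by
  have hW := P.big
  have hXp := P.X_pow
  have hXs := P.X_stk
  obtain ⟨hp1, hp2, hp3⟩ := P.pows
  have hC := H.consts
  set x := S.v .x with hxv
  set k := S.v .k with hkv
  set y := Nat.log 2 x with hyv
  have hxl := H.word_lt
  have hsz := H.tables.sz x hxl
  rw [bitLen_eq hx] at hsz
  have hy : x.testBit y = true := testBit_log hx
  have hyx : 2 ^ y ≤ x := Nat.pow_log_le_self 2 hx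
  have hyl : y < 2 ^ y := Nat.lt_two_pow_self
  have hi : k * b + y ∈ g.xs := (H.word _).2 ⟨y, hy, rfl⟩
  have hin := ((H.search.todo _).1 (Or.inr (Or.inl hi))).2.1
  have hcard := H.card_I hi
  have hxor : x ^^^ 2 ^ y < 2 ^ b := Nat.xor_lt_two_pow hxl (by omega)
  have hle := P.model.length_edges_le (i := k * b + y) hin.le
  refine ⟨200 * (h + 1) + 80, ?_⟩
  unfold takePos
  refine (Tr.seq_wp (T := 200 * (h + 1) + 70) ?_).mono (by simp [Cmd.cost]; linarith) fun _ h => h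
  simp [Cmd.wp, ← hxv, hsz, ← hyv]
  repeat refine And.intro (by omega) ?_
  refine (Tr.seq_wp (T := 200 * (h + 1) + 60) ?_).mono (by simp [Cmd.cost]; linarith) fun _ h => h
  simp [Cmd.wp]
  repeat refine And.intro (by omega) ?_
  refine (Tr.seq_wp (T := 200 * (h + 1) + 50) ?_).mono (by simp [Cmd.cost]; linarith) fun _ h => h
  simp [Cmd.wp, ← hxv]
  repeat refine And.intro (by omega) ?_
  refine (Tr.seq_wp (T := 200 * (h + 1) + 40) ?_).mono (by simp [Cmd.cost]; linarith) fun _ h => h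
  simp [Cmd.wp, ← hkv, hC.b]
  repeat refine And.intro (by omega) ?_
  refine (Tr.seq (T₁ := 200 * (h + 1)) (T₂ := 40) ((tr_degSum P ?_ ?_ ?_).frame.mono le_rfl
    ?_)).mono le_rfl fun _ h => h
  · exact ⟨by simp [hC.n], by simp [hC.b], by simp [hC.hp], by simp [hC.nn], by simp [hC.hn]⟩
  · exact H.tables.congr rfl rfl rfl rfl
  · simp; omega
  rintro S' ⟨g1, F⟩
  simp only [St.set_v_self] at g1
  refine (tr_of_wp ?_).mono (by simp [Cmd.cost]) fun _ h => h
  simp [Cmd.wp, g1]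
  repeat refine And.intro (by omega) ?_
  set d := (edges n pred (k * b + y)).length with hd
  refine ⟨{ g with stk := [d], I := insert (k * b + y) g.I, xs := g.xs.erase (k * b + y) }, ⟨?_, ?_, ?_, ?_, ?_, ?_, ?_, ?_, ?_, ?_, ?_, ?_, ?_, ?_, ?_,
      H.go_le, ?_, ?_, ?_, ?_⟩, ?_⟩
  · exact ⟨by simp [F.v .n rfl, hC.n], by simp [F.v .b rfl, hC.b], by simp [F.v .hp rfl, hC.hp],
      by simp [F.v .nn rfl, hC.nn], by simp [F.v .hn rfl, hC.hn]⟩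
  · exact H.tables.congr (by simp [F.a .bits rfl]) (by simp [F.a .dir rfl]) (by simp [F.a .pop rfl])
      (by simp [F.a .sz rfl])
  · have h1 := H.search
    rw [hs] at h1
    have h2 := h1.begin_visit hi
    simpa [F.v .lev rfl, F.out rfl] using h2
  · simpa [F.a .mark rfl] using H.marks
  · simp
  · exact ⟨by simp, trivial⟩
  · simpa [F.v .x rfl] using hxor
  · intro i
    simp only [St.set_v_ne _ _ (show Var.x ≠ Var.sp by decide),
      St.set_v_ne _ _ (show Var.k ≠ Var.sp by decide), St.put_v, F.v .x rfl, F.v .k rfl]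
    simp [← hkv]
    rw [H.word, ← hxv, ← hkv]
    constructor
    · rintro ⟨hne, o, ho, rfl⟩
      refine ⟨o, ?_, rfl⟩
      have : y ≠ o := fun e => hne (by rw [e])
      rw [ho, Nat.testBit_two_pow_of_ne this]
      simp
    · rintro ⟨o, ho, rfl⟩
      have hoy : y ≠ o := by
        rintro rfl
        exact ho (by rw [hy, Nat.testBit_two_pow_self])
      refine ⟨by omega, o, ?_, rfl⟩
      rw [Nat.testBit_two_pow_of_ne hoy] at ho
      simpa using ho
  · simpa [F.v .par rfl] using H.par
  · simpa [F.v .par rfl, F.a .set rfl, F.a .que rfl] using H.cur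
  · simpa [F.v .cc rfl] using H.cc
  · simpa [F.v .par rfl, F.a .set rfl, F.a .que rfl] using H.nxt
  · simpa [F.v .nc rfl] using H.nc
  · simpa [F.v .lev rfl] using H.lev_le
  · simpa [F.v .go rfl] using H.go
  · rw [disjoint_left]
    intro j hj hj'
    rw [mem_erase] at hj'
    rcases mem_insert.1 hj with rfl | hj
    · exact hj'.1 rfl
    · exact disjoint_left.1 H.disj_xs hj hj'.2
  · rw [disjoint_left]
    intro j hj hj'
    rcases mem_insert.1 hj with rfl | hj
    · exact disjoint_left.1 H.disj hi hj'
    · exact disjoint_left.1 H.disj_cur hj hj'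
  · exact H.disj.mono_left (erase_subset _ _)
  · intro h0
    simp [hgo] at h0
  · have h1 : 400 * (h + 1) * (n - #g.I) = 400 * (h + 1) * (n - (#g.I + 1)) + 400 * (h + 1) := by
      rw [show n - #g.I = n - (#g.I + 1) + 1 by omega]
      ring
    simp only [potential, hs, hcard.1, List.length_cons, List.length_nil, h1]
    omega

theorem tr_takeWord (P : Par μ n σ b h lb pred V) (H : LoopInv n b h lb pred V g S)
    (hgo : g.go = 1) (hx : S.v .x = 0) (hcc : g.cc ≠ 0) :
    ∃ T, Tr μ takeWord T S (Next (LoopInv n b h lb pred V) (potential n h) (T + 20) g) := by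
  have hW := P.big
  have hbp := P.b_pos
  obtain ⟨hp1, hp2, hp3⟩ := P.pows
  have hC := H.consts
  have hpar := H.par
  obtain ⟨c, hc⟩ : ∃ c, g.cc = c + 1 := ⟨g.cc - 1, by omega⟩
  have hvc : S.v .cc = c + 1 := by rw [H.cc, hc]
  have hcur := H.cur
  rw [hc] at hcur
  have hlt : ∀ a ∈ g.cur, a < n := fun a ha => ((H.search.todo a).1 (Or.inr (Or.inr ha))).2.1
  have hcle := hcur.le_div hbp hlt
  have hX := P.X_bits n (by omega)
  have hnb := Nat.div_le_self n b
  set q := S.v .par with hqv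
  set k := S.a .que (c * 2 + q) with hkv
  have hk : S.a .set (k * 2 + q) ≠ 0 := (hcur.mem k).2 ⟨c, by omega, rfl⟩
  have hkn : k ≤ n / b := by
    obtain ⟨a, ha, he⟩ := (hcur.ne_zero_iff hbp k).1 hk
    rw [← he]
    exact Nat.div_le_div_right (hlt a ha).le
  have hxl : S.a .set (k * 2 + q) < 2 ^ b := hcur.bits.lt k
  have hxs := H.xs_eq_empty hx
  have htake := hcur.take hbp
  rw [← hkv] at htake
  refine ⟨60, ?_⟩
  refine (tr_of_wp ?_).mono (by simp [takeWord, Cmd.cost]) fun _ h => h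
  simp [takeWord, Cmd.wp, hvc, ← hqv, ← hkv]
  repeat refine And.intro (by omega) ?_
  refine ⟨{ g with xs := {a ∈ g.cur | a / b = k}, cur := {a ∈ g.cur | a / b ≠ k}, cc := c },
    ⟨?_, H.tables.congr rfl rfl rfl rfl, ?_, H.marks, by simpa using H.sp, H.stk, by simpa using hxl,
      ?_, by simpa using hpar, by simpa [← hqv] using htake, by simp, ?_, by simpa using H.nc,
      by simpa using H.lev_le,
      by simpa using H.go, H.go_le, ?_, ?_, ?_, ?_⟩, ?_⟩
  · exact ⟨by simp [hC.n], by simp [hC.b], by simp [hC.hp], by simp [hC.nn], by simp [hC.hn]⟩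
  · have h1 := H.search.regroup (xs' := {a ∈ g.cur | a / b = k})
      (cur' := {a ∈ g.cur | a / b ≠ k}) ?_
    · simpa using h1
    · intro i
      rw [hxs]
      simp only [mem_filter, notMem_empty, false_or]
      tauto
  · intro i
    simp
    constructor
    · rintro ⟨h1, h2⟩
      refine ⟨i % b, ?_, by rw [← h2, mul_comm, Nat.div_add_mod]⟩
      refine (hcur.bits k _).2 ⟨Nat.mod_lt _ hbp, ?_⟩
      rw [← h2, mul_comm, Nat.div_add_mod]
      exact h1
    · rintro ⟨o, ho, rfl⟩
      obtain ⟨h1, h2⟩ := (hcur.bits k o).1 ho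
      refine ⟨h2, ?_⟩
      rw [mul_comm, Nat.mul_add_div hbp, Nat.div_eq_of_lt h1, add_zero]
  · have h1 := H.nxt
    rw [← hqv] at h1
    have h2 : SetRep b (1 - q) (Function.update (S.a .set) (k * 2 + q) 0) (S.a .que) g.nc g.nxt := by
      refine h1.congr (fun j => ?_) fun j => rfl
      rw [Function.update_of_ne (by omega)]
    simpa [← hqv] using h2
  · exact H.disj_cur.mono_right (filter_subset _ _)
  · exact H.disj_cur.mono_right (filter_subset _ _)
  · rw [disjoint_left]
    intro a ha ha'
    simp only [mem_filter] at ha ha'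
    exact ha'.2 ha.2
  · intro h0
    simp [hgo] at h0
  · simp only [potential, hc]
    omega

theorem tr_nextLevel (P : Par μ n σ b h lb pred V) (H : LoopInv n b h lb pred V g S)
    (hgo : g.go = 1) (hs : g.stk = []) (hx : S.v .x = 0) (hcc : g.cc = 0) (hnc : g.nc ≠ 0) :
    ∃ T, Tr μ nextLevel T S (Next (LoopInv n b h lb pred V) (potential n h) (T + 20) g) := by
  have hW := P.big
  have hbp := P.b_pos
  obtain ⟨hp1, hp2, hp3⟩ := P.pows
  have hC := H.consts
  have hpar := H.par
  have hxs := H.xs_eq_empty hx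
  have hcur := H.cur
  rw [hcc] at hcur
  have hce := hcur.eq_empty hbp
  have hlt : ∀ a ∈ g.nxt, a < n := fun a ha => ((H.search.mem_nxt a).1 ha).2.1
  have hnle := H.nxt.le_div hbp hlt
  have hnb := Nat.div_le_self n b
  have hlev : S.v .lev < n := by
    obtain ⟨a, ha, -⟩ := (H.nxt.ne_zero_iff hbp _).1 ((H.nxt.mem _).2 ⟨0, by omega, rfl⟩)
    obtain ⟨h1, h2, -, h3⟩ := (H.search.mem_nxt a).1 ha
    rw [← h3]
    exact P.layout.val_lt h1 h2
  have hvn := H.nc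
  have hw := H.word
  rw [hxs] at hw
  refine ⟨40, ?_⟩
  refine (tr_of_wp ?_).mono (by simp [nextLevel, Cmd.cost]) fun _ h => h
  simp [nextLevel, Cmd.wp, hvn]
  repeat refine And.intro (by omega) ?_
  refine ⟨{ g with xs := ∅, cur := g.nxt, nxt := ∅, cc := g.nc, nc := 0 },
    ⟨?_, H.tables.congr rfl rfl rfl rfl, ?_, H.marks, by simpa using H.sp, H.stk,
      by simpa using H.word_lt, by simpa using hw, by simp, by simpa using H.nxt, by simp, ?_, by simp,
      by simp; omega, by simpa using H.go, H.go_le, by simp, ?_, by simp, ?_⟩, ?_⟩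
  · exact ⟨by simp [hC.n], by simp [hC.b], by simp [hC.hp], by simp [hC.nn], by simp [hC.hn]⟩
  · have h1 := H.search
    rw [hs, hxs, hce] at h1
    simpa [hs] using h1.next_level P.layout
  · have h1 : 1 - (1 - S.v .par) = S.v .par := by omega
    refine SetRep.empty fun k => ?_
    simp [h1]
    exact hcur.word_eq_zero k
  · rw [disjoint_left]
    intro i hi hi'
    have h1 := ((H.search.todo i).1 (Or.inl hi)).2.2
    have h2 := ((H.search.mem_nxt i).1 hi').2.2.2
    omega
  · intro h0
    simp [hgo] at h0
  · simp only [potential, hcc]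
    omega

end LoopInv

theorem tr_mainLoop (P : Par μ n σ b h lb pred V) {S : St} (hC : Consts n b h S)
    (hT : Tables n b h (bitSet n h lb pred) S)
    (H : StartInv n b h (starts n h (labelSeq n h lb pred)) S) (hcc : S.v .cc = 0)
    (hsp : S.v .sp = 0) :
    Tr μ mainLoop (2000 * ((h + 1) * (n + 1))) S fun S' =>
      ∃ M I lev, SearchInv n h (labelSeq n h lb pred) (fun i => (edges n pred i).length) V
        (child₀ (n + 1) (rankOf (bitSet n h lb pred))) (child₁ (n + 1) (rankOf (bitSet n h lb pred)))
        M [] I ∅ ∅ ∅ lev S'.out := by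
  have hW := P.big
  have hbp := P.b_pos
  obtain ⟨hp1, hp2, hp3⟩ := P.pows
  have hmul : (h + 1) * (n + 1) = (h + 1) * n + (h + 1) := by ring
  have hmul' : 400 * (h + 1) * n = 400 * ((h + 1) * n) := by ring
  have hnh : n ≤ (h + 1) * n := Nat.le_mul_of_pos_left _ (by omega)
  have hnb := Nat.div_le_self n b
  have hpos : 1 ≤ (h + 1) * (n + 1) := Nat.succ_le_of_lt (by positivity)
  set A : Finset ℕ := {p ∈ range n | 0 < p ∧ h * (n + 1) + p ∈ starts n h (labelSeq n h lb pred)}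
    with hA
  have hncle := H.nxt.le_div (n := n) hbp (fun a ha => by
    simp only [mem_filter, mem_range] at ha
    exact ha.1)
  unfold mainLoop
  refine (Tr.seq_wp (T := 1600 * ((h + 1) * (n + 1)) + 350) ?_).mono
    (by simp only [Cmd.cost, time_num]; linarith) fun _ h => h
  simp [Cmd.wp]
  repeat refine And.intro (by omega) ?_
  refine (Tr.seq_wp (T := 1600 * ((h + 1) * (n + 1)) + 320) ?_).mono
    (by simp only [Cmd.cost, time_num]; linarith) fun _ h => h
  simp [Cmd.wp]
  repeat refine And.intro (by omega) ?_
  refine Tr.wh_next (LoopInv n b h lb pred V) (potential n h) ?_ ?_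
    (a := ⟨starts n h (labelSeq n h lb pred), [], ∅, ∅, ∅, A, 0, S.v .nc, 1⟩) ?_ ?_ ?_
  · simp
  · intro g S H hgo
    have hgo : g.go = 1 := by
      have h1 := H.go
      have h2 := H.go_le
      simp [h1] at hgo
      omega
    rcases hstk : g.stk with _ | ⟨a, s⟩
    · have hsp : S.v .sp = 0 := by rw [H.sp, hstk]; rfl
      by_cases hx : S.v .x = 0
      · by_cases hcc : g.cc = 0
        · have hcv : S.v .cc = 0 := by rw [H.cc, hcc]
          by_cases hnc : g.nc = 0
          · have hnv : S.v .nc = 0 := by rw [H.nc, hnc]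
            have hC := H.consts
            refine ⟨10, ?_⟩
            refine (Tr.ite (T := 8) (by simp) (by simp [hsp]) fun _ => ?_).mono (by simp) fun _ h => h
            refine (Tr.ite (T := 6) (by simp) (by simp [hx]) fun _ => ?_).mono (by simp) fun _ h => h
            refine (Tr.ite (T := 4) (by simp) (by simp [hcv]) fun _ => ?_).mono (by simp) fun _ h => h
            refine (Tr.ite (T := 2) (by simp) (by simp [hnv]) fun _ => ?_).mono (by simp) fun _ h => h
            refine (tr_of_wp ?_).mono (by simp [Cmd.cost]) fun _ h => h
            simp [Cmd.wp]
            repeat refine And.intro (by omega) ?_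
            have hcur := H.cur
            have hnxt := H.nxt
            rw [hcc] at hcur
            rw [hnc] at hnxt
            refine ⟨{ g with go := 0 }, ⟨?_, H.tables.congr rfl rfl rfl rfl,
              by simpa using H.search, H.marks, by simpa using H.sp, H.stk, by simpa using H.word_lt,
              by simpa using H.word, by simpa using H.par, by simpa using H.cur, by simpa using H.cc,
              by simpa using H.nxt, by simpa using H.nc, by simpa using H.lev_le, by simp, by simp,
              H.disj_xs, H.disj_cur, H.disj, ?_⟩, ?_⟩
            · exact ⟨by simp [hC.n], by simp [hC.b], by simp [hC.hp], by simp [hC.nn],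
                by simp [hC.hn]⟩
            · exact fun _ => ⟨hstk, H.xs_eq_empty hx, hcur.eq_empty hbp, hnxt.eq_empty hbp⟩
            · simp only [potential, hgo, time_rd]
              omega
          · obtain ⟨T, hT⟩ := H.tr_nextLevel P hgo hstk hx hcc hnc
            refine ⟨T + 8, ?_⟩
            refine (Tr.ite (T := T + 6) (by simp) (by simp [hsp]) fun _ => ?_).mono
              (by simp; omega) fun _ h => h
            refine (Tr.ite (T := T + 4) (by simp) (by simp [hx]) fun _ => ?_).mono
              (by simp; omega) fun _ h => h
            refine (Tr.ite (T := T + 2) (by simp) (by simp [hcv]) fun _ => ?_).mono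
              (by simp; omega) fun _ h => h
            refine (Tr.ite (T := T) (by simp) (fun _ => ?_) (by simp [H.nc, hnc])).mono
              (by simp; omega) fun _ h => h
            refine hT.mono le_rfl ?_
            rintro S' ⟨g', h1, h2⟩
            exact ⟨g', h1, by simp only [time_rd]; omega⟩
        · obtain ⟨T, hT⟩ := H.tr_takeWord P hgo hx hcc
          refine ⟨T + 6, ?_⟩
          refine (Tr.ite (T := T + 4) (by simp) (by simp [hsp]) fun _ => ?_).mono
            (by simp; omega) fun _ h => h
          refine (Tr.ite (T := T + 2) (by simp) (by simp [hx]) fun _ => ?_).mono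
            (by simp; omega) fun _ h => h
          refine (Tr.ite (T := T) (by simp) (fun _ => ?_) (by simp [H.cc, hcc])).mono
            (by simp; omega) fun _ h => h
          refine hT.mono le_rfl ?_
          rintro S' ⟨g', h1, h2⟩
          exact ⟨g', h1, by simp only [time_rd]; omega⟩
      · obtain ⟨T, hT⟩ := H.tr_takePos P hgo hstk hx
        refine ⟨T + 4, ?_⟩
        refine (Tr.ite (T := T + 2) (by simp) (by simp [hsp]) fun _ => ?_).mono
          (by simp; omega) fun _ h => h
        refine (Tr.ite (T := T) (by simp) (fun _ => ?_) (by simp [hx])).mono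
          (by simp; omega) fun _ h => h
        refine hT.mono le_rfl ?_
        rintro S' ⟨g', h1, h2⟩
        exact ⟨g', h1, by simp only [time_rd]; omega⟩
    · obtain ⟨T, hT⟩ := H.tr_visit P hgo hstk
      refine ⟨T + 2, ?_⟩
      refine (Tr.ite (T := T) (by simp) (fun _ => ?_) (by simp [H.sp, hstk])).mono
        (by simp; omega) fun _ h => h
      refine hT.mono le_rfl ?_
      rintro S' ⟨g', h1, h2⟩
      exact ⟨g', h1, by simp only [time_rd]; omega⟩
  · refine ⟨?_, hT.congr rfl rfl rfl rfl, ?_, H.marks, by simpa using hsp, trivial, by simp,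
      by simp, by simp [H.par], ?_, by simpa using hcc, ?_, by simp, by simp [H.lev], by simp,
      by simp, by simp, by simp, by simp, by simp⟩
    · exact ⟨by simp [hC.n], by simp [hC.b], by simp [hC.hp], by simp [hC.nn], by simp [hC.hn]⟩
    · simpa [H.lev] using H.searchInv P.layout
    · refine SetRep.empty fun k => ?_
      simpa [H.par] using H.set_zero k
    · simpa [H.par] using H.nxt
  · have : (h + 1) * (n + 1) - #(starts n h (labelSeq n h lb pred)) ≤ (h + 1) * (n + 1) :=
      Nat.sub_le _ _
    simp only [potential, card_empty, Nat.sub_zero, List.length_nil, time_rd]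
    omega
  · intro g S H hgo
    have h1 : g.go = 0 := by
      have := H.go
      simp [this] at hgo
      exact hgo
    obtain ⟨h2, h3, h4, h5⟩ := H.done h1
    have h6 := H.search
    rw [h2, h3, h4, h5] at h6
    exact ⟨_, _, _, h6⟩

end WheelerLCP

namespace WheelerLCP

open Finset

set_option linter.constructorNameAsVariable false
set_option linter.unusedSimpArgs false

variable {μ : Mach} {n σ b h : ℕ} {lb pred V : ℕ → ℕ}

/-! ## The whole program -/

/-- The initial state. -/
def St.init (n σ w : ℕ) : St where
  v
    | .n => n
    | .sg => σ
    | .wd => w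
    | _ => 0
  a _ _ := 0
  out := []

/-- A bound for the time of the whole program. -/
def lcpTime (q n b h : ℕ) : ℕ :=
  30 * (b + 1) + (100 * 2 ^ b + ((q + 50) * (n + 1) + (50 * (h + 1) +
    ((q + 60 * (h + 2) + 60) * (n + 2) + (500 * (2 * 2 ^ h) + ((q + 150 * (h + 1) + 50) * (2 * n + 2) +
      (60 * (2 * (h * (n + 1)) / b + 2) + 2000 * ((h + 1) * (n + 1)))))))))

theorem tr_lcpCmd (P : Par μ n σ b h lb pred V) (w : ℕ) :
    Tr μ lcpCmd (lcpTime μ.q n b h) (St.init n σ w) fun S' =>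
      ∃ M I lev, SearchInv n h (labelSeq n h lb pred) (fun i => (edges n pred i).length) V
        (child₀ (n + 1) (rankOf (bitSet n h lb pred))) (child₁ (n + 1) (rankOf (bitSet n h lb pred)))
        M [] I ∅ ∅ ∅ lev S'.out := by
  refine Tr.seq ((tr_mkPow P rfl).frame.mono le_rfl ?_)
  rintro S₁ ⟨⟨hb, hpw⟩, F₁⟩
  refine Tr.seq ((tr_mkTables P hpw (F₁.a _ rfl) (F₁.a _ rfl)).frame.mono le_rfl ?_)
  rintro S₂ ⟨⟨hpop, hsz⟩, F₂⟩
  have hn₂ : S₂.v .n = n := by rw [F₂.v _ rfl, F₁.v _ rfl]; rfl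
  refine Tr.seq ((tr_mkLabels P hn₂).frame.mono le_rfl ?_)
  rintro S₃ ⟨⟨hm, hlab⟩, F₃⟩
  have hn₃ : S₃.v .n = n := by rw [F₃.v _ rfl, hn₂]
  refine Tr.seq ((tr_mkHeight P hn₃ hm).frame.mono le_rfl ?_)
  rintro S₄ ⟨⟨_, hhp, hnn, hhn⟩, F₄⟩
  have hC₄ : Consts n b h S₄ :=
    ⟨by rw [F₄.v _ rfl, hn₃], by rw [F₄.v _ rfl, F₃.v _ rfl, F₂.v _ rfl, hb], hhp, hnn, hhn⟩
  have hlab₄ : ∀ t < n, S₄.a .lab (rk lb t) = lb t := by rw [F₄.a _ rfl]; exact hlab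
  refine Tr.seq ((tr_mkCounts P hC₄.n hhp hlab₄
    (by rw [F₄.a _ rfl, F₃.a _ rfl, F₂.a _ rfl, F₁.a _ rfl]; rfl)).frame.mono le_rfl ?_)
  rintro S₅ ⟨hcnt, F₅⟩
  have hC₅ := hC₄.frame F₅ rfl
  have ha : ∀ r, r = Arr.mark ∨ r = .set ∨ r = .que ∨ r = .bits → S₅.a r = fun _ => 0 := by
    rintro r (rfl | rfl | rfl | rfl) <;>
    · rw [F₅.a _ rfl, F₄.a _ rfl, F₃.a _ rfl, F₂.a _ rfl, F₁.a _ rfl]; rfl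
  have hv : ∀ x, x = Var.par ∨ x = .lev ∨ x = .nc ∨ x = .cc ∨ x = .sp → S₅.v x = 0 := by
    rintro r (rfl | rfl | rfl | rfl | rfl) <;>
    · rw [F₅.v _ rfl, F₄.v _ rfl, F₃.v _ rfl, F₂.v _ rfl, F₁.v _ rfl]; rfl
  have hout : S₅.out = [] := by
    rw [F₅.out rfl, F₄.out rfl, F₃.out rfl, F₂.out rfl, F₁.out rfl]; rfl
  have H₅ : StartInv n b h ∅ S₅ := by
    refine ⟨?_, hv _ (by simp), hv _ (by simp), ?_, ?_, ?_, ?_, ?_⟩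
    · rw [ha _ (by simp)]; simpa using HasBits.zero
    · rw [hv _ (by simp)]
      simpa using SetRep.empty (b := b) (c := 1) (que := S₅.a .que) (set := S₅.a .set)
        (by simp [ha])
    · simp [ha]
    · simp [hout]
    · simp [hout]
    · simp [hout]
  refine Tr.seq ((tr_mkStarts P hC₅ hcnt H₅).frame.mono le_rfl ?_)
  rintro S₆ ⟨⟨H₆, hcnt₆⟩, F₆⟩
  have hC₆ := hC₅.frame F₆ rfl
  refine Tr.seq ((tr_fill P hC₆ (by rw [F₆.v _ rfl, F₅.v _ rfl, F₄.v _ rfl, hm])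
    (by rw [F₆.a _ rfl, F₅.a _ rfl]; exact hlab₄) (fun l hl => hcnt₆ l (by omega))
    (by rw [F₆.a _ rfl]; exact ha _ (by simp))).frame.mono le_rfl ?_)
  rintro S₇ ⟨hbits, F₇⟩
  have hC₇ := hC₆.frame F₇ rfl
  have hpop₇ : S₇.a .pop = S₂.a .pop := by
    rw [F₇.a _ rfl, F₆.a _ rfl, F₅.a _ rfl, F₄.a _ rfl, F₃.a _ rfl]
  refine Tr.seq ((tr_mkDir P hC₇ hbits (by rw [hpop₇]; exact hpop)).frame.mono le_rfl ?_)
  rintro S₈ ⟨hdir, F₈⟩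
  refine tr_mainLoop P (hC₇.frame F₈ rfl) ⟨?_, hdir, ?_, ?_⟩ (H₆.congr ?_ ?_ ?_ ?_ ?_ ?_ ?_) ?_ ?_
  · rw [F₈.a _ rfl]; exact hbits
  · rw [F₈.a _ rfl, hpop₇]; exact hpop
  · rw [F₈.a _ rfl, F₇.a _ rfl, F₆.a _ rfl, F₅.a _ rfl, F₄.a _ rfl, F₃.a _ rfl]; exact hsz
  · rw [F₈.a _ rfl, F₇.a _ rfl]
  · rw [F₈.v _ rfl, F₇.v _ rfl]
  · rw [F₈.v _ rfl, F₇.v _ rfl]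
  · rw [F₈.a _ rfl, F₇.a _ rfl]
  · rw [F₈.a _ rfl, F₇.a _ rfl]
  · rw [F₈.v _ rfl, F₇.v _ rfl]
  · rw [F₈.out rfl, F₇.out rfl]
  · rw [F₈.v _ rfl, F₇.v _ rfl, F₆.v _ rfl]; exact hv _ (by simp)
  · rw [F₈.v _ rfl, F₇.v _ rfl, F₆.v _ rfl]; exact hv _ (by simp)

theorem Rep.init {X w n σ : ℕ} (hn : n < 2 ^ w) (hσ : σ < 2 ^ w) :
    Rep X (Config.init w n σ) (St.init n σ w) where
  reg x := by
    have hw : w < 2 ^ w := Nat.lt_two_pow_self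
    cases x <;> simp [Config.init, St.init, Var.idx, Var.ctorIdx, Nat.mod_eq_of_lt, hn, hσ, hw]
  mem _ _ := rfl
  out := rfl
  peak := Nat.zero_le _

theorem SearchInv.streams {V' : Type*} [Fintype V'] {G : LabeledGraph V' σ} {ε Dg c₀ c₁ : ℕ → ℕ}
    {M I : Finset ℕ} {lev : ℕ} {out : List (ℕ × ℕ)} (L : Layout n h ε Dg V c₀ c₁)
    (H : SearchInv n h ε Dg V c₀ c₁ M [] I ∅ ∅ ∅ lev out) (hn : Fintype.card V' = n)
    (hV : ∀ p, 0 < p → p < n → G.reducedLCP (p + 1) = V p) : StreamsReducedLCP G out where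
  nodup := H.nodup
  mem_iff i := by
    rw [H.mem_out, hn]
    constructor
    · rintro ⟨p, rfl, h0, hp, -⟩; omega
    · rintro ⟨h2, hi⟩
      exact ⟨i - 1, by omega, by omega, by omega, H.done L _ (by omega) (by omega)⟩
  value r hr := by
    obtain ⟨p, rfl, -⟩ := H.out_val r hr
    have : p + 1 ∈ out.map Prod.fst := List.mem_map.2 ⟨_, hr, rfl⟩
    obtain ⟨p', hp, h0, hlt, -⟩ := (H.mem_out _).1 this
    obtain rfl : p = p' := by omega
    exact (hV p h0 hlt).symm
  sorted := H.sorted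

theorem rk_lt_of_model (M : Model n lb pred V) (hle : ∀ t < n, lb t ≤ σ) :
    rk lb (n - 1) + 1 ≤ n ∧ rk lb (n - 1) + 1 ≤ σ := by
  have hn := M.n_pos
  constructor
  · have : rk lb (n - 1) ≤ #(range (n - 1)) := card_filter_le _ _
    rw [card_range] at this
    omega
  · have key : ∀ t < n, rk lb t + 1 ≤ lb t := by
      intro t
      induction t with
      | zero => intro h; have := M.lb_pos 0 h; rw [rk_zero]; omega
      | succ t ih =>
        intro h
        have h1 := ih (by omega)
        have h2 := M.lb_mono t (t + 1) (by omega) h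
        rw [rk_succ]
        split_ifs with h3 <;> omega
    exact (key _ (by omega)).trans (hle _ (by omega))

end WheelerLCP

namespace WheelerLCP

open Finset

/-! ## Resources -/

/-- A bound for the indices of the arrays. -/
def lcpSize (n b h : ℕ) : ℕ :=
  2 ^ b + 2 * 2 ^ h + 2 * ((2 * (h * (n + 1)) + 2 * (n + 1)) / b) + h + 4

/-- How the block length `b` and the height `h` depend on the number `n` of nodes and the number `m`
of labels that occur, where `s` is the length of the binary representation of the alphabet size. -/
structure Scale (n m s b h : ℕ) : Prop where
  n_pos : 0 < n
  b_pos : 0 < b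
  h_pos : 0 < h
  n_lt : n < 2 ^ b * 2 ^ b
  b_min : ∀ k < b, 2 ^ k * 2 ^ k ≤ n
  m_lt : m < 2 ^ h
  h_min : ∀ k < h, 2 ^ k ≤ m
  m_le : m ≤ n
  m_lt' : m < 2 ^ s
  s_pos : 0 < s

theorem exists_scale {n m s : ℕ} (hn : 0 < n) (hm : 0 < m) (hmn : m ≤ n) (hms : m < 2 ^ s) :
    ∃ b h, Scale n m s b h := by
  have hb : ∃ b, n < 2 ^ b * 2 ^ b := by
    have : n < 2 ^ n := Nat.lt_two_pow_self
    exact ⟨n, this.trans_le (Nat.le_mul_of_pos_right _ (by positivity))⟩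
  have hh : ∃ h, m < 2 ^ h := ⟨s, hms⟩
  classical
  refine ⟨Nat.find hb, Nat.find hh, hn, ?_, ?_, Nat.find_spec hb,
    fun k hk => not_lt.1 (Nat.find_min hb hk), Nat.find_spec hh,
    fun k hk => not_lt.1 (Nat.find_min hh hk), hmn, hms, ?_⟩
  · rw [Nat.find_pos]; simp; omega
  · rw [Nat.find_pos]; simp; omega
  · rcases Nat.eq_zero_or_pos s with rfl | h
    · simp at hms; omega
    · exact h

namespace Scale

variable {n m s b h : ℕ}

theorem sq_le (H : Scale n m s b h) : 2 ^ b * 2 ^ b ≤ 4 * n := by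
  obtain ⟨c, rfl⟩ : ∃ c, b = c + 1 := ⟨b - 1, by have := H.b_pos; omega⟩
  have := H.b_min c (by omega)
  rw [pow_succ]
  nlinarith

theorem pow_h_le (H : Scale n m s b h) : 2 ^ h ≤ 2 * m := by
  obtain ⟨c, rfl⟩ : ∃ c, h = c + 1 := ⟨h - 1, by have := H.h_pos; omega⟩
  have := H.h_min c (by omega)
  rw [pow_succ]
  omega

theorem h_le (H : Scale n m s b h) : h ≤ s := by
  by_contra hc
  have := H.h_min s (by omega)
  have := H.m_lt'
  omega

theorem h_le_two_mul (H : Scale n m s b h) : h ≤ 2 * b := by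
  by_contra hc
  have h1 := H.h_min (2 * b) (by omega)
  have h2 := H.m_le
  have h3 := H.n_lt
  rw [← pow_add, ← two_mul] at h3
  omega

theorem b_mul_pow_le (H : Scale n m s b h) : b * 2 ^ b ≤ 4 * n :=
  (Nat.mul_le_mul_right _ Nat.lt_two_pow_self.le).trans H.sq_le

theorem pow_b_le (H : Scale n m s b h) : 2 ^ b ≤ 4 * n :=
  (Nat.le_mul_of_pos_right _ (by positivity)).trans H.sq_le

theorem b_le (H : Scale n m s b h) : b ≤ 4 * n := Nat.lt_two_pow_self.le.trans H.pow_b_le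

theorem pow_h_le' (H : Scale n m s b h) : 2 ^ h ≤ 2 * n := by
  have := H.pow_h_le
  have := H.m_le
  omega

theorem le_prod (H : Scale n m s b h) : n ≤ n * s ∧ s ≤ n * s :=
  ⟨Nat.le_mul_of_pos_right _ H.s_pos, Nat.le_mul_of_pos_left _ H.n_pos⟩

theorem time_le (H : Scale n m s b h) {q K : ℕ} (hq : q ≤ K * s) :
    lcpTime q n b h ≤ (9 * K + 14000) * (n * s) := by
  have hn := H.n_pos
  have hs := H.s_pos
  have hh := H.h_le
  obtain ⟨hp1, hp2⟩ := H.le_prod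
  have e1 : (q + 50) * (n + 1) ≤ (K * s + 50 * s) * (2 * n) := by gcongr <;> omega
  have e2 : (q + 60 * (h + 2) + 60) * (n + 2) ≤ (K * s + 240 * s) * (3 * n) :=
    Nat.mul_le_mul (by omega) (by omega)
  have e3 : (q + 150 * (h + 1) + 50) * (2 * n + 2) ≤ (K * s + 350 * s) * (4 * n) :=
    Nat.mul_le_mul (by omega) (by omega)
  have e4 : h * (n + 1) ≤ s * (2 * n) := by gcongr; omega
  have e5 : 2 * (h * (n + 1)) / b ≤ 2 * (h * (n + 1)) := Nat.div_le_self _ _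
  have e6 : (h + 1) * (n + 1) ≤ (2 * s) * (2 * n) := by gcongr <;> omega
  have hb := H.b_le
  have hB := H.pow_b_le
  have hH := H.pow_h_le'
  unfold lcpTime
  nlinarith

theorem size_le (H : Scale n m s b h) : (b + s) * lcpSize n b h ≤ 86 * (n * s) := by
  have hn := H.n_pos
  have hs := H.s_pos
  have hb := H.b_pos
  have hh := H.h_le
  obtain ⟨hp1, hp2⟩ := H.le_prod
  have hB := H.b_mul_pow_le
  have hB' : s * 2 ^ b ≤ s * (4 * n) := by gcongr; exact H.pow_b_le
  have hH : s * 2 ^ h ≤ s * (2 * n) := by gcongr; exact H.pow_h_le'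
  have hH' : b * 2 ^ h ≤ 4 * (n * s) := by
    rcases le_total h b with hc | hc
    · have : b * 2 ^ h ≤ b * 2 ^ b := by gcongr; omega
      omega
    · have : b * 2 ^ h ≤ s * 2 ^ h := by gcongr; omega
      nlinarith
  set a := 2 * (h * (n + 1)) + 2 * (n + 1) with ha
  have e1 : b * (a / b) ≤ 8 * (n * s) := by
    have : h * (n + 1) ≤ s * (2 * n) := by gcongr; omega
    have := Nat.mul_div_le a b
    nlinarith
  have e2 : s * (a / b) ≤ s * (12 * n) := by
    gcongr
    rw [Nat.div_le_iff_le_mul_add_pred hb]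
    have : h * (n + 1) ≤ 2 * b * (n + 1) := by gcongr; exact H.h_le_two_mul
    have : 1 * n ≤ b * n := by gcongr; omega
    nlinarith
  have e3 : b * h ≤ 4 * n * s := by gcongr; exact H.b_le
  have e4 : s * h ≤ s * (2 * n) := by
    gcongr; exact Nat.lt_two_pow_self.le.trans H.pow_h_le'
  have e5 := H.b_le
  unfold lcpSize
  rw [← ha]
  nlinarith

theorem space_le (H : Scale n m s b h) (R : ℕ) :
    (b + s) * (R + 16 * lcpSize n b h) ≤ (5 * R + 1376) * (n * s) := by
  have h1 := H.size_le
  have h2 : (b + s) * R ≤ 5 * (n * s) * R := by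
    gcongr
    have := H.b_le
    have := H.le_prod
    omega
  nlinarith

theorem lt_words (H : Scale n m s b h) {σ N : ℕ} (hN : n + σ < N) :
    1000 * (n + σ + b + 2 ^ b * 2 ^ b + h + 2 ^ h + h * (n + 1) + 1) ≤ 2 ^ 18 * (N * N) ∧
      16 * lcpSize n b h ≤ 2 ^ 18 * (N * N) := by
  have hn := H.n_pos
  have hh : h ≤ 2 * n := Nat.lt_two_pow_self.le.trans H.pow_h_le'
  have hH := H.pow_h_le'
  have hb := H.b_le
  have hB := H.sq_le
  have hB' := H.pow_b_le
  have e1 : h * (n + 1) ≤ 2 * (N * N) :=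
    mul_assoc 2 N N ▸ Nat.mul_le_mul (by omega) (by omega)
  have e2 : 1 * N ≤ N * N := by gcongr; omega
  constructor
  · omega
  · unfold lcpSize
    have := Nat.div_le_self (2 * (h * (n + 1)) + 2 * (n + 1)) b
    omega

end Scale

theorem lt_two_pow_lg (x : ℕ) : x < 2 ^ lg x := Nat.lt_pow_succ_log_self (by norm_num) x

theorem lg_le {x k : ℕ} (hk : 0 < k) (h : x < 2 ^ k) : lg x ≤ k := Nat.log_lt_of_lt_pow' (by omega) h

theorem lg_add_le {n σ b : ℕ} (h : n < 2 ^ b * 2 ^ b) : lg (n + σ) ≤ 2 * (b + lg σ) := by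
  have h1 := lt_two_pow_lg σ
  have hs : 0 < lg σ := Nat.succ_pos _
  refine lg_le (by omega) ?_
  rw [mul_add, two_mul, two_mul, pow_add, pow_add, pow_add]
  have h2 : 2 ≤ 2 ^ lg σ := Nat.le_self_pow (by omega) 2
  have h3 : 0 < 2 ^ b * 2 ^ b := by positivity
  have h4 : 2 ^ b * 2 ^ b * (2 * 2 ^ lg σ) ≤ 2 ^ b * 2 ^ b * (2 ^ lg σ * 2 ^ lg σ) := by gcongr
  nlinarith

end WheelerLCP

/-- One program, for words of `w = Θ(log (n + σ))` bits with a suitable lower constant `k`: the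
time and space constant `C` depends only on the constant `K` in the upper bounds for the word size
and for the query time `q` of the index. -/
theorem mainTheorem2 :
    ∃ (P : Prog) (k : ℕ), ∀ K : ℕ, ∃ C : ℕ,
      ∀ (n σ w q : ℕ) (V : Type*) [Fintype V] (G : LabeledGraph V σ)
        (lt : V → V → Prop) (v : Fin n ≃ V),
        0 < n →
        G.Deterministic →
        G.IsPseudoforest →
        G.IsWheelerOrder lt →
        (∀ i j, i < j → lt (v i) (v j)) →
        Function.Injective G.infStr →
        k * lg (n + σ) ≤ w → w ≤ K * lg (n + σ) →
        q ≤ K * lg σ →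
        ∃ (t : ℕ) (s : Config),
          Exec w q (FMIndex.ofGraph G v) P (Config.init w n σ) t s ∧
          StreamsReducedLCP G s.out ∧
          t ≤ C * (n * lg σ) ∧
          workingBits w P s ≤ C * (n * lg σ) := by
  refine ⟨lcpCmd.compile, 20, fun K =>
    ⟨9 * K + 14000 + 2 * K * (5 * lcpCmd.compile.regs + 1376), ?_⟩⟩
  intro n σ w q V _ G lt v hn hdet hG hW hv hinj hw hwK hq
  obtain ⟨lb, pred, val, M, hle, hin, hout, hval⟩ := exists_model v hn hdet hG hW hv hinj
  obtain ⟨hmn, hmσ⟩ := rk_lt_of_model M hle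
  obtain ⟨b, h, H⟩ := exists_scale hn (Nat.succ_pos _) hmn (hmσ.trans_lt (lt_two_pow_lg σ))
  set N := 2 ^ lg (n + σ) with hN
  have hNlt : n + σ < N := lt_two_pow_lg _
  have hN2 : 2 ^ 18 * (N * N) ≤ 2 ^ w := by
    rw [hN, ← pow_add, ← pow_add]
    have : 0 < lg (n + σ) := Nat.succ_pos _
    exact Nat.pow_le_pow_right (by norm_num) (by omega)
  obtain ⟨hbig, hX⟩ := H.lt_words hNlt
  have P : Par ⟨2 ^ w, lcpSize n b h, q, FMIndex.ofGraph G v⟩ n σ b h lb pred val := by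
    refine ⟨hbig.trans hN2, ?_, ?_, ?_, ?_, H.b_pos, H.h_pos, H.n_lt, H.b_min, H.m_lt, H.h_min, M,
      hle, hin, hout⟩ <;> simp only [lcpSize] <;> have hb := Nat.two_pow_pos b
    · omega
    · omega
    · intro a ha
      have := Nat.div_le_div_right (c := b) ha
      omega
    · omega
  obtain ⟨t, S, hS, ht, M', I, lev, hI⟩ := tr_lcpCmd P w
  have hNw : N * 1 ≤ N * N := by gcongr; omega
  obtain ⟨s, hs, hR⟩ := hS.exec (w := w) rfl (hX.trans hN2) (by omega) _
    (Rep.init (by omega) (by omega))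
  refine ⟨t, s, hs, ?_, ?_, ?_⟩
  · rw [hR.out]
    exact hI.streams P.layout (by rw [← Fintype.card_congr v, Fintype.card_fin]) hval
  · refine ht.trans ((H.time_le hq).trans ?_)
    exact Nat.mul_le_mul_right _ (Nat.le_add_right _ _)
  · calc workingBits w lcpCmd.compile s
        ≤ K * (2 * (b + lg σ)) * (lcpCmd.compile.regs + 16 * lcpSize n b h) := by
          refine Nat.mul_le_mul (hwK.trans ?_) (Nat.add_le_add_left hR.peak _)
          gcongr
          exact lg_add_le H.n_lt
      _ = 2 * K * ((b + lg σ) * (lcpCmd.compile.regs + 16 * lcpSize n b h)) := by ring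
      _ ≤ 2 * K * ((5 * lcpCmd.compile.regs + 1376) * (n * lg σ)) := Nat.mul_le_mul_left _ (H.space_le _)
      _ = 2 * K * (5 * lcpCmd.compile.regs + 1376) * (n * lg σ) := by ring
      _ ≤ _ := Nat.mul_le_mul_right _ (Nat.le_add_left _ _)
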